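/- Let $p=\partial/\partial x$, $q=\partial/\partial y$, $r=\partial/\partial z$. For an open set $U\subset\mathbb R^3$ let $\mathcal F(U)$ be the smooth real-valued functions on $U$ and $\{1\}\subset\mathcal F(U)$ the constants. For a finite-dimensional Lie algebra $\mathfrak h$ of vector fields on $U$ (bracket = commutator), $H^1(\mathfrak h,\mathcal F(U)/\{1\})=\ker\delta_1/\operatorname{im}\delta_0$ is the quotient of the linear maps $F:\mathfrak h\to\mathcal F(U)/\{1\}$ satisfying $v\langle F;w\rangle-w\langle F;v\rangle-\langle F;[v,w]\rangle=0$ by the maps $\langle\delta_0\lambda;v\rangle=v(\lambda)$. In each case below the listed vector fields are a basis of a Lie algebra $\mathfrak h$ of vector fields on $U$. A list of operators $v+\eta_v$, depending linearly on real constants, stands for the linear maps $F$ with $\langle F;v\rangle=\eta_v$ on the basis elements $v$ shown and $\langle F;v\rangle=0$ on the other basis elements. The assertion in each case is that for all values of the constants $F$ is a $1$-cocycle, and that sending the constants to $[F]$ is a linear isomorphism from the space of constants onto $H^1(\mathfrak h,\mathcal F(U)/\{1\})$; in particular every class has exactly one representative of the given form, and "$0$" means $H^1=0$. Throughout $s,t,n,l_0,b_0\ge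 0$ are integers, and $U=\mathbb R^3$ except in case 7C. * **4A** ($0\le t\le s$): $x^iq+\binom it x^{i-t}r$ for $0\le i\le s$ (this is $x^iq$ if $i<t$), $p$, $xp-tzr$, $yq+zr$. Cocycles: $0$. * **4C**: $x^iq$ ($0\le i\le s$), $p$, $yq$, $xp$, $x^ly^{n-b}r$ ($0\le b\le n$, $0\le l\le l_0+sb$), $zr$. Cocycles: $0$. * **4D**: $x^iq$ ($0\le i\le s$), $p$, $yq$, $xp$, $r$, $zr$, $z^2r$. Cocycles: $z^2r+cz$. * **5A\***: $x^iq+x^ir$ ($0\le i\le s$), $p$, $xp$, $yq+zr$, $x^2p+sxyq+sxzr$. Cocycles: $x^2p+sxyq+sxzr+cx$. * **5C**: $x^iq$ ($0\le i\le s$), $p$, $yq$, $xp$, $x^2p+sxyq+(l_0+sn)xzr$, $x^ly^{n-b}r$ ($0\le b\le n$, $0\le l\le l_0+sb$), $zr$. Cocycles: $x^2p+sxyq+(l_0+sn)xzr+cx$. * **5D**: $x^iq$ ($0\le i\le s$), $p$, $yq$, $xp$, $x^2p+sxyq$, $r$, $zr$, $z^2r$. Cocycles: $x^2p+sxyq+cx$,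 $z^2r+dz$. * **7C** ($n\ge1$; $U$ is the half-space $y>0$, or the half-space $y<0$): $p$, $2xp+yq$, $x^2p+xyq$, $x^ly^{-n}r$ ($0\le l\le n$), $zr$. Cocycles: $x^2p+xyq+cy^2$. * **17A$_1$** ($a\in\mathbb R$): $p$, $q$, $xp+zr$, $yq$, $x^2p+(2x+az)zr$, $y^2q$. Cocycles: $x^2p+(2x+az)zr+bx+cz$, $y^2q+dy$. * **17A$_2$** ($a\in\mathbb R$, $a\ne0$): $p$, $q$, $xp+azr$, $yq+zr$, $x^2p+2axzr$, $y^2q+2yzr$. Cocycles: $x^2p+2axzr+cx$, $y^2q+2yzr+dy$. * **17C**: $p$, $q$, $xp$, $yq$, $x^2p+l_0xzr$, $y^2q+b_0yzr$, $x^ly^br$ ($0\le l\le l_0$, $0\le b\le b_0$), $zr$. Cocycles: $x^2p+l_0xzr+cx$, $y^2q+b_0yzr+dy$. * **17D**: $p$, $xp$, $x^2p$, $q$, $yq$, $y^2q$, $r$, $zr$, $z^2r$. Cocycles: $x^2p+ax$, $y^2q+cy$, $z^2r+dz$. Moreover, for integers $0\le t\le s$ consider Amaldi's family **5A**: the vector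 fields $x^iq+\binom it x^{i-t}r$ ($0\le i\le s$), $p$, $xp-tzr$, $yq+zr$, $x^2p+sxyq+(s-2t)xzr$. Their span is a Lie algebra if and only if $t=0$, and for $t=0$ it is the algebra 5A\*. If any of the vector fields $yp$, $zr$, $x^ly^{n-b}r$ ($0\le b\le n$, $0\le l\le l_0+sb$) are adjoined, the span can likewise be a Lie algebra only if $t=0$. -/

import Mathlib

open scoped ContDiff

noncomputable section

/-! ## Degree one Lie algebra cohomology with coefficients in a module -/

namespace LieH1

open LieModule.Cohomology

variable (R L M : Type*) [CommRing R] [LieRing L] [LieAlgebra R L] [AddCommGroup M] [Module R M]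
  [LieRingModule L M] [LieModule R L M]

/-- The coboundary `δ₀ : M → Hom(L, M)`, `⟨δ₀ m; v⟩ = v · m`. -/
def d0 : M →ₗ[R] oneCochain R L M :=
  { toFun := fun m =>
      { toFun := fun v => ⁅v, m⁆
        map_add' := fun v w => add_lie v w m
        map_smul' := fun a v => smul_lie a v m }
    map_add' := fun m m' => by ext v; exact lie_add v m m'
    map_smul' := fun a m => by ext v; exact lie_smul a v m }

@[simp] theorem d0_apply (m : M) (v : L) : d0 R L M m v = ⁅v, m⁆ := rfl

/-- The `1`-cocycles: linear maps `F` with `v · F w - w · F v - F [v, w] = 0`. -/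
def cocycles : Submodule R (oneCochain R L M) := LinearMap.ker (d₁₂ R L M)

theorem mem_cocycles (F : oneCochain R L M) :
    F ∈ cocycles R L M ↔ ∀ v w : L, ⁅v, F w⁆ - ⁅w, F v⁆ - F ⁅v, w⁆ = 0 := by
  rw [cocycles, LinearMap.mem_ker]
  constructor
  · intro h v w
    rw [← d₁₂_apply_apply, h]
    rfl
  · intro h
    apply Subtype.ext
    ext v w
    exact h v w

/-- The `1`-coboundaries: the range of `δ₀`. -/
def coboundaries : Submodule R (oneCochain R L M) := LinearMap.range (d0 R L M)

theorem coboundaries_le_cocycles : coboundaries R L M ≤ cocycles R L M := by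
  rintro _ ⟨m, rfl⟩
  rw [mem_cocycles]
  intro v w
  simp

/-- `H¹(L, M) = ker δ₁ / im δ₀`. -/
abbrev H1 : Type _ := cocycles R L M ⧸ (coboundaries R L M).submoduleOf (cocycles R L M)

end LieH1

/-! ## Functions and vector fields on open subsets of `ℝ³` -/

namespace VF3

/-- Coordinate space `ℝ³`; the coordinates `x, y, z` are numbered `0, 1, 2`. -/
abbrev R3 : Type := Fin 3 → ℝ

variable {U : TopologicalSpace.Opens R3}

/-- Extension by zero of a function on `U`. -/
def ext0 (f : U → ℝ) : R3 → ℝ := Function.extend Subtype.val f 0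

theorem ext0_apply (f : U → ℝ) (u : U) : ext0 f u = f u :=
  Subtype.val_injective.extend_apply f 0 u

theorem ext0_restrict (g : R3 → ℝ) : Set.EqOn (ext0 fun u : U => g u) g U :=
  fun a ha => ext0_apply (fun u : U => g u) ⟨a, ha⟩

theorem eqOn_nhds {f g : R3 → ℝ} (h : Set.EqOn f g U) (u : U) : f =ᶠ[nhds (u : R3)] g :=
  h.eventuallyEq_of_mem (U.isOpen.mem_nhds u.2)

variable (U) in
/-- The algebra `𝓕(U)` of smooth real-valued functions on the open set `U`. -/
def smoothFun : Subalgebra ℝ (U → ℝ) where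
  carrier := {f | ContDiffOn ℝ ∞ (ext0 f) U}
  mul_mem' {f g} hf hg := (ContDiffOn.mul hf hg).congr fun a ha => by
    simp only [ext0_apply _ ⟨a, ha⟩, Pi.mul_apply]
  add_mem' {f g} hf hg := (ContDiffOn.add hf hg).congr fun a ha => by
    simp only [ext0_apply _ ⟨a, ha⟩, Pi.add_apply]
  algebraMap_mem' c := contDiffOn_const.congr (ext0_restrict fun _ => c)

variable (U) in
/-- `𝓕(U)` as a type. -/
abbrev Fun : Type := smoothFun U

/-- A function that is smooth on `U`, as an element of `𝓕(U)`. -/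
def Fun.of (g : R3 → ℝ) (hg : ContDiffOn ℝ ∞ g U) : Fun U :=
  ⟨fun u => g u, hg.congr (ext0_restrict g)⟩

theorem Fun.differentiableAt (f : Fun U) (u : U) : DifferentiableAt ℝ (ext0 f.1) u :=
  (f.2.contDiffAt (U.isOpen.mem_nhds u.2)).differentiableAt (by simp)

theorem ext0_add (f g : U → ℝ) : Set.EqOn (ext0 (f + g)) (ext0 f + ext0 g) U := fun a ha => by
  simp only [Pi.add_apply, ext0_apply _ ⟨a, ha⟩]

theorem ext0_mul (f g : U → ℝ) : Set.EqOn (ext0 (f * g)) (ext0 f * ext0 g) U := fun a ha => by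
  simp only [Pi.mul_apply, ext0_apply _ ⟨a, ha⟩]

theorem ext0_smul (c : ℝ) (f : U → ℝ) : Set.EqOn (ext0 (c • f)) (c • ext0 f) U := fun a ha => by
  simp only [Pi.smul_apply, ext0_apply _ ⟨a, ha⟩]

/-- The partial derivative `∂f/∂xᵢ` of a smooth function on `U`. -/
def pderivFun (i : Fin 3) (f : Fun U) : Fun U :=
  Fun.of (fun a => fderiv ℝ (ext0 f.1) a (Pi.single i 1))
    ((f.2.fderiv_of_isOpen (m := ∞) U.isOpen (by simp)).clm_apply contDiffOn_const)

theorem pderivFun_apply (i : Fin 3) (f : Fun U) (u : U) :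
    (pderivFun i f).1 u = fderiv ℝ (ext0 f.1) u (Pi.single i 1) := rfl

variable (U) in
/-- The Lie algebra `𝓥(U)` of smooth vector fields on `U`: derivations of `𝓕(U)`, with the
commutator bracket. -/
abbrev VF : Type := Derivation ℝ (Fun U) (Fun U)

variable (U) in
/-- The coordinate vector field `∂/∂xᵢ`. -/
def pderiv (i : Fin 3) : VF U :=
  Derivation.mk'
    { toFun := pderivFun i
      map_add' := fun f g => by
        apply Subtype.ext
        funext u
        show fderiv ℝ (ext0 (f.1 + g.1)) u (Pi.single i 1) =
          fderiv ℝ (ext0 f.1) u (Pi.single i 1) + fderiv ℝ (ext0 g.1) u (Pi.single i 1)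
        rw [(eqOn_nhds (ext0_add f.1 g.1) u).fderiv_eq,
          fderiv_add (f.differentiableAt u) (g.differentiableAt u)]
        rfl
      map_smul' := fun c f => by
        apply Subtype.ext
        funext u
        show fderiv ℝ (ext0 (c • f.1)) u (Pi.single i 1) =
          c • fderiv ℝ (ext0 f.1) u (Pi.single i 1)
        rw [(eqOn_nhds (ext0_smul c f.1) u).fderiv_eq,
          fderiv_const_smul (f.differentiableAt u)]
        rfl }
    fun f g => by
      apply Subtype.ext
      funext u
      show fderiv ℝ (ext0 (f.1 * g.1)) u (Pi.single i 1) =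
        f.1 u * fderiv ℝ (ext0 g.1) u (Pi.single i 1) +
          g.1 u * fderiv ℝ (ext0 f.1) u (Pi.single i 1)
      rw [(eqOn_nhds (ext0_mul f.1 g.1) u).fderiv_eq,
        fderiv_mul (f.differentiableAt u) (g.differentiableAt u)]
      simp [ext0_apply]

theorem pderiv_apply (i : Fin 3) (f : Fun U) (u : U) :
    (pderiv U i f).1 u = fderiv ℝ (ext0 f.1) u (Pi.single i 1) := rfl

variable (U) in
/-- The `𝓥(U)`-submodule `{1}` of constant functions. -/
def constants : LieSubmodule ℝ (VF U) (Fun U) where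
  __ := LinearMap.range (Algebra.linearMap ℝ (Fun U))
  lie_mem := by
    rintro D _ ⟨c, rfl⟩
    exact ⟨0, by simp⟩

variable (U) in
/-- The coefficient module `𝓕(U)/{1}`. -/
abbrev FunModConst : Type := Fun U ⧸ constants U

/-- The coordinate functions. -/
def coord (i : Fin 3) : Fun U := Fun.of (fun a => a i) (contDiff_apply ℝ ℝ i).contDiffOn

/-- Let `v` be a (finite) family of vector fields on `U`, and for each `c ∈ ℝᵐ` let `η c` be a
family of functions, with `η c i` to be thought of as added to `v i`. The assertion is that `v` is
a basis of a Lie algebra `𝔥` of vector fields, that for every `c` the linear map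
`F_c : 𝔥 → 𝓕(U)/{1}` with `⟨F_c; v i⟩ = η c i` is a `1`-cocycle, and that `c ↦ [F_c]` is a linear
isomorphism of `ℝᵐ` onto `H¹(𝔥, 𝓕(U)/{1})`, so that every cohomology class is represented by
exactly one `F_c`. -/
def HasCohomology {ι : Type} {m : ℕ} (v : ι → VF U) (η : (Fin m → ℝ) → ι → Fun U) : Prop :=
  ∃ (𝔥 : LieSubalgebra ℝ (VF U)) (B : Module.Basis ι ℝ 𝔥)
    (Φ : (Fin m → ℝ) ≃ₗ[ℝ] LieH1.H1 ℝ 𝔥 (FunModConst U)),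
    (∀ i, (B i : VF U) = v i) ∧
    ∀ c, ∃ F : LieH1.cocycles ℝ 𝔥 (FunModConst U),
      (∀ i, F.1 (B i) = LieSubmodule.Quotient.mk (η c i)) ∧ Φ c = Submodule.Quotient.mk F

/-- The linear span of a set of vector fields is a Lie algebra. -/
def SpanIsLieAlgebra (S : Set (VF U)) : Prop :=
  ∃ 𝔥 : LieSubalgebra ℝ (VF U), 𝔥.toSubmodule = Submodule.span ℝ S

end VF3

/-! ## The algebras and the cocycles -/

namespace TypeIII

open VF3

variable {U : TopologicalSpace.Opens R3}

/-- The coordinate function `x`. -/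
def x : Fun U := coord 0
/-- The coordinate function `y`. -/
def y : Fun U := coord 1
/-- The coordinate function `z`. -/
def z : Fun U := coord 2

/-- The vector field `f p + g q + h r`, where `p = ∂/∂x`, `q = ∂/∂y`, `r = ∂/∂z`. -/
def vf (f g h : Fun U) : VF U := f • pderiv U 0 + g • pderiv U 1 + h • pderiv U 2

/-- `xⁱq + C(i,t) xⁱ⁻ᵗ r`; for `i < t` the binomial coefficient vanishes and this is `xⁱq`. -/
def twisted (t i : ℕ) : VF U := vf 0 (x ^ i) ((i.choose t : ℝ) • x ^ (i - t))

/-- 4A: `xⁱq + C(i,t) xⁱ⁻ᵗ r` (`0 ≤ i ≤ s`), `p`, `xp - tzr`, `yq + zr`. -/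
def gen4A (s t : ℕ) : Fin (s + 1) ⊕ Fin 3 → VF U :=
  Sum.elim (fun i => twisted t i) ![vf 1 0 0, vf x 0 (-(t : ℝ) • z), vf 0 y z]

/-- The pairs `(b, l)` with `0 ≤ b ≤ n` and `0 ≤ l ≤ l₀ + s b`. -/
abbrev Pairs (s n l₀ : ℕ) : Type := (b : Fin (n + 1)) × Fin (l₀ + s * b + 1)

/-- 4C: `xⁱq` (`0 ≤ i ≤ s`), `xˡyⁿ⁻ᵇ r` (`0 ≤ b ≤ n`, `0 ≤ l ≤ l₀ + s b`), `p`, `yq`, `xp`, `zr`. -/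
def gen4C (s n l₀ : ℕ) : Fin (s + 1) ⊕ Pairs s n l₀ ⊕ Fin 4 → VF U :=
  Sum.elim (fun i => vf 0 (x ^ (i : ℕ)) 0) <|
    Sum.elim (fun bl => vf 0 0 (x ^ (bl.2 : ℕ) * y ^ (n - bl.1 : ℕ)))
      ![vf 1 0 0, vf 0 y 0, vf x 0 0, vf 0 0 z]

/-- 4D: `xⁱq` (`0 ≤ i ≤ s`), `p`, `yq`, `xp`, `r`, `zr`, `z²r`. -/
def gen4D (s : ℕ) : Fin (s + 1) ⊕ Fin 6 → VF U :=
  Sum.elim (fun i => vf 0 (x ^ (i : ℕ)) 0)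
    ![vf 1 0 0, vf 0 y 0, vf x 0 0, vf 0 0 1, vf 0 0 z, vf 0 0 (z ^ 2)]

/-- The cocycles `z²r + cz` for 4D. -/
def coc4D (s : ℕ) (c : Fin 1 → ℝ) : Fin (s + 1) ⊕ Fin 6 → Fun U :=
  Sum.elim (fun _ => 0) ![0, 0, 0, 0, 0, c 0 • z]

/-- 5A*: `xⁱq + xⁱr` (`0 ≤ i ≤ s`), `p`, `xp`, `yq + zr`, `x²p + sxyq + sxzr`. -/
def gen5Astar (s : ℕ) : Fin (s + 1) ⊕ Fin 4 → VF U :=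
  Sum.elim (fun i => vf 0 (x ^ (i : ℕ)) (x ^ (i : ℕ)))
    ![vf 1 0 0, vf x 0 0, vf 0 y z, vf (x ^ 2) ((s : ℝ) • (x * y)) ((s : ℝ) • (x * z))]

/-- The cocycles `x²p + sxyq + sxzr + cx` for 5A*. -/
def coc5Astar (s : ℕ) (c : Fin 1 → ℝ) : Fin (s + 1) ⊕ Fin 4 → Fun U :=
  Sum.elim (fun _ => 0) ![0, 0, 0, c 0 • x]

/-- 5C: `xⁱq` (`0 ≤ i ≤ s`), `xˡyⁿ⁻ᵇ r` (`0 ≤ b ≤ n`, `0 ≤ l ≤ l₀ + s b`), `p`, `yq`, `xp`, `zr`,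
`x²p + sxyq + (l₀ + sn)xzr`. -/
def gen5C (s n l₀ : ℕ) : Fin (s + 1) ⊕ Pairs s n l₀ ⊕ Fin 5 → VF U :=
  Sum.elim (fun i => vf 0 (x ^ (i : ℕ)) 0) <|
    Sum.elim (fun bl => vf 0 0 (x ^ (bl.2 : ℕ) * y ^ (n - bl.1 : ℕ)))
      ![vf 1 0 0, vf 0 y 0, vf x 0 0, vf 0 0 z,
        vf (x ^ 2) ((s : ℝ) • (x * y)) (((l₀ : ℝ) + s * n) • (x * z))]

/-- The cocycles `x²p + sxyq + (l₀ + sn)xzr + cx` for 5C. -/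
def coc5C (s n l₀ : ℕ) (c : Fin 1 → ℝ) : Fin (s + 1) ⊕ Pairs s n l₀ ⊕ Fin 5 → Fun U :=
  Sum.elim (fun _ => 0) <| Sum.elim (fun _ => 0) ![0, 0, 0, 0, c 0 • x]

/-- 5D: `xⁱq` (`0 ≤ i ≤ s`), `p`, `yq`, `xp`, `x²p + sxyq`, `r`, `zr`, `z²r`. -/
def gen5D (s : ℕ) : Fin (s + 1) ⊕ Fin 7 → VF U :=
  Sum.elim (fun i => vf 0 (x ^ (i : ℕ)) 0)
    ![vf 1 0 0, vf 0 y 0, vf x 0 0, vf (x ^ 2) ((s : ℝ) • (x * y)) 0,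
      vf 0 0 1, vf 0 0 z, vf 0 0 (z ^ 2)]

/-- The cocycles `x²p + sxyq + cx`, `z²r + dz` for 5D. -/
def coc5D (s : ℕ) (c : Fin 2 → ℝ) : Fin (s + 1) ⊕ Fin 7 → Fun U :=
  Sum.elim (fun _ => 0) ![0, 0, 0, c 0 • x, 0, 0, c 1 • z]

/-- For `ε > 0` the half-space `y > 0`, for `ε < 0` the half-space `y < 0`. -/
def halfSpace (ε : ℝ) : TopologicalSpace.Opens R3 :=
  ⟨{a | 0 < ε * a 1}, isOpen_lt continuous_const (by fun_prop)⟩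

/-- The function `1/y` on a half-space. -/
def yInv (ε : ℝ) : Fun (halfSpace ε) :=
  Fun.of (fun a => (a 1)⁻¹) <| (contDiff_apply ℝ ℝ (1 : Fin 3)).contDiffOn.inv fun a ha h => by
    have ha' : 0 < ε * a 1 := ha
    simp [h] at ha'

/-- 7C: `xˡy⁻ⁿ r` (`0 ≤ l ≤ n`), `p`, `2xp + yq`, `x²p + xyq`, `zr`. -/
def gen7C (ε : ℝ) (n : ℕ) : Fin (n + 1) ⊕ Fin 4 → VF (halfSpace ε) :=
  Sum.elim (fun l => vf 0 0 (x ^ (l : ℕ) * yInv ε ^ n))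
    ![vf 1 0 0, vf ((2 : ℝ) • x) y 0, vf (x ^ 2) (x * y) 0, vf 0 0 z]

/-- The cocycles `x²p + xyq + cy²` for 7C. -/
def coc7C (ε : ℝ) (n : ℕ) (c : Fin 1 → ℝ) : Fin (n + 1) ⊕ Fin 4 → Fun (halfSpace ε) :=
  Sum.elim (fun _ => 0) ![0, 0, c 0 • y ^ 2, 0]

/-- 17A₁: `p`, `q`, `xp + zr`, `yq`, `x²p + (2x + az)zr`, `y²q`. -/
def gen17A₁ (a : ℝ) : Fin 6 → VF U :=
  ![vf 1 0 0, vf 0 1 0, vf x 0 z, vf 0 y 0, vf (x ^ 2) 0 (((2 : ℝ) • x + a • z) * z),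
    vf 0 (y ^ 2) 0]

/-- The cocycles `x²p + (2x + az)zr + bx + cz`, `y²q + dy` for 17A₁. -/
def coc17A₁ (c : Fin 3 → ℝ) : Fin 6 → Fun U :=
  ![0, 0, 0, 0, c 0 • x + c 1 • z, c 2 • y]

/-- 17A₂: `p`, `q`, `xp + azr`, `yq + zr`, `x²p + 2axzr`, `y²q + 2yzr`. -/
def gen17A₂ (a : ℝ) : Fin 6 → VF U :=
  ![vf 1 0 0, vf 0 1 0, vf x 0 (a • z), vf 0 y z, vf (x ^ 2) 0 ((2 * a) • (x * z)),
    vf 0 (y ^ 2) ((2 : ℝ) • (y * z))]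

/-- The cocycles `x²p + 2axzr + cx`, `y²q + 2yzr + dy` for 17A₂. -/
def coc17A₂ (c : Fin 2 → ℝ) : Fin 6 → Fun U :=
  ![0, 0, 0, 0, c 0 • x, c 1 • y]

/-- 17C: `xˡyᵇ r` (`0 ≤ l ≤ l₀`, `0 ≤ b ≤ b₀`), `p`, `q`, `xp`, `yq`, `zr`, `x²p + l₀xzr`,
`y²q + b₀yzr`. -/
def gen17C (l₀ b₀ : ℕ) : (Fin (l₀ + 1) × Fin (b₀ + 1)) ⊕ Fin 7 → VF U :=
  Sum.elim (fun lb => vf 0 0 (x ^ (lb.1 : ℕ) * y ^ (lb.2 : ℕ)))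
    ![vf 1 0 0, vf 0 1 0, vf x 0 0, vf 0 y 0, vf 0 0 z,
      vf (x ^ 2) 0 ((l₀ : ℝ) • (x * z)), vf 0 (y ^ 2) ((b₀ : ℝ) • (y * z))]

/-- The cocycles `x²p + l₀xzr + cx`, `y²q + b₀yzr + dy` for 17C. -/
def coc17C (l₀ b₀ : ℕ) (c : Fin 2 → ℝ) : (Fin (l₀ + 1) × Fin (b₀ + 1)) ⊕ Fin 7 → Fun U :=
  Sum.elim (fun _ => 0) ![0, 0, 0, 0, 0, c 0 • x, c 1 • y]

/-- 17D: `p`, `xp`, `x²p`, `q`, `yq`, `y²q`, `r`, `zr`, `z²r`. -/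
def gen17D : Fin 9 → VF U :=
  ![vf 1 0 0, vf x 0 0, vf (x ^ 2) 0 0, vf 0 1 0, vf 0 y 0, vf 0 (y ^ 2) 0,
    vf 0 0 1, vf 0 0 z, vf 0 0 (z ^ 2)]

/-- The cocycles `x²p + ax`, `y²q + cy`, `z²r + dz` for 17D. -/
def coc17D (c : Fin 3 → ℝ) : Fin 9 → Fun U :=
  ![0, 0, c 0 • x, 0, 0, c 1 • y, 0, 0, c 2 • z]

/-- Amaldi's family 5A: `xⁱq + C(i,t) xⁱ⁻ᵗ r` (`0 ≤ i ≤ s`), `p`, `xp - tzr`, `yq + zr`,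
`x²p + sxyq + (s - 2t)xzr`. -/
def gen5A (s t : ℕ) : Set (VF U) :=
  Set.range (fun i : Fin (s + 1) => twisted t i) ∪
    {vf 1 0 0, vf x 0 (-(t : ℝ) • z), vf 0 y z,
      vf (x ^ 2) ((s : ℝ) • (x * y)) (((s : ℝ) - 2 * t) • (x * z))}

/-- The further elements that accompany the family 5A in print: `yp`, `zr` and
`xˡyⁿ⁻ᵇ r` (`0 ≤ b ≤ n`, `0 ≤ l ≤ l₀ + s b`). -/
def extra5A (s n l₀ : ℕ) : Set (VF U) :=
  {vf y 0 0, vf 0 0 z} ∪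
    Set.range fun bl : Pairs s n l₀ => vf 0 0 (x ^ (bl.2 : ℕ) * y ^ (n - bl.1 : ℕ))

end TypeIII

end

/-! A cocycle `F` is the same thing as the space of first order operators v + f with f in the class
⟨F; v⟩: the cocycle identity says that this space is closed under commutators, and its elements of
order zero are the constants. Changing `F` by a coboundary conjugates the operators by an
exponential (`shift`). Computing H¹ thus means bringing every operator algebra that lifts 𝔥 to a
normal form under conjugation; `Classifies` records such a normal form and
`hasCohomology_of_classifies` turns it into the statement about H¹.

On ℝ³ each algebra contains p, v₀ = q + θr, e₁ = xp + awr and e₂ = y(q + θr) + bwr, where w = z - θy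
and (a, b) ≠ (0, 0). `FullFrame.exists_shift` conjugates their terms of order zero away: p and v₀ by
integration along lines, e₁ and e₂ by solving w l'(w) = k(w) - k(0), which is possible because w
divides k(w) - k(0) (Hadamard). The other generators are eigenvectors of e₁ and e₂, and their
brackets with p and v₀ are already lifted without term of order zero. Hence p and v₀ map the term f
of such a generator to constants, so f = cx + dy + k(w), and the eigenvalue equations leave only
terms of the same weight as the generator. If p, q, r, xp, yq, zr all occur, the weights allow only
multiples of x, y, z on x²p + ..., y²q + ..., z²r; if e₁ = xp + zr, then z has the weight of x,
whence the extra term cz. These terms are not coboundaries, since a function whose coboundary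
vanishes on p, v₀, e₁, e₂ is constant.

On the half-space y⁻ⁿr takes the place of q or r. After p, y⁻ⁿr and 2xp + yq have been normalized,
multiples of log y remain available for conjugation; they remove the term in x on x²p + xyq but
never reach y², so cy² survives.

In the family with parameter t, bracketing x²p + sxyq + (s-2t)xzr with the top field gives a nonzero
multiple of t xˢ⁻ᵗ⁺¹r. For t ≠ 0 further brackets produce xᴹr for arbitrarily large M, which no
finite-dimensional span contains. -/

noncomputable section

/-! ## Integrals depending smoothly on a parameter -/

-- Differentiation under the integral sign. The required dominating function is constant: the
-- partial derivative is continuous, hence bounded on the compact product of a closed ball around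
-- `a₀` with [0, 1].
open Set Filter MeasureTheory in
theorem hasFDerivAt_integral_unit {H E : Type} [NormedAddCommGroup H] [NormedSpace ℝ H]
    [FiniteDimensional ℝ H] [NormedAddCommGroup E] [NormedSpace ℝ E] {U : Set H}
    {V : Set (H × ℝ)} (hU : IsOpen U) (hV : IsOpen V)
    (hUV : ∀ a ∈ U, ∀ t ∈ Icc (0 : ℝ) 1, (a, t) ∈ V) {G : H × ℝ → E}
    (hG : ContDiffOn ℝ ∞ G V) {a₀ : H} (ha₀ : a₀ ∈ U) :
    HasFDerivAt (fun a => ∫ t in (0 : ℝ)..1, G (a, t))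
      (∫ t in (0 : ℝ)..1, (fderiv ℝ G (a₀, t)).comp (ContinuousLinearMap.inl ℝ H ℝ)) a₀ := by
  have : ProperSpace H := FiniteDimensional.proper ℝ H
  obtain ⟨ε, hε, hball⟩ := Metric.nhds_basis_closedBall.mem_iff.1 (hU.mem_nhds ha₀)
  have hK : Metric.closedBall a₀ ε ×ˢ Icc (0 : ℝ) 1 ⊆ V := fun p hp => hUV _ (hball hp.1) _ hp.2
  have hd : ContinuousOn
      (fun p : H × ℝ => (fderiv ℝ G p).comp (ContinuousLinearMap.inl ℝ H ℝ)) V :=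
    (hG.continuousOn_fderiv_of_isOpen hV (by simp)).clm_comp continuousOn_const
  obtain ⟨C, hC⟩ := ((isCompact_closedBall a₀ ε).prod isCompact_Icc).exists_bound_of_continuousOn
    (hd.mono hK)
  have hslice : ∀ {E' : Type} [TopologicalSpace E'] {f : H × ℝ → E'} {a : H},
      ContinuousOn f V → a ∈ U → ContinuousOn (fun t => f (a, t)) (uIcc (0 : ℝ) 1) := by
    intro E' _ f a hf ha
    refine hf.comp (by fun_prop) fun t ht => hUV a ha t ?_
    rwa [uIcc_of_le zero_le_one] at ht
  refine intervalIntegral.hasFDerivAt_integral_of_dominated_of_fderiv_le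
    (F := fun a t => G (a, t)) (bound := fun _ => C)
    (F' := fun a t => (fderiv ℝ G (a, t)).comp (ContinuousLinearMap.inl ℝ H ℝ))
    (Metric.closedBall_mem_nhds a₀ hε) ?_ ?_ ?_ ?_ ?_ ?_
  · filter_upwards [hU.mem_nhds ha₀] with a ha
    exact ((hslice hG.continuousOn ha).mono uIoc_subset_uIcc).aestronglyMeasurable
      measurableSet_uIoc
  · exact (hslice hG.continuousOn ha₀).intervalIntegrable
  · exact ((hslice hd ha₀).mono uIoc_subset_uIcc).aestronglyMeasurable measurableSet_uIoc
  · refine Eventually.of_forall fun t ht a ha => hC (a, t) ⟨ha, ?_⟩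
    have := uIoc_subset_uIcc ht
    rwa [uIcc_of_le zero_le_one] at this
  · exact intervalIntegrable_const
  · refine Eventually.of_forall fun t ht a ha => ?_
    have ht' := uIoc_subset_uIcc ht
    rw [uIcc_of_le zero_le_one] at ht'
    have h1 : HasFDerivAt G (fderiv ℝ G (a, t)) (a, t) :=
      ((hG.contDiffAt (hV.mem_nhds (hUV a (hball ha) t ht'))).differentiableAt
        (by simp)).hasFDerivAt
    exact h1.comp a (hasFDerivAt_prodMk_left a t)

-- The derivative of the integral is again an integral of the same kind, with values in a space of
-- linear maps. The induction on `n` therefore has to run over all target spaces `E` at once.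
open Set in
theorem contDiffOn_integral_unit {H : Type} [NormedAddCommGroup H] [NormedSpace ℝ H]
    [FiniteDimensional ℝ H] {U : Set H}
    {V : Set (H × ℝ)} (hU : IsOpen U) (hV : IsOpen V)
    (hUV : ∀ a ∈ U, ∀ t ∈ Icc (0 : ℝ) 1, (a, t) ∈ V) (n : ℕ) :
    ∀ {E : Type} [NormedAddCommGroup E] [NormedSpace ℝ E] {G : H × ℝ → E},
      ContDiffOn ℝ ∞ G V → ContDiffOn ℝ n (fun a => ∫ t in (0 : ℝ)..1, G (a, t)) U := by
  induction n with
  | zero =>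
    intro E _ _ G hG
    exact contDiffOn_zero.2 fun a ha =>
      (hasFDerivAt_integral_unit hU hV hUV hG ha).continuousAt.continuousWithinAt
  | succ n ih =>
    intro E _ _ G hG
    push_cast
    rw [contDiffOn_succ_iff_fderiv_of_isOpen hU]
    refine ⟨fun a ha => (hasFDerivAt_integral_unit hU hV hUV hG
      ha).differentiableAt.differentiableWithinAt, by simp, ?_⟩
    have hd : ContDiffOn ℝ ∞
        (fun p : H × ℝ => (fderiv ℝ G p).comp (ContinuousLinearMap.inl ℝ H ℝ)) V :=
      (hG.fderiv_of_isOpen hV (by simp)).clm_comp contDiffOn_const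
    exact (ih hd).congr fun a ha => (hasFDerivAt_integral_unit hU hV hUV hG ha).fderiv

/-! ## Primitives along a direction -/

namespace VF3

open Set

theorem fderiv_fderiv_comm {U : Set R3} (hU : IsOpen U) {f : R3 → ℝ} (hf : ContDiffOn ℝ ∞ f U)
    {a : R3} (ha : a ∈ U) (d e : R3) :
    fderiv ℝ (fun b => fderiv ℝ f b d) a e = fderiv ℝ (fun b => fderiv ℝ f b e) a d := by
  have hf' : DifferentiableAt ℝ (fderiv ℝ f) a :=
    ((hf.fderiv_of_isOpen (m := ∞) hU (by simp)).contDiffAt (hU.mem_nhds ha)).differentiableAt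
      (by simp)
  have hs : IsSymmSndFDerivAt ℝ f a :=
    (hf.contDiffAt (hU.mem_nhds ha)).isSymmSndFDerivAt (by
      simpa using WithTop.coe_le_coe.2 (le_top : (2 : ℕ∞) ≤ ⊤))
  have key : ∀ d, fderiv ℝ (fun b => fderiv ℝ f b d) a = (fderiv ℝ (fderiv ℝ f) a).flip d := by
    intro d
    rw [fderiv_clm_apply hf' (differentiableAt_const d)]
    ext e
    simp
  rw [key, key]
  exact hs.eq e d

theorem eq_of_fderiv_eq_zero {U : Set R3} (hU : IsOpen U) {f : R3 → ℝ}
    (hf : ContDiffOn ℝ ∞ f U) {a b : R3} (hab : segment ℝ a b ⊆ U)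
    (h : ∀ c ∈ U, fderiv ℝ f c (b - a) = 0) : f b = f a := by
  have hseg : ∀ t ∈ Icc (0 : ℝ) 1, a + t • (b - a) ∈ U := fun t ht =>
    hab (by rw [segment_eq_image']; exact ⟨t, ht, rfl⟩)
  have hd : ∀ t ∈ Icc (0 : ℝ) 1, HasDerivAt (fun t : ℝ => f (a + t • (b - a))) 0 t := by
    intro t ht
    have h1 : HasFDerivAt f (fderiv ℝ f (a + t • (b - a))) (a + t • (b - a)) :=
      ((hf.contDiffAt (hU.mem_nhds (hseg t ht))).differentiableAt (by simp)).hasFDerivAt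
    have h2 : HasDerivAt (fun t : ℝ => a + t • (b - a)) (b - a) t := by
      simpa using ((hasDerivAt_id t).smul_const (b - a)).const_add a
    have h3 := h1.comp_hasDerivAt t h2
    rwa [h _ (hseg t ht)] at h3
  have := constant_of_has_deriv_right_zero (f := fun t : ℝ => f (a + t • (b - a)))
    (fun t ht => (hd t ht).continuousAt.continuousWithinAt)
    (fun t ht => (hd t (Ico_subset_Icc_self ht)).hasDerivWithinAt) 1 (by simp)
  simpa using this

/-- The primitive at `a` is the integral of `g` along the line in direction `e` from the hyperplane
`l = s` to `a`. It vanishes on that hyperplane, so a direction `d` tangent to the hyperplane that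
annihilates `g` also annihilates the primitive: ∂ₑ∂_d f = ∂_d g = 0, and ∂_d f = 0 on the
hyperplane. -/
theorem exists_primitive {U : Set R3} (hU : IsOpen U) (e : R3) (l : R3 →L[ℝ] ℝ) (hl : l e = 1)
    (s : ℝ) (hs : ∀ a ∈ U, ∀ t ∈ Icc (0 : ℝ) 1, a + ((t - 1) * (l a - s)) • e ∈ U)
    {g : R3 → ℝ} (hg : ContDiffOn ℝ ∞ g U) :
    ∃ f : R3 → ℝ, ContDiffOn ℝ ∞ f U ∧ (∀ a ∈ U, fderiv ℝ f a e = g a) ∧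
      ∀ d, l d = 0 → (∀ a ∈ U, fderiv ℝ g a d = 0) → ∀ a ∈ U, fderiv ℝ f a d = 0 := by
  -- The point of the line at which `l` takes the value `s + t * (l a - s)`: on the hyperplane for
  -- `t = 0`, equal to `a` for `t = 1`.
  let φ : R3 × ℝ → R3 := fun p => p.1 + ((p.2 - 1) * (l p.1 - s)) • e
  have hφ : ContDiff ℝ ∞ φ := by fun_prop
  let G : R3 × ℝ → ℝ := fun p => (l p.1 - s) * g (φ p)
  let f : R3 → ℝ := fun a => ∫ t in (0 : ℝ)..1, G (a, t)
  have hV : IsOpen (φ ⁻¹' U) := hU.preimage hφ.continuous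
  have hG : ContDiffOn ℝ ∞ G (φ ⁻¹' U) :=
    ContDiffOn.mul (by fun_prop) (hg.comp hφ.contDiffOn fun p hp => hp)
  have hf : ContDiffOn ℝ ∞ f U :=
    contDiffOn_infty.2 fun n => contDiffOn_integral_unit hU hV hs n hG
  have hfd : ∀ a ∈ U, HasFDerivAt f (fderiv ℝ f a) a := fun a ha =>
    ((hf.contDiffAt (hU.mem_nhds ha)).differentiableAt (by simp)).hasFDerivAt
  have hline : ∀ a ∈ U, ∀ v ∈ uIcc 0 (l a - s), a + (v - (l a - s)) • e ∈ U := by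
    intro a ha v hv
    rcases eq_or_ne (l a - s) 0 with h0 | h0
    · rw [h0] at hv ⊢
      simp only [uIcc_self, mem_singleton_iff] at hv
      simpa [hv] using ha
    · have : v / (l a - s) ∈ Icc (0 : ℝ) 1 := by
        rcases le_total 0 (l a - s) with h | h
        · rw [uIcc_of_le h] at hv
          exact ⟨div_nonneg hv.1 h, div_le_one_of_le₀ hv.2 h⟩
        · rw [uIcc_of_ge h] at hv
          exact ⟨div_nonneg_of_nonpos hv.2 h, div_le_one_of_ge hv.1 h⟩
      convert hs a ha _ this using 3
      field_simp
  have hfe : ∀ a ∈ U, fderiv ℝ f a e = g a := by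
    intro a ha
    -- The substitution u = t (l a - s + v) moves the dependence on `v` into the upper limit, where
    -- the fundamental theorem of calculus applies.
    have hform : ∀ v : ℝ, f (a + v • e) =
        ∫ u in (0 : ℝ)..(l a - s + v), g (a + (u - (l a - s)) • e) := by
      intro v
      have h1 := intervalIntegral.smul_integral_comp_mul_right (a := 0) (b := 1)
        (fun u => g (a + (u - (l a - s)) • e)) (l a - s + v)
      rw [zero_mul, one_mul] at h1
      rw [← h1, ← intervalIntegral.integral_smul]
      refine intervalIntegral.integral_congr fun t _ => ?_
      have h2 : l (a + v • e) - s = l a - s + v := by simp [hl]; ring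
      simp only [G, φ, h2, smul_eq_mul]
      congr 2
      rw [add_assoc, ← add_smul]
      congr 2
      ring
    have hcont : ContinuousOn (fun u => g (a + (u - (l a - s)) • e))
        {u : ℝ | a + (u - (l a - s)) • e ∈ U} :=
      hg.continuousOn.comp (by fun_prop) fun u hu => hu
    have hopen : IsOpen {u : ℝ | a + (u - (l a - s)) • e ∈ U} :=
      hU.preimage (by fun_prop : Continuous fun u : ℝ => a + (u - (l a - s)) • e)
    have hmem : l a - s ∈ {u : ℝ | a + (u - (l a - s)) • e ∈ U} := by simpa using ha
    have hftc := intervalIntegral.integral_hasDerivAt_right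
      (f := fun u => g (a + (u - (l a - s)) • e)) (a := 0) (b := l a - s)
      ((hcont.mono fun u hu => hline a ha u hu).intervalIntegrable)
      (hcont.stronglyMeasurableAtFilter hopen _ hmem)
      (hcont.continuousAt (hopen.mem_nhds hmem))
    have h1 : HasDerivAt (fun v : ℝ => f (a + v • e)) (g a) 0 := by
      have h2 : HasDerivAt (fun v : ℝ => l a - s + v) 1 0 := (hasDerivAt_id _).const_add _
      have h3 := HasDerivAt.comp (0 : ℝ) (h₂ := fun u => ∫ x in (0 : ℝ)..u,
        g (a + (x - (l a - s)) • e)) (h := fun v : ℝ => l a - s + v) (by simpa using hftc) h2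
      simp only [Function.comp_def, ← hform] at h3
      simpa using h3
    have h4 : HasDerivAt (fun v : ℝ => a + v • e) e 0 := by
      simpa using ((hasDerivAt_id (0 : ℝ)).smul_const e).const_add a
    have h5 := HasFDerivAt.comp_hasDerivAt (0 : ℝ) (l := f) (l' := fderiv ℝ f a)
      (f := fun v : ℝ => a + v • e) (by simpa using hfd a ha) h4
    exact h5.unique h1
  refine ⟨f, hf, hfe, fun d hd hgd a ha => ?_⟩
  have hD : ContDiffOn ℝ ∞ (fun b => fderiv ℝ f b d) U :=
    (hf.fderiv_of_isOpen (m := ∞) hU (by simp)).clm_apply contDiffOn_const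
  have hDe : ∀ b ∈ U, fderiv ℝ (fun b => fderiv ℝ f b d) b e = 0 := by
    intro b hb
    rw [fderiv_fderiv_comm hU hf hb]
    rw [Filter.EventuallyEq.fderiv_eq (f := g)
      (Set.EqOn.eventuallyEq_of_mem (fun c hc => hfe c hc) (hU.mem_nhds hb))]
    exact hgd b hb
  -- The projection of `a` to the hyperplane along `e`.
  set b : R3 := a + ((0 - 1) * (l a - s)) • e with hb
  have hbU : b ∈ U := hs a ha 0 (by simp)
  have hlb : l b = s := by simp [hb, hl]
  have hba : segment ℝ b a ⊆ U := by
    rw [segment_eq_image']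
    rintro _ ⟨t, ht, rfl⟩
    convert hs a ha t ht using 1
    rw [hb]
    module
  have h0 : fderiv ℝ f b d = 0 := by
    have h4 : HasDerivAt (fun v : ℝ => b + v • d) d 0 := by
      simpa using ((hasDerivAt_id (0 : ℝ)).smul_const d).const_add b
    have h5 := HasFDerivAt.comp_hasDerivAt (0 : ℝ) (l := f) (l' := fderiv ℝ f b)
      (f := fun v : ℝ => b + v • d) (by simpa using hfd b hbU) h4
    have h6 : (f ∘ fun v : ℝ => b + v • d) = fun _ => 0 := by
      funext v
      simp [f, G, hd, hlb]
    rw [h6] at h5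
    exact h5.unique (hasDerivAt_const _ _)
  rw [← h0]
  refine eq_of_fderiv_eq_zero hU hD hba fun c hc => ?_
  have : a - b = (l a - s) • e := by rw [hb]; module
  rw [this, map_smul, hDe c hc, smul_zero]

end VF3

/-! ## Calculus of smooth functions and vector fields -/

namespace VF3

open Set

variable {U : TopologicalSpace.Opens R3}

theorem Fun.ext {f g : Fun U} (h : ∀ u : U, f.1 u = g.1 u) : f = g :=
  Subtype.ext (funext h)

/-- The constant vector field with components `d`. -/
def dir (d : R3) : VF U := d 0 • pderiv U 0 + d 1 • pderiv U 1 + d 2 • pderiv U 2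

theorem dir_apply (d : R3) (f : Fun U) :
    dir d f = d 0 • pderiv U 0 f + d 1 • pderiv U 1 f + d 2 • pderiv U 2 f := by
  simp [dir]

theorem dir_apply_val (d : R3) (f : Fun U) (u : U) :
    (dir d f).1 u = fderiv ℝ (ext0 f.1) u d := by
  have hd : d = d 0 • Pi.single 0 1 + d 1 • Pi.single 1 1 + d 2 • Pi.single 2 1 := by
    ext i
    fin_cases i <;> simp
  conv_rhs => rw [hd]
  simp only [map_add, map_smul, dir_apply]
  rfl

theorem Fun.of_dir {f : R3 → ℝ} (hf : ContDiffOn ℝ ∞ f U) (d : R3) (u : U) :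
    (dir d (Fun.of f hf)).1 u = fderiv ℝ f u d := by
  rw [dir_apply_val]
  exact congrArg (fun L : R3 →L[ℝ] ℝ => L d) (eqOn_nhds (ext0_restrict f) u).fderiv_eq

theorem pderiv_comm (i j : Fin 3) (f : Fun U) :
    pderiv U i (pderiv U j f) = pderiv U j (pderiv U i f) := by
  refine Fun.ext fun u => ?_
  have h : ∀ k : Fin 3, ∀ d, (dir d (pderiv U k f)).1 u =
      fderiv ℝ (fun a => fderiv ℝ (ext0 f.1) a (Pi.single k 1)) u d := fun k d => by
    rw [dir_apply_val]
    exact congrArg (fun L : R3 →L[ℝ] ℝ => L d) (eqOn_nhds (ext0_restrict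
      fun a => fderiv ℝ (ext0 f.1) a (Pi.single k 1)) u).fderiv_eq
  have h' : ∀ k (g : Fun U), dir (Pi.single k 1) g = pderiv U k g := fun k g => by
    rw [dir_apply]; fin_cases k <;> simp
  rw [← h' i, ← h' j (pderiv U i f), h, h]
  exact fderiv_fderiv_comm U.isOpen f.2 u.2 _ _

theorem exists_dir_eq (e : R3) (l : R3 →L[ℝ] ℝ) (hl : l e = 1) (s : ℝ)
    (hs : ∀ a ∈ U, ∀ t ∈ Icc (0 : ℝ) 1, a + ((t - 1) * (l a - s)) • e ∈ U) (g : Fun U) :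
    ∃ f : Fun U, dir e f = g ∧ ∀ d, l d = 0 → dir d g = 0 → dir d f = 0 := by
  obtain ⟨f, hf, hfe, hfd⟩ := exists_primitive U.isOpen e l hl s hs g.2
  refine ⟨Fun.of f hf, Fun.ext fun u => ?_, fun d hd hg => Fun.ext fun u => ?_⟩
  · rw [Fun.of_dir, hfe u u.2, ext0_apply]
  · rw [Fun.of_dir]
    refine hfd d hd (fun a ha => ?_) u u.2
    rw [← dir_apply_val d g ⟨a, ha⟩, hg]
    rfl

theorem mem_constants_of_pderiv_eq_zero (hU : Convex ℝ (U : Set R3)) (hne : (U : Set R3).Nonempty)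
    {f : Fun U} (h : ∀ i, pderiv U i f = 0) : f ∈ constants U := by
  obtain ⟨a, ha⟩ := hne
  refine ⟨ext0 f.1 a, Fun.ext fun u => ?_⟩
  rw [← ext0_apply f.1 u]
  refine (eq_of_fderiv_eq_zero U.isOpen f.2 (hU.segment_subset ha u.2) fun c hc => ?_).symm
  rw [← dir_apply_val _ f ⟨c, hc⟩, dir_apply, h, h, h]
  simp

end VF3

/-! ### Derivatives of the coordinate functions -/

namespace TypeIII

open VF3

variable {U : TopologicalSpace.Opens R3}

theorem pderiv_coord (i j : Fin 3) :
    pderiv U i (coord j) = if i = j then 1 else 0 := by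
  refine Fun.ext fun u => ?_
  have h1 : (pderiv U i (coord j)).1 u = fderiv ℝ (fun a : R3 => a j) u (Pi.single i 1) :=
    congrArg (fun L : R3 →L[ℝ] ℝ => L (Pi.single i 1)) (eqOn_nhds (ext0_restrict fun a : R3 => a j) u).fderiv_eq
  have h2 : fderiv ℝ (fun a : R3 => a j) (u : R3) = ContinuousLinearMap.proj j :=
    (ContinuousLinearMap.proj (R := ℝ) (φ := fun _ : Fin 3 => ℝ) j).fderiv
  rw [h1, h2]
  rcases eq_or_ne i j with rfl | h
  · simp
  · simp [h]

@[simp] theorem pderiv_zero_x : pderiv U 0 x = 1 := by simp [x, pderiv_coord]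
@[simp] theorem pderiv_zero_y : pderiv U 0 y = 0 := by simp [y, pderiv_coord]
@[simp] theorem pderiv_zero_z : pderiv U 0 z = 0 := by simp [z, pderiv_coord]
@[simp] theorem pderiv_one_x : pderiv U 1 x = 0 := by simp [x, pderiv_coord]
@[simp] theorem pderiv_one_y : pderiv U 1 y = 1 := by simp [y, pderiv_coord]
@[simp] theorem pderiv_one_z : pderiv U 1 z = 0 := by simp [z, pderiv_coord]
@[simp] theorem pderiv_two_x : pderiv U 2 x = 0 := by simp [x, pderiv_coord]
@[simp] theorem pderiv_two_y : pderiv U 2 y = 0 := by simp [y, pderiv_coord]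
@[simp] theorem pderiv_two_z : pderiv U 2 z = 1 := by simp [z, pderiv_coord]

end TypeIII

/-! ## First order operators on a commutative algebra -/

namespace DiffOp

/-- The derivations of a commutative real algebra. -/
abbrev Der (A : Type) [CommRing A] [Algebra ℝ A] : Type := Derivation ℝ A A

variable {A : Type} [CommRing A] [Algebra ℝ A]

variable (A) in
/-- The constants. -/
def scalars : Submodule ℝ A := LinearMap.range (Algebra.linearMap ℝ A)

@[simp] theorem algebraMap_mem_scalars (c : ℝ) : algebraMap ℝ A c ∈ scalars A := ⟨c, rfl⟩

theorem map_eq_zero_of_mem_scalars (D : Der A) {f : A} (hf : f ∈ scalars A) : D f = 0 := by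
  obtain ⟨c, rfl⟩ := hf
  simp

/-- The commutator of the first order operators `v + f` and `w + g`. -/
def opLie (a b : Der A × A) : Der A × A := (⁅a.1, b.1⁆, a.1 b.2 - b.1 a.2)

/-- A Lie algebra of first order operators whose elements of order zero are the constants. -/
structure IsOpAlg (G : Submodule ℝ (Der A × A)) : Prop where
  opLie_mem : ∀ {a b}, a ∈ G → b ∈ G → opLie a b ∈ G
  zero_mem_iff : ∀ {f}, ((0, f) : Der A × A) ∈ G ↔ f ∈ scalars A

variable (A) in
/-- The constants, as operators of order zero. -/
def constOps : Submodule ℝ (Der A × A) := Submodule.prod ⊥ (scalars A)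

theorem mem_constOps {a : Der A × A} : a ∈ constOps A ↔ a.1 = 0 ∧ a.2 ∈ scalars A := by
  simp [constOps, Submodule.mem_prod]

/-- The span of the operators `v i + η i` and the constants. -/
def opSpan {ι : Type} (v : ι → Der A) (η : ι → A) : Submodule ℝ (Der A × A) :=
  Submodule.span ℝ (Set.range fun i => (v i, η i)) ⊔ constOps A

theorem opSpan_gen {ι : Type} (v : ι → Der A) (η : ι → A) (i : ι) :
    (v i, η i) ∈ opSpan v η :=
  Submodule.mem_sup_left (Submodule.subset_span ⟨i, rfl⟩)

theorem opLie_add_left (a a' b : Der A × A) : opLie (a + a') b = opLie a b + opLie a' b := by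
  ext1
  · exact add_lie a.1 a'.1 b.1
  · simp only [opLie, Prod.fst_add, Prod.snd_add, Derivation.add_apply, map_add]; abel

theorem opLie_smul_left (c : ℝ) (a b : Der A × A) : opLie (c • a) b = c • opLie a b := by
  ext1
  · exact smul_lie c a.1 b.1
  · simp only [opLie, Prod.smul_fst, Prod.smul_snd, Derivation.smul_apply, Derivation.map_smul,
      smul_sub]

theorem opLie_swap (a b : Der A × A) : opLie b a = (-1 : ℝ) • opLie a b := by
  ext1
  · rw [neg_one_smul]
    exact (lie_skew b.1 a.1).symm
  · simp [opLie]

theorem opLie_add_right (a b b' : Der A × A) : opLie a (b + b') = opLie a b + opLie a b' := by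
  rw [opLie_swap, opLie_add_left, smul_add, ← opLie_swap, ← opLie_swap]

theorem opLie_smul_right (c : ℝ) (a b : Der A × A) : opLie a (c • b) = c • opLie a b := by
  rw [opLie_swap, opLie_smul_left, smul_comm, ← opLie_swap]

theorem opLie_self (a : Der A × A) : opLie a a = 0 := by
  ext1
  · exact lie_self a.1
  · simp [opLie]

theorem opLie_const_left {a : Der A × A} (ha : a ∈ constOps A) (b : Der A × A) :
    opLie a b = 0 := by
  obtain ⟨_, _⟩ := a
  obtain ⟨rfl, c, rfl⟩ := mem_constOps.1 ha
  ext1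
  · exact zero_lie b.1
  · simp [opLie]

theorem opLie_const_right (a : Der A × A) {b : Der A × A} (hb : b ∈ constOps A) :
    opLie a b = 0 := by
  rw [opLie_swap, opLie_const_left hb, smul_zero]

/-- Constants commute with all first order operators, so by bilinearity closure has to be tested on
the generators only. -/
theorem opSpan_lie {ι : Type} {v : ι → Der A} {η : ι → A}
    (h : ∀ i j, opLie (v i, η i) (v j, η j) ∈ opSpan v η) {a b : Der A × A}
    (ha : a ∈ opSpan v η) (hb : b ∈ opSpan v η) : opLie a b ∈ opSpan v η := by
  obtain ⟨a₁, ha₁, a₂, ha₂, rfl⟩ := Submodule.mem_sup.1 ha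
  obtain ⟨b₁, hb₁, b₂, hb₂, rfl⟩ := Submodule.mem_sup.1 hb
  rw [opLie_add_left, opLie_const_left ha₂, add_zero, opLie_add_right, opLie_const_right _ hb₂,
    add_zero]
  clear ha hb
  induction ha₁, hb₁ using Submodule.span_induction₂ with
  | mem_mem a b ha hb =>
    obtain ⟨i, rfl⟩ := ha
    obtain ⟨j, rfl⟩ := hb
    exact h i j
  | zero_left b hb => rw [opLie_const_left (zero_mem _)]; exact zero_mem _
  | zero_right a ha => rw [opLie_const_right _ (zero_mem _)]; exact zero_mem _
  | add_left a a' b _ _ _ h h' => rw [opLie_add_left]; exact add_mem h h'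
  | add_right a b b' _ _ _ h h' => rw [opLie_add_right]; exact add_mem h h'
  | smul_left c a b _ _ h => rw [opLie_smul_left]; exact Submodule.smul_mem _ _ h
  | smul_right c a b _ _ h => rw [opLie_smul_right]; exact Submodule.smul_mem _ _ h

theorem fst_mem_of_mem_opSpan {ι : Type} {v : ι → Der A} {η : ι → A} {a : Der A × A}
    (ha : a ∈ opSpan v η) : a.1 ∈ Submodule.span ℝ (Set.range v) := by
  obtain ⟨a₁, ha₁, a₂, ha₂, rfl⟩ := Submodule.mem_sup.1 ha
  rw [Prod.fst_add, (mem_constOps.1 ha₂).1, add_zero]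
  have := Submodule.mem_map_of_mem (f := LinearMap.fst ℝ (Der A) A) ha₁
  rwa [Submodule.map_span, ← Set.range_comp] at this

theorem exists_mem_opSpan {ι : Type} {v : ι → Der A} (η : ι → A) {w : Der A}
    (hw : w ∈ Submodule.span ℝ (Set.range v)) : ∃ f, (w, f) ∈ opSpan v η := by
  induction hw using Submodule.span_induction with
  | mem w h => obtain ⟨i, rfl⟩ := h; exact ⟨_, opSpan_gen v η i⟩
  | zero => exact ⟨0, zero_mem _⟩
  | add w w' _ _ h h' =>
    obtain ⟨f, hf⟩ := h
    obtain ⟨g, hg⟩ := h'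
    exact ⟨f + g, add_mem hf hg⟩
  | smul c w _ h =>
    obtain ⟨f, hf⟩ := h
    exact ⟨c • f, Submodule.smul_mem _ c hf⟩

theorem span_lie_mem {ι : Type} {v : ι → Der A}
    (h : ∀ i j, opLie (v i, 0) (v j, 0) ∈ opSpan v fun _ => 0) {a b : Der A}
    (ha : a ∈ Submodule.span ℝ (Set.range v)) (hb : b ∈ Submodule.span ℝ (Set.range v)) :
    ⁅a, b⁆ ∈ Submodule.span ℝ (Set.range v) := by
  obtain ⟨f, hf⟩ := exists_mem_opSpan (fun _ => 0) ha
  obtain ⟨g, hg⟩ := exists_mem_opSpan (fun _ => 0) hb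
  exact fst_mem_of_mem_opSpan (opSpan_lie h hf hg)

/-- The operators `v + f` with `v + f + v(l)` in `G`. -/
def shift (G : Submodule ℝ (Der A × A)) (l : A) : Submodule ℝ (Der A × A) where
  carrier := {a | (a.1, a.2 + a.1 l) ∈ G}
  add_mem' {a b} ha hb := by
    have : (a.1, a.2 + a.1 l) + (b.1, b.2 + b.1 l) ∈ G := G.add_mem ha hb
    rwa [Prod.mk_add_mk, add_add_add_comm] at this
  zero_mem' := by
    simp only [Set.mem_ofPred_eq, Prod.fst_zero, Prod.snd_zero, Derivation.coe_zero, Pi.zero_apply,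
      add_zero]
    exact G.zero_mem
  smul_mem' c a ha := by
    have : c • (a.1, a.2 + a.1 l) ∈ G := G.smul_mem c ha
    rwa [Prod.smul_mk, smul_add] at this

theorem mem_shift {G : Submodule ℝ (Der A × A)} {l : A} {v : Der A} {f : A} :
    (v, f) ∈ shift G l ↔ (v, f + v l) ∈ G := Iff.rfl

theorem shift_shift (G : Submodule ℝ (Der A × A)) (l l' : A) :
    shift (shift G l) l' = shift G (l + l') := by
  ext ⟨v, f⟩
  rw [mem_shift, mem_shift, mem_shift, map_add, add_assoc, add_comm (v l)]

namespace IsOpAlg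

variable {G : Submodule ℝ (Der A × A)}

/-- The map v + f ↦ v + f + v(l) is conjugation by an exponential of `l`; it respects commutators
and fixes the operators of order zero. -/
theorem shift (hG : IsOpAlg G) (l : A) : IsOpAlg (shift G l) where
  opLie_mem := by
    rintro ⟨v, f⟩ ⟨w, g⟩ ha hb
    have := hG.opLie_mem (mem_shift.1 ha) (mem_shift.1 hb)
    refine mem_shift.2 ?_
    convert this using 1
    simp only [opLie, map_add, Derivation.commutator_apply]
    ext1
    · rfl
    · simp only; ring
  zero_mem_iff := by
    intro f
    rw [mem_shift]
    simpa using hG.zero_mem_iff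

theorem sub_mem (hG : IsOpAlg G) {v : Der A} {f g : A} (hf : (v, f) ∈ G) (hg : (v, g) ∈ G) : f - g ∈ scalars A := by
  have := _root_.sub_mem hf hg
  rw [Prod.mk_sub_mk, sub_self] at this
  exact hG.zero_mem_iff.1 this

theorem congr (hG : IsOpAlg G) {v : Der A} {f g : A} (hf : (v, f) ∈ G) (h : f - g ∈ scalars A) : (v, g) ∈ G := by
  have := _root_.sub_mem hf (hG.zero_mem_iff.2 h)
  simpa using this

theorem zero_of (hG : IsOpAlg G) {v : Der A} {f : A} (hf : (v, f) ∈ G) (h : f ∈ scalars A) : (v, 0) ∈ G :=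
  hG.congr hf (by simpa using h)

/-- This is the cocycle identity modulo constants: the commutator of the two lifts and the given
lift of ⁅v, w⁆ differ by an element of order zero. -/
theorem rel (hG : IsOpAlg G) {v w : Der A} {f g h : A} (hv : (v, f) ∈ G) (hw : (w, g) ∈ G) (hvw : (⁅v, w⁆, h) ∈ G) :
    v g - w f - h ∈ scalars A :=
  hG.sub_mem (hG.opLie_mem hv hw) hvw

theorem rel_zero (hG : IsOpAlg G) {v w : Der A} {f g : A} (hv : (v, f) ∈ G) (hw : (w, g) ∈ G) (hvw : ⁅v, w⁆ = 0) :
    v g - w f ∈ scalars A := by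
  have := hG.rel hv hw (h := 0) (by rw [hvw]; exact zero_mem G)
  simpa using this

/-- The relation for an eigenvector `w` of `v`, when `v` is represented by zero. -/
theorem rel_smul (hG : IsOpAlg G) {v w : Der A} {g : A} {c : ℝ} (hv : (v, 0) ∈ G) (hw : (w, g) ∈ G)
    (hvw : ⁅v, w⁆ = c • w) : v g - algebraMap ℝ A c * g ∈ scalars A := by
  have := hG.rel hv hw (h := c • g) (by rw [hvw]; exact G.smul_mem c hw)
  simpa [Algebra.smul_def] using this

theorem rel_mem (hG : IsOpAlg G) {v w : Der A} {g : A} (hv : (v, 0) ∈ G) (hw : (w, g) ∈ G)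
    (hvw : (⁅v, w⁆, 0) ∈ G) : v g ∈ scalars A := by
  simpa using hG.rel hv hw hvw

end IsOpAlg

/-- The operators `v + η c` span, together with the constants, Lie algebras of first order operators,
and every Lie algebra of first order operators lifting the span of `v` is equivalent to exactly one of
them. -/
structure Classifies {ι : Type} {m : ℕ} (v : ι → Der A) (η : (Fin m → ℝ) → ι → A) : Prop where
  add : ∀ c c' i, η (c + c') i = η c i + η c' i
  smul : ∀ (r : ℝ) c i, η (r • c) i = r • η c i
  linearIndependent : LinearIndependent ℝ v
  lie : ∀ c i j, opLie (v i, η c i) (v j, η c j) ∈ opSpan v (η c)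
  inj : ∀ c f, (∀ i, η c i - v i f ∈ scalars A) → c = 0
  surj : ∀ G : Submodule ℝ (Der A × A), IsOpAlg G → (∀ i, ∃ f, (v i, f) ∈ G) →
    ∃ c f, ∀ i, (v i, η c i) ∈ shift G f

/-! ## Frames -/

/-- Three commuting derivations `p, q, r` with coordinates `x, y, z`, for which only the constants
have vanishing derivatives, and a point of the plane `x = z = 0`. -/
structure Frame (A : Type) [CommRing A] [Algebra ℝ A] where
  (p q r : Der A)
  (x y z : A)
  ev : A →ₐ[ℝ] ℝ
  ev_x : ev x = 0
  ev_z : ev z = 0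
  p_x : p x = 1
  p_y : p y = 0
  p_z : p z = 0
  q_x : q x = 0
  q_y : q y = 1
  q_z : q z = 0
  r_x : r x = 0
  r_y : r y = 0
  r_z : r z = 1
  q_p : ∀ f, q (p f) = p (q f)
  r_p : ∀ f, r (p f) = p (r f)
  r_q : ∀ f, r (q f) = q (r f)
  mem_scalars : ∀ f, p f = 0 → q f = 0 → r f = 0 → f ∈ scalars A
  exists_p_eq : ∀ g, ∃ f, p f = g

attribute [simp] Frame.ev_x Frame.ev_z Frame.p_x Frame.p_y Frame.p_z Frame.q_x Frame.q_y Frame.q_z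
  Frame.r_x Frame.r_y Frame.r_z

namespace Frame

variable (F : Frame A)

theorem algebraMap_inj (F : Frame A) {c d : ℝ} : algebraMap ℝ A c = algebraMap ℝ A d ↔ c = d := by
  refine ⟨fun h => ?_, fun h => by rw [h]⟩
  simpa using congrArg F.ev h

theorem algebraMap_eq_zero (F : Frame A) {c : ℝ} : algebraMap ℝ A c = 0 ↔ c = 0 := by
  rw [← map_zero (algebraMap ℝ A), F.algebraMap_inj]

/-- The derivation `f p + g q + h r`. -/
def vf (f g h : A) : Der A := f • F.p + g • F.q + h • F.r

theorem vf_apply (f g h φ : A) : F.vf f g h φ = f * F.p φ + g * F.q φ + h * F.r φ := by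
  simp [vf]

theorem vf_add (f g h f' g' h' : A) :
    F.vf f g h + F.vf f' g' h' = F.vf (f + f') (g + g') (h + h') := by
  simp only [vf]; module

theorem vf_smul (c : ℝ) (f g h : A) : c • F.vf f g h = F.vf (c • f) (c • g) (c • h) := by
  simp only [vf, smul_add, smul_assoc]

theorem vf_zero : F.vf 0 0 0 = 0 := by simp [vf]

theorem vf_lie (f g h f' g' h' : A) :
    ⁅F.vf f g h, F.vf f' g' h'⁆ = F.vf (F.vf f g h f' - F.vf f' g' h' f)
      (F.vf f g h g' - F.vf f' g' h' g) (F.vf f g h h' - F.vf f' g' h' h) := by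
  refine Derivation.ext fun φ => ?_
  rw [Derivation.commutator_apply]
  simp only [vf_apply, map_add, Derivation.leibniz, smul_eq_mul, F.q_p, F.r_p, F.r_q]
  ring

end Frame

end DiffOp

/-! ### From algebras of first order operators to H¹ -/

namespace LieH1

theorem exists_equiv_H1 {R L M P : Type*} [CommRing R] [LieRing L] [LieAlgebra R L]
    [AddCommGroup M] [Module R M] [LieRingModule L M] [LieModule R L M] [AddCommGroup P]
    [Module R P] (F : P →ₗ[R] LieModule.Cohomology.oneCochain R L M)
    (hF : ∀ c, F c ∈ cocycles R L M)
    (hinj : ∀ c, F c ∈ coboundaries R L M → c = 0)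
    (hsurj : ∀ E ∈ cocycles R L M, ∃ c, F c - E ∈ coboundaries R L M) :
    ∃ Φ : P ≃ₗ[R] H1 R L M, ∀ c, Φ c = Submodule.Quotient.mk ⟨F c, hF c⟩ := by
  let Ψ : P →ₗ[R] H1 R L M := (Submodule.mkQ _).comp (F.codRestrict _ hF)
  have hΨ : Function.Bijective Ψ := by
    constructor
    · rw [← LinearMap.ker_eq_bot, LinearMap.ker_eq_bot']
      intro c hc
      exact hinj c ((Submodule.Quotient.mk_eq_zero
        ((coboundaries R L M).submoduleOf (cocycles R L M))).1 hc)
    · intro κ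
      obtain ⟨E, rfl⟩ := Submodule.Quotient.mk_surjective _ κ
      obtain ⟨c, hc⟩ := hsurj E.1 E.2
      exact ⟨c, (Submodule.Quotient.eq _).2 hc⟩
  exact ⟨LinearEquiv.ofBijective Ψ hΨ, fun c => rfl⟩

end LieH1

namespace VF3

open DiffOp

variable {U : TopologicalSpace.Opens R3}

theorem quotient_mk_eq_iff {f g : Fun U} :
    (LieSubmodule.Quotient.mk f : FunModConst U) = LieSubmodule.Quotient.mk g ↔
      f - g ∈ constants U :=
  Submodule.Quotient.eq _

theorem quotient_mk_eq_zero_iff {f : Fun U} :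
    (LieSubmodule.Quotient.mk f : FunModConst U) = 0 ↔ f ∈ constants U :=
  Submodule.Quotient.mk_eq_zero _

theorem lie_quotient_mk {𝔥 : LieSubalgebra ℝ (VF U)} (w : 𝔥) (f : Fun U) :
    ⁅w, (LieSubmodule.Quotient.mk f : FunModConst U)⁆ =
      LieSubmodule.Quotient.mk ((w : VF U) f) := rfl

/-- The first order operators `v + f` with `v ∈ 𝔥` and `f` in the class `⟨F; v⟩`. -/
def graphOps {𝔥 : LieSubalgebra ℝ (VF U)} (F : 𝔥 →ₗ[ℝ] FunModConst U) :
    Submodule ℝ (Der (Fun U) × Fun U) where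
  carrier := {a | ∃ w : 𝔥, (w : VF U) = a.1 ∧ F w = LieSubmodule.Quotient.mk a.2}
  add_mem' := by
    rintro a b ⟨w, hw, hF⟩ ⟨w', hw', hF'⟩
    exact ⟨w + w', by simp [hw, hw'], by rw [map_add, hF, hF']; rfl⟩
  zero_mem' := ⟨0, rfl, by rw [map_zero]; rfl⟩
  smul_mem' := by
    rintro c a ⟨w, hw, hF⟩
    exact ⟨c • w, by simp [hw], by rw [map_smul, hF]; rfl⟩

/-- The cocycle identity is the closure of the graph under commutators. -/
theorem isOpAlg_graphOps {𝔥 : LieSubalgebra ℝ (VF U)}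
    (F : LieH1.cocycles ℝ 𝔥 (FunModConst U)) : IsOpAlg (graphOps F.1) where
  opLie_mem := by
    rintro ⟨a, f⟩ ⟨b, g⟩ ⟨w, hw, hF⟩ ⟨w', hw', hF'⟩
    simp only at hw hw' hF hF'
    subst hw hw'
    refine ⟨⁅w, w'⁆, rfl, ?_⟩
    have := (LieH1.mem_cocycles ℝ 𝔥 (FunModConst U) F.1).1 F.2 w w'
    rw [hF, hF', lie_quotient_mk, lie_quotient_mk] at this
    exact (sub_eq_zero.1 this).symm
  zero_mem_iff := by
    intro f
    constructor
    · rintro ⟨w, hw, hF⟩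
      obtain rfl : w = 0 := Subtype.ext hw
      rw [map_zero] at hF
      exact quotient_mk_eq_zero_iff.1 hF.symm
    · intro hf
      exact ⟨0, rfl, by rw [map_zero]; exact (quotient_mk_eq_zero_iff.2 hf).symm⟩

/-- A converse to `isOpAlg_graphOps`. It applies with `W` the span of the operators on a basis and
the constants, so that the cocycle identity follows from the brackets of basis elements. -/
theorem mem_cocycles_of_le_graphOps {𝔥 : LieSubalgebra ℝ (VF U)} {F : 𝔥 →ₗ[ℝ] FunModConst U}
    {W : Submodule ℝ (Der (Fun U) × Fun U)} (hle : W ≤ graphOps F)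
    (hW : ∀ {a b}, a ∈ W → b ∈ W → opLie a b ∈ W) (hex : ∀ w : 𝔥, ∃ f, ((w : VF U), f) ∈ W) :
    F ∈ LieH1.cocycles ℝ 𝔥 (FunModConst U) := by
  rw [LieH1.mem_cocycles]
  intro w w'
  obtain ⟨f, hf⟩ := hex w
  obtain ⟨g, hg⟩ := hex w'
  obtain ⟨w₁, hw₁, hF₁⟩ := hle hf
  obtain ⟨w₂, hw₂, hF₂⟩ := hle hg
  obtain ⟨w₃, hw₃, hF₃⟩ := hle (hW hf hg)
  obtain rfl : w₁ = w := Subtype.ext hw₁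
  obtain rfl : w₂ = w' := Subtype.ext hw₂
  obtain rfl : w₃ = ⁅w₁, w₂⁆ := Subtype.ext hw₃
  rw [hF₁, hF₂, hF₃, lie_quotient_mk, lie_quotient_mk, sub_eq_zero]
  rfl

theorem opSpan_le_graphOps {ι : Type} {v : ι → VF U} {η : ι → Fun U} {𝔥 : LieSubalgebra ℝ (VF U)}
    {B : ι → 𝔥} (hB : ∀ i, (B i : VF U) = v i) {F : 𝔥 →ₗ[ℝ] FunModConst U}
    (hF : ∀ i, F (B i) = LieSubmodule.Quotient.mk (η i)) : opSpan v η ≤ graphOps F := by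
  refine sup_le (Submodule.span_le.2 ?_) fun a ha => ?_
  · rintro _ ⟨i, rfl⟩
    exact ⟨B i, hB i, hF i⟩
  · refine ⟨0, (mem_constOps.1 ha).1.symm, ?_⟩
    rw [map_zero]
    exact (quotient_mk_eq_zero_iff.2 (mem_constOps.1 ha).2).symm

theorem exists_linearMap_cochain {ι P L M N : Type} [AddCommGroup P] [Module ℝ P] [AddCommGroup L]
    [Module ℝ L] [AddCommGroup M] [Module ℝ M] [AddCommGroup N] [Module ℝ N]
    (B : Module.Basis ι ℝ L) (e : M →ₗ[ℝ] N) {η : P → ι → M}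
    (hadd : ∀ c c' i, η (c + c') i = η c i + η c' i)
    (hsmul : ∀ (r : ℝ) c i, η (r • c) i = r • η c i) :
    ∃ F : P →ₗ[ℝ] L →ₗ[ℝ] N, ∀ c i, F c (B i) = e (η c i) := by
  refine ⟨{ toFun := fun c => B.constr ℝ fun i => e (η c i)
            map_add' := fun c c' => B.ext fun i => ?_
            map_smul' := fun r c => B.ext fun i => ?_ }, fun c i => B.constr_basis ℝ _ i⟩
  · rw [LinearMap.add_apply, B.constr_basis, B.constr_basis, B.constr_basis, hadd, map_add]
  · rw [LinearMap.smul_apply, B.constr_basis, B.constr_basis, hsmul, map_smul, RingHom.id_apply]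

variable (U) in
/-- The projection of `𝓕(U)` onto `𝓕(U)/{1}`. -/
def modConst : Fun U →ₗ[ℝ] FunModConst U := Submodule.mkQ (constants U).toSubmodule

theorem modConst_apply (f : Fun U) : modConst U f = LieSubmodule.Quotient.mk f := rfl

theorem modConst_surjective : Function.Surjective (modConst U) :=
  Submodule.mkQ_surjective (constants U).toSubmodule

theorem sub_mem_coboundaries {ι : Type} {v : ι → VF U} {η : ι → Fun U}
    {𝔥 : LieSubalgebra ℝ (VF U)} (B : Module.Basis ι ℝ 𝔥) (hB : ∀ i, (B i : VF U) = v i)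
    {F E : 𝔥 →ₗ[ℝ] FunModConst U} (hF : ∀ i, F (B i) = LieSubmodule.Quotient.mk (η i))
    {f : Fun U} (h : ∀ i, ((v i, η i + v i f) : Der (Fun U) × Fun U) ∈ graphOps E) :
    F - E ∈ LieH1.coboundaries ℝ 𝔥 (FunModConst U) := by
  -- By `h`, the value of `E` on `v i` is the class of `η i + v i f`, whence the sign.
  refine ⟨modConst U (-f), B.ext fun i => ?_⟩
  obtain ⟨w, hw, hE⟩ := h i
  obtain rfl : w = B i := Subtype.ext (hw.trans (hB i).symm)
  rw [LieH1.d0_apply, modConst_apply, lie_quotient_mk, LinearMap.sub_apply, hF, hB]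
  refine Eq.trans ?_ (congrArg _ hE.symm)
  rw [← modConst_apply, ← modConst_apply, ← modConst_apply, ← map_sub]
  congr 1
  rw [map_neg]
  exact (sub_add_cancel_left _ _).symm

theorem hasCohomology_of_basis {ι : Type} {m : ℕ} {v : ι → VF U} {η : (Fin m → ℝ) → ι → Fun U}
    (𝔥 : LieSubalgebra ℝ (VF U)) (B : Module.Basis ι ℝ 𝔥) (hB : ∀ i, (B i : VF U) = v i)
    (hspan : ∀ w : 𝔥, (w : VF U) ∈ Submodule.span ℝ (Set.range v))
    (h : Classifies (A := Fun U) v η) : HasCohomology v η := by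
  obtain ⟨F, hF⟩ := exists_linearMap_cochain B (modConst U) h.add h.smul
  have hcoc : ∀ c, F c ∈ LieH1.cocycles ℝ 𝔥 (FunModConst U) := fun c =>
    mem_cocycles_of_le_graphOps (opSpan_le_graphOps hB (hF c))
      (fun ha hb => opSpan_lie (h.lie c) ha hb) fun w => exists_mem_opSpan (η c) (hspan w)
  obtain ⟨Φ, hΦ⟩ := LieH1.exists_equiv_H1 F hcoc
    (by
      rintro c ⟨μ, hμ⟩
      obtain ⟨f, rfl⟩ := modConst_surjective μ
      refine h.inj c f fun i => quotient_mk_eq_iff.1 ?_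
      rw [← modConst_apply, ← hF, ← hμ, ← hB]
      rfl)
    (by
      intro E hE
      obtain ⟨c, f, hc⟩ := h.surj _ (isOpAlg_graphOps ⟨E, hE⟩) fun i => by
        obtain ⟨f, hf⟩ := modConst_surjective (E (B i))
        exact ⟨f, B i, hB i, hf.symm⟩
      exact ⟨c, sub_mem_coboundaries B hB (hF c) hc⟩)
  exact ⟨𝔥, B, Φ, hB, fun c => ⟨⟨F c, hcoc c⟩, hF c, hΦ c⟩⟩

theorem hasCohomology_of_classifies {ι : Type} {m : ℕ} {v : ι → VF U}
    {η : (Fin m → ℝ) → ι → Fun U} (h : Classifies (A := Fun U) v η) : HasCohomology v η := by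
  -- With all constants zero, the bracket condition of `Classifies` says that the `v i` span a Lie
  -- algebra.
  have hη0 : η 0 = fun _ => 0 := by
    funext i
    have := h.smul 0 0 i
    rwa [zero_smul, zero_smul] at this
  obtain ⟨𝔥, h𝔥⟩ : ∃ 𝔥 : LieSubalgebra ℝ (VF U),
      𝔥.toSubmodule = Submodule.span ℝ (Set.range v) :=
    ⟨{ Submodule.span ℝ (Set.range v) with
      lie_mem' := fun ha hb => span_lie_mem (by simpa only [hη0] using h.lie 0) ha hb }, rfl⟩
  let B := (Module.Basis.span h.linearIndependent).map (LinearEquiv.ofEq _ _ h𝔥.symm)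
  have hB : ∀ i, ((B i : 𝔥) : VF U) = v i := fun i => by
    change ((Module.Basis.span h.linearIndependent i : Submodule.span ℝ (Set.range v)) : VF U) = v i
    rw [Module.Basis.span_apply]
  exact hasCohomology_of_basis 𝔥 B hB (fun w => h𝔥 ▸ w.2) h

end VF3

/-! ## Normal forms over the whole space -/

namespace DiffOp

variable {A : Type} [CommRing A] [Algebra ℝ A]

/-- A frame with the properties of the smooth functions on `ℝ³` with respect to
`w = z - θ y` and the vector field `q + θ r`. -/
structure FullFrame (A : Type) [CommRing A] [Algebra ℝ A] extends Frame A where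
  ev_y : ev y = 0
  exists_q_add_r_eq : ∀ (θ : ℝ) (g : A), p g = 0 →
    ∃ f, p f = 0 ∧ q f + algebraMap ℝ A θ * r f = g
  exists_euler : ∀ (θ : ℝ) (k : A), p k = 0 → q k + algebraMap ℝ A θ * r k = 0 →
    ∃ f, p f = 0 ∧ q f + algebraMap ℝ A θ * r f = 0 ∧
      k - (z - algebraMap ℝ A θ * y) * r f ∈ scalars A
  eq_zero_of_mul_eq_zero : ∀ (θ : ℝ) (g : A), (z - algebraMap ℝ A θ * y) * g = 0 → g = 0

attribute [simp] FullFrame.ev_y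

namespace FullFrame

variable (F : FullFrame A)

/-- The coordinate `w = z - θ y`. -/
def w (θ : ℝ) : A := F.z - algebraMap ℝ A θ * F.y

@[simp] theorem p_w (θ : ℝ) : F.p (F.w θ) = 0 := by simp [w]
@[simp] theorem q_w (θ : ℝ) : F.q (F.w θ) = -algebraMap ℝ A θ := by simp [w]
@[simp] theorem r_w (θ : ℝ) : F.r (F.w θ) = 1 := by simp [w]
@[simp] theorem ev_w (θ : ℝ) : F.ev (F.w θ) = 0 := by simp [w]

/-- Invariance under `p` and `q + θ r`. -/
def Inv (θ : ℝ) (k : A) : Prop := F.p k = 0 ∧ F.q k + algebraMap ℝ A θ * F.r k = 0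

variable {F} {θ : ℝ}

namespace Inv

theorem add {k l : A} (hk : F.Inv θ k) (hl : F.Inv θ l) : F.Inv θ (k + l) := by
  obtain ⟨h1, h2⟩ := hk
  obtain ⟨h3, h4⟩ := hl
  exact ⟨by rw [map_add, h1, h3, add_zero], by rw [map_add, map_add]; linear_combination h2 + h4⟩

theorem mul {k l : A} (hk : F.Inv θ k) (hl : F.Inv θ l) : F.Inv θ (k * l) := by
  obtain ⟨h1, h2⟩ := hk
  obtain ⟨h3, h4⟩ := hl
  refine ⟨by simp [h1, h3], ?_⟩
  simp only [Derivation.leibniz, smul_eq_mul]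
  linear_combination l * h2 + k * h4

theorem const (c : ℝ) : F.Inv θ (algebraMap ℝ A c) := ⟨by simp, by simp⟩

theorem w : F.Inv θ (F.w θ) := ⟨by simp, by simp⟩

theorem cmul {k : A} (c : ℝ) (hk : F.Inv θ k) : F.Inv θ (algebraMap ℝ A c * k) := (const c).mul hk

theorem sub {k l : A} (hk : F.Inv θ k) (hl : F.Inv θ l) : F.Inv θ (k - l) := by
  have := hk.add (hl.cmul (-1))
  simpa [sub_eq_add_neg] using this

theorem r {k : A} (hk : F.Inv θ k) : F.Inv θ (F.r k) := by
  obtain ⟨h1, h2⟩ := hk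
  refine ⟨by rw [← F.r_p, h1, map_zero], ?_⟩
  have := congrArg F.r h2
  simp only [map_add, Derivation.leibniz, Derivation.map_algebraMap, smul_eq_mul, F.r_q] at this
  simpa using this

theorem mem_scalars {k : A} (hk : F.Inv θ k) (h : F.r k = 0) : k ∈ scalars A := by
  refine F.mem_scalars k hk.1 ?_ h
  simpa [h] using hk.2

/-- Such `k` are functions of w alone, with derivative `F.r k`. The constant w k'(w) vanishes at the
base point, where w = 0, and w can be cancelled. -/
theorem mem_scalars_of_euler {k : A} (hk : F.Inv θ k) (h : F.w θ * F.r k ∈ scalars A) :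
    k ∈ scalars A := by
  obtain ⟨c, hc⟩ := h
  have h0 : c = 0 := by simpa using congrArg F.ev hc
  subst h0
  refine hk.mem_scalars (F.eq_zero_of_mul_eq_zero θ _ ?_)
  simpa [FullFrame.w] using hc.symm

/-- If wk' + k = c, then w(k - c) has derivative zero and vanishes at w = 0, so k = c. Smoothness
across w = 0 is what excludes the solution 1/w. -/
theorem mem_scalars_of_euler_add {k : A} (hk : F.Inv θ k) (h : F.w θ * F.r k + k ∈ scalars A) :
    k ∈ scalars A := by
  obtain ⟨c, hc⟩ := h
  rw [Algebra.linearMap_apply] at hc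
  have h1 : F.Inv θ (F.w θ * (k - algebraMap ℝ A c)) := w.mul (hk.sub (const c))
  obtain ⟨d, hd⟩ := h1.mem_scalars (by
    simp only [Derivation.leibniz, map_sub, Derivation.map_algebraMap, smul_eq_mul, r_w]
    linear_combination -hc)
  have hd0 : d = 0 := by simpa using congrArg F.ev hd
  subst hd0
  refine ⟨c, ?_⟩
  have := F.eq_zero_of_mul_eq_zero θ (k - algebraMap ℝ A c) (by simpa [FullFrame.w] using hd.symm)
  exact (sub_eq_zero.1 this).symm

/-- Differentiating gives wk'' = 0, hence k' is constant. -/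
theorem exists_of_euler_sub {k : A} (hk : F.Inv θ k) (h : F.w θ * F.r k - k ∈ scalars A) :
    ∃ c : ℝ, k - algebraMap ℝ A c * F.w θ ∈ scalars A := by
  have h1 := map_eq_zero_of_mem_scalars F.r h
  simp only [map_sub, Derivation.leibniz, smul_eq_mul, r_w] at h1
  obtain ⟨c, hc⟩ := hk.r.mem_scalars
    (F.eq_zero_of_mul_eq_zero θ _ (by
      change F.w θ * _ = 0
      linear_combination h1))
  refine ⟨c, (hk.sub (w.cmul c)).mem_scalars ?_⟩
  rw [Algebra.linearMap_apply] at hc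
  simp [← hc]

end Inv

/-- Applying p isolates c, applying q + θr isolates d; this is comparison of coefficients for the
expressions that `exists_affine` produces. -/
theorem mem_scalars_affine {c d : ℝ} {k : A} (hk : F.Inv θ k)
    (h : algebraMap ℝ A c * F.x + algebraMap ℝ A d * F.y + k ∈ scalars A) :
    c = 0 ∧ d = 0 ∧ k ∈ scalars A := by
  have h1 := map_eq_zero_of_mem_scalars F.p h
  have h2 := map_eq_zero_of_mem_scalars F.q h
  have h3 := map_eq_zero_of_mem_scalars F.r h
  simp [hk.1] at h1
  simp at h2 h3
  have h4 := hk.2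
  have hc : c = 0 := F.algebraMap_eq_zero.1 h1
  have hd : d = 0 := by
    refine F.algebraMap_eq_zero.1 ?_
    rw [h3] at h4
    linear_combination h2 - h4
  subst hc hd
  exact ⟨rfl, rfl, by simpa using h⟩

theorem exists_affine {f : A} (h1 : F.p f ∈ scalars A)
    (h2 : F.q f + algebraMap ℝ A θ * F.r f ∈ scalars A) :
    ∃ (c d : ℝ) (k : A), F.Inv θ k ∧ f = algebraMap ℝ A c * F.x + algebraMap ℝ A d * F.y + k := by
  obtain ⟨c, hc⟩ := h1
  obtain ⟨d, hd⟩ := h2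
  rw [Algebra.linearMap_apply] at hc hd
  refine ⟨c, d, f - (algebraMap ℝ A c * F.x + algebraMap ℝ A d * F.y), ⟨by simp [← hc], ?_⟩, by ring⟩
  simp
  linear_combination -hd

variable (F) in
/-- The vector field `q + θ r`. -/
def v₀ (θ : ℝ) : Der A := F.vf 0 1 (algebraMap ℝ A θ)

variable (F) in
/-- The vector field `x p + a w r`. -/
def e₁ (θ a : ℝ) : Der A := F.vf F.x 0 (algebraMap ℝ A a * F.w θ)

variable (F) in
/-- The vector field `y (q + θ r) + b w r`. -/
def e₂ (θ b : ℝ) : Der A :=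
  F.vf 0 F.y (algebraMap ℝ A θ * F.y + algebraMap ℝ A b * F.w θ)

theorem p_apply (f : A) : F.vf 1 0 0 f = F.p f := by simp [Frame.vf_apply]

theorem v₀_apply (f : A) : F.v₀ θ f = F.q f + algebraMap ℝ A θ * F.r f := by
  simp [v₀, Frame.vf_apply]

theorem e₁_affine {k : A} (hk : F.Inv θ k) (a c d : ℝ) :
    F.e₁ θ a (algebraMap ℝ A c * F.x + algebraMap ℝ A d * F.y + k) =
      algebraMap ℝ A c * F.x + algebraMap ℝ A a * (F.w θ * F.r k) := by
  simp [e₁, Frame.vf_apply, hk.1]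
  ring

theorem e₂_affine {k : A} (hk : F.Inv θ k) (b c d : ℝ) :
    F.e₂ θ b (algebraMap ℝ A c * F.x + algebraMap ℝ A d * F.y + k) =
      algebraMap ℝ A d * F.y + algebraMap ℝ A b * (F.w θ * F.r k) := by
  have h := hk.2
  simp [e₂, Frame.vf_apply]
  linear_combination F.y * h

theorem lie_p_v₀ : ⁅F.vf 1 0 0, F.v₀ θ⁆ = 0 := by
  rw [v₀, Frame.vf_lie, ← F.vf_zero]
  congr 1 <;> simp [Frame.vf_apply]

theorem lie_p_e₁ (a : ℝ) : ⁅F.vf 1 0 0, F.e₁ θ a⁆ = F.vf 1 0 0 := by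
  rw [e₁, Frame.vf_lie]
  congr 1 <;> simp [Frame.vf_apply]

theorem lie_v₀_e₁ (a : ℝ) : ⁅F.v₀ θ, F.e₁ θ a⁆ = 0 := by
  rw [e₁, v₀, Frame.vf_lie, ← F.vf_zero]
  congr 1 <;> simp [Frame.vf_apply]

theorem lie_p_e₂ (b : ℝ) : ⁅F.vf 1 0 0, F.e₂ θ b⁆ = 0 := by
  rw [e₂, Frame.vf_lie, ← F.vf_zero]
  congr 1 <;> simp [Frame.vf_apply]

theorem lie_v₀_e₂ (b : ℝ) : ⁅F.v₀ θ, F.e₂ θ b⁆ = F.v₀ θ := by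
  rw [e₂, v₀, Frame.vf_lie]
  congr 1 <;> simp [Frame.vf_apply]
  ring

theorem lie_e₁_e₂ (a b : ℝ) : ⁅F.e₁ θ a, F.e₂ θ b⁆ = 0 := by
  rw [e₁, e₂, Frame.vf_lie, ← F.vf_zero]
  congr 1 <;> simp [Frame.vf_apply]
  ring

theorem exists_shift_p {G : Submodule ℝ (Der A × A)} (h : ∃ f, (F.vf 1 0 0, f) ∈ G) :
    ∃ l, (F.vf 1 0 0, 0) ∈ shift G l := by
  obtain ⟨f, hf⟩ := h
  obtain ⟨l, rfl⟩ := F.exists_p_eq f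
  exact ⟨l, by rwa [mem_shift, p_apply, zero_add]⟩

/-- The term of v₀ has constant derivative c along p. Its part independent of x is removed by
integration along q + θr, which leaves cx. Applying p to the relation of v₀ with the commuting field
e₁ then forces c = 0, because [p, e₁] = p makes p(g) constant for the term g of e₁. -/
theorem exists_shift_v₀ {G : Submodule ℝ (Der A × A)} (hG : IsOpAlg G) {a : ℝ}
    (hp : (F.vf 1 0 0, 0) ∈ G) (hv : ∃ f, (F.v₀ θ, f) ∈ G) (he : ∃ f, (F.e₁ θ a, f) ∈ G) :
    ∃ l, (F.vf 1 0 0, 0) ∈ shift G l ∧ (F.v₀ θ, 0) ∈ shift G l := by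
  obtain ⟨f, hf⟩ := hv
  obtain ⟨h, hh⟩ := he
  have h1 := hG.rel_zero hp hf lie_p_v₀
  rw [map_zero, sub_zero, p_apply] at h1
  obtain ⟨c, hc⟩ := h1
  rw [Algebra.linearMap_apply] at hc
  obtain ⟨l, hl, hl'⟩ := F.exists_q_add_r_eq θ (f - algebraMap ℝ A c * F.x) (by simp [← hc])
  have hp' : (F.vf 1 0 0, 0) ∈ shift G l := by
    rwa [mem_shift, p_apply, hl, add_zero]
  refine ⟨l, hp', ?_⟩
  have hv' : (F.v₀ θ, algebraMap ℝ A c * F.x) ∈ shift G l := by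
    rw [mem_shift, v₀_apply, hl', add_sub_cancel]
    exact hf
  have he' : (F.e₁ θ a, h - F.e₁ θ a l) ∈ shift G l := by
    rw [mem_shift, sub_add_cancel]
    exact hh
  generalize h - F.e₁ θ a l = g at he'
  have h2 := (hG.shift l).rel_mem hp' he' (by rwa [lie_p_e₁])
  have h3 := map_eq_zero_of_mem_scalars F.p ((hG.shift l).rel_zero hv' he' (lie_v₀_e₁ a))
  rw [p_apply] at h2
  have hq := map_eq_zero_of_mem_scalars F.q h2
  have hr := map_eq_zero_of_mem_scalars F.r h2
  rw [v₀_apply] at h3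
  simp [e₁, Frame.vf_apply, ← F.q_p, ← F.r_p, hq, hr] at h3
  have hc0 := F.algebraMap_eq_zero.1 h3
  subst hc0
  simpa using hv'

/-- The terms are cᵢx + dᵢy + kᵢ(w). As e₁ and e₂ commute, c₂ = d₁ = 0 and ak₂ - bk₁ is constant; so
modulo constants (k₁, k₂) is proportional to (a, b), and one function l(w) serves both fields. If a
= b = 0, no function of w could change k₁ or k₂. -/
theorem exists_shift_e {G : Submodule ℝ (Der A × A)} (hG : IsOpAlg G) {a b : ℝ}
    (hab : a ^ 2 + b ^ 2 ≠ 0)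
    (hp : (F.vf 1 0 0, 0) ∈ G) (hv : (F.v₀ θ, 0) ∈ G) (h₁ : ∃ f, (F.e₁ θ a, f) ∈ G)
    (h₂ : ∃ f, (F.e₂ θ b, f) ∈ G) :
    ∃ l, (F.vf 1 0 0, 0) ∈ shift G l ∧ (F.v₀ θ, 0) ∈ shift G l ∧ (F.e₁ θ a, 0) ∈ shift G l ∧
      (F.e₂ θ b, 0) ∈ shift G l := by
  obtain ⟨f₁, hf₁⟩ := h₁
  obtain ⟨f₂, hf₂⟩ := h₂
  have hp1 := hG.rel_mem hp hf₁ (by rwa [lie_p_e₁])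
  have hv1 := hG.rel_mem hv hf₁ (by rw [lie_v₀_e₁]; exact zero_mem G)
  have hp2 := hG.rel_mem hp hf₂ (by rw [lie_p_e₂]; exact zero_mem G)
  have hv2 := hG.rel_mem hv hf₂ (by rwa [lie_v₀_e₂])
  have h12 := hG.rel_zero hf₁ hf₂ (lie_e₁_e₂ a b)
  rw [p_apply] at hp1 hp2
  rw [v₀_apply] at hv1 hv2
  obtain ⟨c₁, d₁, k₁, hk₁, rfl⟩ := exists_affine hp1 hv1
  obtain ⟨c₂, d₂, k₂, hk₂, rfl⟩ := exists_affine hp2 hv2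
  rw [e₁_affine hk₂, e₂_affine hk₁] at h12
  have hk : F.Inv θ (algebraMap ℝ A a * k₂ - algebraMap ℝ A b * k₁) :=
    (hk₂.cmul a).sub (hk₁.cmul b)
  obtain ⟨hc₂, hd₁, hk'⟩ := mem_scalars_affine (F := F) (θ := θ) (c := c₂) (d := -d₁)
    (Inv.w.mul hk.r) (by
      convert h12 using 1
      simp
      ring)
  obtain ⟨e, he⟩ := hk.mem_scalars_of_euler hk'
  rw [Algebra.linearMap_apply] at he
  obtain rfl : d₁ = 0 := by simpa using hd₁
  subst hc₂
  -- Modulo constants k₁ = ak and k₂ = bk with k = (ak₁ + bk₂)/(a² + b²), so the equation to solve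
  -- is wl' = k up to a constant.
  obtain ⟨l, hl, hl', e', he'⟩ := F.exists_euler θ
    (algebraMap ℝ A (a ^ 2 + b ^ 2)⁻¹ * (algebraMap ℝ A a * k₁ + algebraMap ℝ A b * k₂))
    (((hk₁.cmul a).add (hk₂.cmul b)).cmul _).1 (((hk₁.cmul a).add (hk₂.cmul b)).cmul _).2
  rw [Algebra.linearMap_apply, ← w] at he'
  have hli : F.Inv θ l := ⟨hl, hl'⟩
  have hn : algebraMap ℝ A (a ^ 2 + b ^ 2)⁻¹ * (algebraMap ℝ A a ^ 2 + algebraMap ℝ A b ^ 2) = 1 := by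
    rw [← map_pow, ← map_pow, ← map_add, ← map_mul, inv_mul_cancel₀ hab, map_one]
  -- The linear part is reproduced by e₁ and e₂, and it changes the terms of p and v₀ by constants
  -- only.
  refine ⟨algebraMap ℝ A c₁ * F.x + algebraMap ℝ A d₂ * F.y + l, ?_, ?_, ?_, ?_⟩
  · refine hG.congr hp ?_
    simp [p_apply, hl, ← map_neg]
  · refine hG.congr hv ?_
    have : F.v₀ θ (algebraMap ℝ A c₁ * F.x + algebraMap ℝ A d₂ * F.y + l) = algebraMap ℝ A d₂ := by
      rw [v₀_apply]
      simp
      linear_combination hl'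
    simp [this, ← map_neg]
  · refine hG.congr hf₁ ⟨-(a ^ 2 + b ^ 2)⁻¹ * b * e + a * e', ?_⟩
    rw [e₁_affine hli]
    simp only [Algebra.linearMap_apply, map_add, map_mul, map_neg, map_zero]
    linear_combination (-algebraMap ℝ A (a ^ 2 + b ^ 2)⁻¹ * algebraMap ℝ A b) * he +
      algebraMap ℝ A a * he' + k₁ * hn
  · refine hG.congr hf₂ ⟨(a ^ 2 + b ^ 2)⁻¹ * a * e + b * e', ?_⟩
    rw [e₂_affine hli]
    simp only [Algebra.linearMap_apply, map_add, map_mul, map_zero]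
    linear_combination (algebraMap ℝ A (a ^ 2 + b ^ 2)⁻¹ * algebraMap ℝ A a) * he +
      algebraMap ℝ A b * he' + k₂ * hn

theorem exists_shift {G : Submodule ℝ (Der A × A)} (hG : IsOpAlg G) {a b : ℝ}
    (hab : a ^ 2 + b ^ 2 ≠ 0) (hp : ∃ f, (F.vf 1 0 0, f) ∈ G) (hv : ∃ f, (F.v₀ θ, f) ∈ G)
    (h₁ : ∃ f, (F.e₁ θ a, f) ∈ G) (h₂ : ∃ f, (F.e₂ θ b, f) ∈ G) :
    ∃ l, (F.vf 1 0 0, 0) ∈ shift G l ∧ (F.v₀ θ, 0) ∈ shift G l ∧ (F.e₁ θ a, 0) ∈ shift G l ∧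
      (F.e₂ θ b, 0) ∈ shift G l := by
  have key : ∀ {G : Submodule ℝ (Der A × A)} (l : A) {v : Der A}, (∃ f, (v, f) ∈ G) →
      ∃ f, (v, f) ∈ shift G l := fun {G} l {v} ⟨f, hf⟩ =>
    ⟨f - v l, by rwa [mem_shift, sub_add_cancel]⟩
  obtain ⟨l₁, hl₁⟩ := exists_shift_p hp
  obtain ⟨l₂, hl₂⟩ := exists_shift_v₀ (hG.shift l₁) hl₁ (key _ hv) (key _ h₁)
  have := exists_shift_e ((hG.shift l₁).shift l₂) hab hl₂.1 hl₂.2 (key _ (key _ h₁))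
    (key _ (key _ h₂))
  simp only [shift_shift] at this
  obtain ⟨l₃, hl₃⟩ := this
  exact ⟨_, hl₃⟩

end FullFrame

/-- A frame with the properties of the smooth functions on a half-space `y > 0` or `y < 0`. -/
structure HalfFrame (A : Type) [CommRing A] [Algebra ℝ A] extends Frame A where
  yi : A
  y_mul_yi : y * yi = 1
  exists_r_eq : ∀ g, p g = 0 → ∃ f, p f = 0 ∧ r f = g
  exists_q_eq : ∀ g, p g = 0 → r g = 0 → ∃ f, p f = 0 ∧ r f = 0 ∧ q f = g
  eq_zero_of_mul_eq_zero : ∀ g, z * g = 0 → g = 0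

end DiffOp

/-! ## The frames of smooth functions -/

namespace VF3

open DiffOp Set

variable {U : TopologicalSpace.Opens R3}

theorem dir_vec (a b c : ℝ) (f : Fun U) :
    dir ![a, b, c] f = a • pderiv U 0 f + b • pderiv U 1 f + c • pderiv U 2 f := by
  rw [dir_apply]
  rfl

/-- Evaluation at a point. -/
def evalAt (u : U) : Fun U →ₐ[ℝ] ℝ := (Pi.evalAlgHom ℝ (fun _ : U => ℝ) u).comp (smoothFun U).val

/-- The linear form `z - θ y`. -/
def wForm (θ : ℝ) : R3 →L[ℝ] ℝ :=
  ContinuousLinearMap.proj (R := ℝ) (φ := fun _ : Fin 3 => ℝ) 2 -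
    θ • ContinuousLinearMap.proj (R := ℝ) (φ := fun _ : Fin 3 => ℝ) 1

theorem wForm_apply (θ : ℝ) (a : R3) : wForm θ a = a 2 - θ * a 1 := by simp [wForm]

/-- Off the hyperplane `l = 0` one can divide; on it the value is a limit along the direction `e`,
which leaves the hyperplane. -/
theorem eq_zero_of_form_mul_eq_zero (l : R3 →L[ℝ] ℝ) (e : R3) (hl : l e = 1)
    (hU : ∀ a ∈ U, ∀ t : ℝ, a + t • e ∈ U) {g : Fun U} (h : ∀ u : U, l u * g.1 u = 0) : g = 0 := by
  refine Fun.ext fun u => ?_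
  change g.1 u = 0
  by_cases hu : l u = 0
  · have hc : ContinuousAt (fun t : ℝ => ext0 g.1 ((u : R3) + t • e)) 0 := by
      have h1 : ContinuousAt (ext0 g.1) ((u : R3) + (0 : ℝ) • e) := by
        simpa using (g.differentiableAt u).continuousAt
      exact ContinuousAt.comp (f := fun t : ℝ => (u : R3) + t • e) h1 (by fun_prop)
    have h0 : ∀ t : ℝ, t ≠ 0 → ext0 g.1 ((u : R3) + t • e) = 0 := by
      intro t ht
      have h2 := h ⟨_, hU u u.2 t⟩
      rw [← ext0_apply g.1] at h2
      simpa [hu, hl, ht] using h2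
    have h3 : Filter.Tendsto (fun t : ℝ => ext0 g.1 ((u : R3) + t • e)) (nhdsWithin 0 {0}ᶜ)
        (nhds 0) :=
      tendsto_const_nhds.congr' (by
        filter_upwards [self_mem_nhdsWithin] with t ht using (h0 t ht).symm)
    have h4 := tendsto_nhds_unique (hc.tendsto.mono_left nhdsWithin_le_nhds) h3
    rw [← ext0_apply g.1]
    simpa using h4
  · exact (mul_eq_zero.1 (h u)).resolve_left hu

/-- The coordinate frame on a convex open set. -/
def frame (U : TopologicalSpace.Opens R3) (hU : Convex ℝ (U : Set R3)) (u : U)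
    (h0 : (u : R3) 0 = 0) (h2 : (u : R3) 2 = 0) (hx : ∀ a ∈ U, ∀ t : ℝ, a + t • ![1, 0, 0] ∈ U) :
    Frame (Fun U) where
  p := pderiv U 0
  q := pderiv U 1
  r := pderiv U 2
  x := TypeIII.x
  y := TypeIII.y
  z := TypeIII.z
  ev := evalAt u
  ev_x := h0
  ev_z := h2
  p_x := TypeIII.pderiv_zero_x
  p_y := TypeIII.pderiv_zero_y
  p_z := TypeIII.pderiv_zero_z
  q_x := TypeIII.pderiv_one_x
  q_y := TypeIII.pderiv_one_y
  q_z := TypeIII.pderiv_one_z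
  r_x := TypeIII.pderiv_two_x
  r_y := TypeIII.pderiv_two_y
  r_z := TypeIII.pderiv_two_z
  q_p := pderiv_comm 1 0
  r_p := pderiv_comm 2 0
  r_q := pderiv_comm 2 1
  mem_scalars := fun f hp hq hr =>
    mem_constants_of_pderiv_eq_zero hU ⟨u, u.2⟩ (fun i => by fin_cases i <;> assumption)
  exists_p_eq := fun g => by
    obtain ⟨f, hf, -⟩ := exists_dir_eq ![1, 0, 0]
      (ContinuousLinearMap.proj (R := ℝ) (φ := fun _ : Fin 3 => ℝ) 0) rfl 0
      (fun a ha t _ => hx a ha _) g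
    refine ⟨f, ?_⟩
    rw [← hf, dir_vec]
    module

/-- Hadamard's lemma in the variable w: k(w) - k(0) = w ∫₀¹ k'(tw) dt, with the integral as the
smooth quotient. -/
theorem exists_euler_quotient (θ : ℝ) {k : Fun ⊤} (hp : pderiv ⊤ 0 k = 0)
    (hq : pderiv ⊤ 1 k + θ • pderiv ⊤ 2 k = 0) :
    ∃ m : Fun ⊤, ∃ c : ℝ, ∀ u : (⊤ : TopologicalSpace.Opens R3), c + wForm θ u * m.1 u = k.1 u := by
  obtain ⟨e, he⟩ : ∃ e : R3, e = ![0, 0, 1] := ⟨_, rfl⟩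
  let φ : R3 × ℝ → R3 := fun b => b.1 + ((b.2 - 1) * wForm θ b.1) • e
  have hφ : ContDiff ℝ ∞ φ := by fun_prop
  have hg : ContDiff ℝ ∞ (ext0 (pderiv ⊤ 2 k).1) := contDiffOn_univ.1 (pderiv ⊤ 2 k).2
  have hk : ContDiff ℝ ∞ (ext0 k.1) := contDiffOn_univ.1 k.2
  have hm : ContDiffOn ℝ ∞ (fun a => ∫ t in (0 : ℝ)..1, ext0 (pderiv ⊤ 2 k).1 (φ (a, t)))
      (⊤ : TopologicalSpace.Opens R3) :=
    contDiffOn_infty.2 fun n => contDiffOn_integral_unit isOpen_univ isOpen_univ (by simp) n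
      (G := fun b => ext0 (pderiv ⊤ 2 k).1 (φ b)) (hg.comp hφ).contDiffOn
  refine ⟨Fun.of _ hm, ext0 k.1 0, fun u => ?_⟩
  have h1 : ∀ t : ℝ, HasDerivAt (fun t : ℝ => ext0 k.1 (φ (u, t)))
      (wForm θ u * ext0 (pderiv ⊤ 2 k).1 (φ (u, t))) t := by
    intro t
    have h2 : HasFDerivAt (ext0 k.1) (fderiv ℝ (ext0 k.1) (φ (u, t))) (φ (u, t)) :=
      (hk.differentiable (by simp) _).hasFDerivAt
    have h3 : HasDerivAt (fun t : ℝ => φ (u, t)) (wForm θ u • e) t := by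
      have := ((((hasDerivAt_id t).sub_const 1).mul_const (wForm θ u)).smul_const
        e).const_add (u : R3)
      rw [one_mul] at this
      exact this
    have h4 := h2.comp_hasDerivAt t h3
    have h5 : fderiv ℝ (ext0 k.1) (φ (u, t)) e = ext0 (pderiv ⊤ 2 k).1 (φ (u, t)) := by
      rw [ext0_apply _ ⟨φ (u, t), TopologicalSpace.Opens.mem_top _⟩, 
        ← dir_apply_val _ k ⟨φ (u, t), TopologicalSpace.Opens.mem_top _⟩, he, dir_vec]
      simp only [zero_smul, one_smul, zero_add]
    rwa [map_smul, h5, smul_eq_mul] at h4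
  have h6 := intervalIntegral.integral_eq_sub_of_hasDerivAt (a := 0) (b := 1)
    (fun t _ => h1 t) (Continuous.intervalIntegrable
      (continuous_const.mul (hg.continuous.comp (hφ.continuous.comp (by fun_prop)))) _ _)
  rw [intervalIntegral.integral_const_mul] at h6
  have h7 : φ (u, 1) = u := by simp [φ]
  have h8 : φ (u, 0) = ![(u : R3) 0, (u : R3) 1, θ * (u : R3) 1] := by
    have h10 : ∀ i, φ (u, 0) i = (u : R3) i + ((0 - 1) * wForm θ u) * e i := fun i => rfl
    ext i
    rw [h10, wForm_apply, he]
    fin_cases i <;> simp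
  -- The plane w = 0 is spanned by the directions p and q + θr, along which `k` is constant.
  have h9 : ext0 k.1 (φ (u, 0)) = ext0 k.1 0 := by
    refine eq_of_fderiv_eq_zero isOpen_univ (f := ext0 k.1) hk.contDiffOn (subset_univ _)
      fun c _ => ?_
    rw [← dir_apply_val _ k ⟨c, TopologicalSpace.Opens.mem_top _⟩, sub_zero, h8, dir_vec, hp, smul_zero, zero_add, mul_comm,
      mul_smul, ← smul_add, hq, smul_zero]
    rfl
  change ext0 k.1 0 + wForm θ u * (∫ t in (0 : ℝ)..1, ext0 (pderiv ⊤ 2 k).1 (φ (u, t))) = _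
  rw [h6, h7, h9, ← ext0_apply k.1 u]
  ring

/-- The solution is a z-primitive of the Hadamard quotient `m`. Differentiating c + wm = k along p
or q + θr and cancelling w shows that `m` depends on w only. Integration starts at w = 0, a plane
tangent to both fields, so the primitive inherits this. -/
theorem exists_euler (θ : ℝ) {k : Fun ⊤} (hp : pderiv ⊤ 0 k = 0)
    (hq : pderiv ⊤ 1 k + θ • pderiv ⊤ 2 k = 0) :
    ∃ f : Fun ⊤, pderiv ⊤ 0 f = 0 ∧ pderiv ⊤ 1 f + θ • pderiv ⊤ 2 f = 0 ∧
      ∃ c : ℝ, ∀ u : (⊤ : TopologicalSpace.Opens R3), c + wForm θ u * (pderiv ⊤ 2 f).1 u = k.1 u := by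
  obtain ⟨m, c, hm⟩ := exists_euler_quotient θ hp hq
  have hd : ∀ d, wForm θ d = 0 → dir d k = 0 → dir d m = 0 := by
    intro d hd hdk
    refine eq_zero_of_form_mul_eq_zero (wForm θ) ![0, 0, 1] (by simp [wForm_apply])
      (fun _ _ _ => TopologicalSpace.Opens.mem_top _) fun u => ?_
    have h1 : HasFDerivAt (fun a => c + wForm θ a * ext0 m.1 a)
        (wForm θ u • fderiv ℝ (ext0 m.1) u + ext0 m.1 u • wForm θ) u :=
      ((wForm θ).hasFDerivAt.mul (m.differentiableAt u).hasFDerivAt).const_add c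
    have h2 : (fun a => c + wForm θ a * ext0 m.1 a) = ext0 k.1 := by
      funext a
      rw [ext0_apply _ ⟨a, TopologicalSpace.Opens.mem_top _⟩, ext0_apply _ ⟨a, TopologicalSpace.Opens.mem_top _⟩]
      exact hm ⟨a, TopologicalSpace.Opens.mem_top _⟩
    rw [h2] at h1
    have h3 := dir_apply_val d k u
    rw [h1.fderiv, hdk] at h3
    rw [dir_apply_val]
    simpa [hd] using h3.symm
  obtain ⟨f, hf, hfd⟩ := exists_dir_eq ![0, 0, 1] (wForm θ) (by simp [wForm_apply]) 0
    (fun _ _ _ _ => TopologicalSpace.Opens.mem_top _) m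
  rw [dir_vec, zero_smul, zero_smul, one_smul, zero_add, zero_add] at hf
  have h1 := hfd ![1, 0, 0] (by simp [wForm_apply])
    (hd _ (by simp [wForm_apply]) (by rw [dir_vec, hp]; module))
  have h2 := hfd ![0, 1, θ] (by simp [wForm_apply])
    (hd _ (by simp [wForm_apply]) (by rw [dir_vec, one_smul, zero_smul, zero_add, hq]))
  rw [dir_vec, one_smul, zero_smul, zero_smul, add_zero, add_zero] at h1
  rw [dir_vec, one_smul, zero_smul, zero_add] at h2
  exact ⟨f, h1, h2, c, by rw [hf]; exact hm⟩

theorem algebraMap_mul_eq_smul (c : ℝ) (f : Fun U) : algebraMap ℝ (Fun U) c * f = c • f :=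
  (Algebra.smul_def c f).symm

/-- The coordinate frame on `ℝ³`. -/
def fullFrame : FullFrame (Fun ⊤) where
  toFrame := frame ⊤ convex_univ ⟨0, TopologicalSpace.Opens.mem_top _⟩ rfl rfl fun _ _ _ => TopologicalSpace.Opens.mem_top _
  ev_y := rfl
  exists_q_add_r_eq := by
    intro θ g hg
    change pderiv ⊤ 0 g = 0 at hg
    obtain ⟨f, hf, hfd⟩ := exists_dir_eq ![0, 1, θ]
      (ContinuousLinearMap.proj (R := ℝ) (φ := fun _ : Fin 3 => ℝ) 1) rfl 0
      (fun _ _ _ _ => TopologicalSpace.Opens.mem_top _) g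
    have h1 := hfd ![1, 0, 0] rfl (by rw [dir_vec, hg]; module)
    rw [dir_vec, one_smul, zero_smul, zero_smul, add_zero, add_zero] at h1
    rw [dir_vec, one_smul, zero_smul, zero_add] at hf
    refine ⟨f, h1, ?_⟩
    rw [algebraMap_mul_eq_smul]
    exact hf
  exists_euler := by
    intro θ k hp hq
    rw [algebraMap_mul_eq_smul] at hq
    obtain ⟨f, h1, h2, c, hc⟩ := exists_euler θ hp hq
    refine ⟨f, h1, ?_, c, Fun.ext fun u => ?_⟩
    · rw [algebraMap_mul_eq_smul]
      exact h2
    · have := hc u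
      rw [wForm_apply] at this
      change c = k.1 u - ((u : R3) 2 - θ * (u : R3) 1) * (pderiv ⊤ 2 f).1 u
      rw [← this]
      ring
  eq_zero_of_mul_eq_zero := by
    intro θ g h
    refine eq_zero_of_form_mul_eq_zero (wForm θ) ![0, 0, 1] (by simp [wForm_apply])
      (fun _ _ _ => TopologicalSpace.Opens.mem_top _) fun u => ?_
    rw [wForm_apply]
    exact congrArg (fun f : Fun ⊤ => f.1 u) h

theorem convex_halfSpace (ε : ℝ) : Convex ℝ (TypeIII.halfSpace ε : Set R3) := by
  have h : IsLinearMap ℝ fun a : R3 => ε * a 1 :=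
    ⟨fun a b => mul_add _ _ _, fun c a => by simp only [Pi.smul_apply, smul_eq_mul]; ring⟩
  exact convex_halfSpace_gt h 0

theorem mem_halfSpace {ε : ℝ} {a : R3} : a ∈ TypeIII.halfSpace ε ↔ 0 < ε * a 1 := Iff.rfl

theorem add_smul_mem_halfSpace {ε : ℝ} {a e : R3} (ha : a ∈ TypeIII.halfSpace ε) (he : e 1 = 0)
    (t : ℝ) : a + t • e ∈ TypeIII.halfSpace ε := by
  have h : (a + t • e) 1 = a 1 + t * e 1 := rfl
  rw [mem_halfSpace, h, he, mul_zero, add_zero]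
  exact ha

/-- The coordinate frame on a half-space. -/
def halfFrame (ε : ℝ) (hε : ε ≠ 0) : HalfFrame (Fun (TypeIII.halfSpace ε)) where
  toFrame := frame _ (convex_halfSpace ε)
    ⟨![0, ε, 0], mem_halfSpace.2 (by simpa using mul_self_pos.2 hε)⟩ rfl rfl
    fun a ha t => add_smul_mem_halfSpace ha rfl t
  yi := TypeIII.yInv ε
  y_mul_yi := Fun.ext fun u => by
    have hu : (u : R3) 1 ≠ 0 := fun h => by
      have := mem_halfSpace.1 u.2
      simp [h] at this
    exact mul_inv_cancel₀ hu
  exists_r_eq := by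
    intro g hg
    change pderiv _ 0 g = 0 at hg
    obtain ⟨f, hf, hfd⟩ := exists_dir_eq ![0, 0, 1]
      (ContinuousLinearMap.proj (R := ℝ) (φ := fun _ : Fin 3 => ℝ) 2) rfl 0
      (fun a ha t _ => add_smul_mem_halfSpace ha rfl _) g
    have h1 := hfd ![1, 0, 0] rfl (by rw [dir_vec, hg]; module)
    rw [dir_vec, one_smul, zero_smul, zero_smul, add_zero, add_zero] at h1
    rw [dir_vec, one_smul, zero_smul, zero_smul, zero_add, zero_add] at hf
    exact ⟨f, h1, hf⟩
  exists_q_eq := by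
    intro g hp hr
    change pderiv _ 0 g = 0 at hp
    change pderiv _ 2 g = 0 at hr
    obtain ⟨f, hf, hfd⟩ := exists_dir_eq ![0, 1, 0]
      -- The plane y = 0 lies outside the half-space; y = ε lies inside because ε² > 0.
      (ContinuousLinearMap.proj (R := ℝ) (φ := fun _ : Fin 3 => ℝ) 1) rfl ε
      (fun a ha t ht => by
        rw [mem_halfSpace] at ha ⊢
        have h1 : ε * (a 1 + ((t - 1) * (a 1 - ε)) * 1) = t * (ε * a 1) + (1 - t) * (ε * ε) := by
          ring
        have h2 := mul_self_pos.2 hε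
        change 0 < ε * (a 1 + ((t - 1) * (a 1 - ε)) * 1)
        rw [h1]
        rcases ht.1.eq_or_lt with h | h
        · rw [← h]; simpa using h2
        · have := mul_pos h ha
          have := mul_nonneg (sub_nonneg.2 ht.2) h2.le
          linarith) g
    have h1 := hfd ![1, 0, 0] rfl (by rw [dir_vec, hp]; module)
    have h2 := hfd ![0, 0, 1] rfl (by rw [dir_vec, hr]; module)
    rw [dir_vec, one_smul, zero_smul, zero_smul, add_zero, add_zero] at h1
    rw [dir_vec, one_smul, zero_smul, zero_smul, zero_add, zero_add] at h2
    rw [dir_vec, one_smul, zero_smul, zero_smul, zero_add, add_zero] at hf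
    exact ⟨f, h1, h2, hf⟩
  eq_zero_of_mul_eq_zero := by
    intro g h
    refine eq_zero_of_form_mul_eq_zero
      (ContinuousLinearMap.proj (R := ℝ) (φ := fun _ : Fin 3 => ℝ) 2) ![0, 0, 1] rfl
      (fun a ha t => add_smul_mem_halfSpace ha rfl t) fun u => ?_
    exact congrArg (fun f : Fun (TypeIII.halfSpace ε) => f.1 u) h

end VF3

namespace DiffOp

/-- The truncated exponent at `i = 0` does no harm, since the coefficient is zero there. This lets
the bracket formulas below be stated without case distinctions. -/
theorem x_mul_pow_pred {B : Type*} [CommRing B] (i : ℕ) (a : B) : a * ((i : B) * a ^ (i - 1)) = i * a ^ i := by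
  rcases i with _ | i
  · simp
  · simp only [Nat.add_sub_cancel]
    ring

variable {A : Type} [CommRing A] [Algebra ℝ A]

/-! ## Commutators of polynomial operators -/

namespace Frame

variable (F : Frame A)

/-- The first order operator `f p + g q + h r + e`. -/
def op (f g h e : A) : Der A × A := (F.vf f g h, e)

theorem opLie_op (f g h e f' g' h' e' : A) :
    opLie (F.op f g h e) (F.op f' g' h' e') =
      F.op (f * F.p f' + g * F.q f' + h * F.r f' - (f' * F.p f + g' * F.q f + h' * F.r f))
        (f * F.p g' + g * F.q g' + h * F.r g' - (f' * F.p g + g' * F.q g + h' * F.r g))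
        (f * F.p h' + g * F.q h' + h * F.r h' - (f' * F.p h + g' * F.q h + h' * F.r h))
        (f * F.p e' + g * F.q e' + h * F.r e' - (f' * F.p e + g' * F.q e + h' * F.r e)) := by
  simp only [op, opLie, vf_lie, vf_apply]

theorem smul_op (c : ℝ) (f g h e : A) :
    c • F.op f g h e = F.op (algebraMap ℝ A c * f) (algebraMap ℝ A c * g) (algebraMap ℝ A c * h)
      (algebraMap ℝ A c * e) := by
  simp only [op, Prod.smul_mk, vf_smul, Algebra.smul_def]

theorem add_op (f g h e f' g' h' e' : A) :
    F.op f g h e + F.op f' g' h' e' = F.op (f + f') (g + g') (h + h') (e + e') := by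
  simp only [op, Prod.mk_add_mk, vf_add]

theorem zero_op : (0 : Der A × A) = F.op 0 0 0 0 := by
  rw [op, vf_zero]
  rfl

/-- The constant `c` as an operator. -/
def opC (c : ℝ) : Der A × A := F.op 0 0 0 (algebraMap ℝ A c)
/-- `p` -/
def opP : Der A × A := F.op 1 0 0 0
/-- `xⁱ q` -/
def opQ (i : ℕ) : Der A × A := F.op 0 (F.x ^ i) 0 0
/-- `xˡ yᵐ r` -/
def opR (l m : ℕ) : Der A × A := F.op 0 0 (F.x ^ l * F.y ^ m) 0
/-- `x p` -/
def opXP : Der A × A := F.op F.x 0 0 0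
/-- `y q` -/
def opYQ : Der A × A := F.op 0 F.y 0 0
/-- `z r` -/
def opZR : Der A × A := F.op 0 0 F.z 0
/-- `x² p + s x y q + k x z r + c x` -/
def opX2 (s k c : ℝ) : Der A × A := F.op (F.x ^ 2) (s • (F.x * F.y)) (k • (F.x * F.z)) (c • F.x)
/-- `y² q + b y z r + d y` -/
def opY2 (b d : ℝ) : Der A × A := F.op 0 (F.y ^ 2) (b • (F.y * F.z)) (d • F.y)
/-- `z² r + d z` -/
def opZ2 (d : ℝ) : Der A × A := F.op 0 0 (F.z ^ 2) (d • F.z)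

theorem opC_mem {W : Submodule ℝ (Der A × A)} (hW : constOps A ≤ W) (c : ℝ) : F.opC c ∈ W :=
  hW (mem_constOps.2 ⟨F.vf_zero, c, rfl⟩)

theorem lie_P_Q (i : ℕ) : opLie F.opP (F.opQ i) = (i : ℝ) • F.opQ (i - 1) := by
  simp only [opP, opQ, opLie_op, smul_op]
  congr 1 <;> simp

theorem lie_P_R (l m : ℕ) : opLie F.opP (F.opR l m) = (l : ℝ) • F.opR (l - 1) m := by
  simp only [opP, opR, opLie_op, smul_op]
  congr 1 <;> simp
  ring

theorem lie_P_XP : opLie F.opP F.opXP = F.opP := by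
  simp only [opP, opXP, opLie_op]
  congr 1 <;> simp

theorem lie_P_YQ : opLie F.opP F.opYQ = 0 := by
  simp only [opP, opYQ, opLie_op, F.zero_op]
  congr 1 <;> simp

theorem lie_P_ZR : opLie F.opP F.opZR = 0 := by
  simp only [opP, opZR, opLie_op, F.zero_op]
  congr 1 <;> simp

theorem lie_P_X2 (s k c : ℝ) : opLie F.opP (F.opX2 s k c) =
    (2 : ℝ) • F.opXP + s • F.opYQ + k • F.opZR + F.opC c := by
  simp only [opP, opX2, opXP, opYQ, opZR, opC, opLie_op, smul_op, add_op]
  congr 1 <;> simp [Algebra.smul_def, map_ofNat]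

theorem lie_P_Y2 (b d : ℝ) : opLie F.opP (F.opY2 b d) = 0 := by
  simp only [opP, opY2, opLie_op, F.zero_op]
  congr 1 <;> simp [Algebra.smul_def]

theorem lie_P_Z2 (d : ℝ) : opLie F.opP (F.opZ2 d) = 0 := by
  simp only [opP, opZ2, opLie_op, F.zero_op]
  congr 1 <;> simp [Algebra.smul_def]

theorem lie_Q_Q (i j : ℕ) : opLie (F.opQ i) (F.opQ j) = 0 := by
  simp only [opQ, opLie_op, F.zero_op]
  congr 1 <;> simp

theorem lie_Q_R (i l m : ℕ) : opLie (F.opQ i) (F.opR l m) = (m : ℝ) • F.opR (l + i) (m - 1) := by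
  simp only [opQ, opR, opLie_op, smul_op]
  congr 1 <;> simp
  ring

theorem lie_XP_Q (i : ℕ) : opLie F.opXP (F.opQ i) = (i : ℝ) • F.opQ i := by
  simp only [opXP, opQ, opLie_op, smul_op]
  congr 1 <;> simp [x_mul_pow_pred]

theorem lie_YQ_Q (i : ℕ) : opLie F.opYQ (F.opQ i) = (-1 : ℝ) • F.opQ i := by
  simp only [opYQ, opQ, opLie_op, smul_op]
  congr 1 <;> simp

theorem lie_ZR_Q (i : ℕ) : opLie F.opZR (F.opQ i) = (0 : ℝ) • F.opQ i := by
  simp only [opZR, opQ, opLie_op, smul_op]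
  congr 1 <;> simp

/-- The coefficient vanishes exactly at i = s, where the chain of the xⁱq must end. -/
theorem lie_X2_Q (s k c : ℝ) (i : ℕ) :
    opLie (F.opX2 s k c) (F.opQ i) = (i - s) • F.opQ (i + 1) := by
  simp only [opX2, opQ, opLie_op, smul_op]
  congr 1 <;> simp [Algebra.smul_def]
  linear_combination F.x * x_mul_pow_pred i F.x

theorem lie_Q_Y2 (b d : ℝ) : opLie (F.opQ 0) (F.opY2 b d) =
    (2 : ℝ) • F.opYQ + b • F.opZR + F.opC d := by
  simp only [opQ, opY2, opYQ, opZR, opC, opLie_op, smul_op, add_op]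
  congr 1 <;> simp [Algebra.smul_def, map_ofNat]

theorem lie_Q_Z2 (i : ℕ) (d : ℝ) : opLie (F.opQ i) (F.opZ2 d) = 0 := by
  simp only [opQ, opZ2, opLie_op, F.zero_op]
  congr 1 <;> simp [Algebra.smul_def]

theorem lie_R_R (l m l' m' : ℕ) : opLie (F.opR l m) (F.opR l' m') = 0 := by
  simp only [opR, opLie_op, F.zero_op]
  congr 1 <;> simp

theorem lie_XP_R (l m : ℕ) : opLie F.opXP (F.opR l m) = (l : ℝ) • F.opR l m := by
  simp only [opXP, opR, opLie_op, smul_op]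
  congr 1 <;> simp
  linear_combination F.y ^ m * x_mul_pow_pred l F.x

theorem lie_YQ_R (l m : ℕ) : opLie F.opYQ (F.opR l m) = (m : ℝ) • F.opR l m := by
  simp only [opYQ, opR, opLie_op, smul_op]
  congr 1 <;> simp
  linear_combination F.x ^ l * x_mul_pow_pred m F.y

theorem lie_ZR_R (l m : ℕ) : opLie F.opZR (F.opR l m) = (-1 : ℝ) • F.opR l m := by
  simp only [opZR, opR, opLie_op, smul_op]
  congr 1 <;> simp

/-- The vanishing of the coefficient for l + sm = k dictates the coefficient of xzr that matches a
given range of the exponents. -/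
theorem lie_X2_R (s k c : ℝ) (l m : ℕ) :
    opLie (F.opX2 s k c) (F.opR l m) = (l + s * m - k) • F.opR (l + 1) m := by
  simp only [opX2, opR, opLie_op, smul_op]
  congr 1 <;> simp [Algebra.smul_def]
  linear_combination F.x * F.y ^ m * x_mul_pow_pred l F.x +
    algebraMap ℝ A s * F.x ^ (l + 1) * x_mul_pow_pred m F.y

theorem lie_Y2_R (b d : ℝ) (l m : ℕ) :
    opLie (F.opY2 b d) (F.opR l m) = (m - b) • F.opR l (m + 1) := by
  simp only [opY2, opR, opLie_op, smul_op]
  congr 1 <;> simp [Algebra.smul_def]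
  linear_combination F.y * F.x ^ l * x_mul_pow_pred m F.y

theorem lie_R_Z2 (d : ℝ) : opLie (F.opR 0 0) (F.opZ2 d) = (2 : ℝ) • F.opZR + F.opC d := by
  simp only [opR, opZ2, opZR, opC, opLie_op, smul_op, add_op]
  congr 1 <;> simp [Algebra.smul_def, map_ofNat]

theorem lie_XP_YQ : opLie F.opXP F.opYQ = 0 := by
  simp only [opXP, opYQ, opLie_op, F.zero_op]
  congr 1 <;> simp

theorem lie_XP_ZR : opLie F.opXP F.opZR = 0 := by
  simp only [opXP, opZR, opLie_op, F.zero_op]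
  congr 1 <;> simp

theorem lie_YQ_ZR : opLie F.opYQ F.opZR = 0 := by
  simp only [opYQ, opZR, opLie_op, F.zero_op]
  congr 1 <;> simp

theorem lie_XP_X2 (s k c : ℝ) : opLie F.opXP (F.opX2 s k c) = (1 : ℝ) • F.opX2 s k c := by
  simp only [opXP, opX2, opLie_op, smul_op]
  congr 1 <;> simp [Algebra.smul_def] <;> ring

theorem lie_YQ_X2 (s k c : ℝ) : opLie F.opYQ (F.opX2 s k c) = (0 : ℝ) • F.opX2 s k c := by
  simp only [opYQ, opX2, opLie_op, smul_op]
  congr 1 <;> simp [Algebra.smul_def]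
  ring

theorem lie_ZR_X2 (s k c : ℝ) : opLie F.opZR (F.opX2 s k c) = (0 : ℝ) • F.opX2 s k c := by
  simp only [opZR, opX2, opLie_op, smul_op]
  congr 1 <;> simp [Algebra.smul_def]
  ring

theorem lie_XP_Y2 (b d : ℝ) : opLie F.opXP (F.opY2 b d) = (0 : ℝ) • F.opY2 b d := by
  simp only [opXP, opY2, opLie_op, smul_op]
  congr 1 <;> simp [Algebra.smul_def]

theorem lie_YQ_Y2 (b d : ℝ) : opLie F.opYQ (F.opY2 b d) = (1 : ℝ) • F.opY2 b d := by
  simp only [opYQ, opY2, opLie_op, smul_op]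
  congr 1 <;> simp [Algebra.smul_def] <;> ring

theorem lie_ZR_Y2 (b d : ℝ) : opLie F.opZR (F.opY2 b d) = (0 : ℝ) • F.opY2 b d := by
  simp only [opZR, opY2, opLie_op, smul_op]
  congr 1 <;> simp [Algebra.smul_def]
  ring

theorem lie_XP_Z2 (d : ℝ) : opLie F.opXP (F.opZ2 d) = (0 : ℝ) • F.opZ2 d := by
  simp only [opXP, opZ2, opLie_op, smul_op]
  congr 1 <;> simp [Algebra.smul_def]

theorem lie_YQ_Z2 (d : ℝ) : opLie F.opYQ (F.opZ2 d) = (0 : ℝ) • F.opZ2 d := by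
  simp only [opYQ, opZ2, opLie_op, smul_op]
  congr 1 <;> simp [Algebra.smul_def]

theorem lie_ZR_Z2 (d : ℝ) : opLie F.opZR (F.opZ2 d) = (1 : ℝ) • F.opZ2 d := by
  simp only [opZR, opZ2, opLie_op, smul_op]
  congr 1 <;> simp [Algebra.smul_def] <;> ring

theorem lie_X2_Y2 (k c b d : ℝ) : opLie (F.opX2 0 k c) (F.opY2 b d) = 0 := by
  simp only [opX2, opY2, opLie_op, F.zero_op]
  congr 1 <;> simp [Algebra.smul_def]
  ring

theorem lie_X2_Z2 (s c d : ℝ) : opLie (F.opX2 s 0 c) (F.opZ2 d) = 0 := by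
  simp only [opX2, opZ2, opLie_op, F.zero_op]
  congr 1 <;> simp [Algebra.smul_def]

theorem lie_Y2_Z2 (c d : ℝ) : opLie (F.opY2 0 c) (F.opZ2 d) = 0 := by
  simp only [opY2, opZ2, opLie_op, F.zero_op]
  congr 1 <;> simp [Algebra.smul_def]

end Frame

end DiffOp

namespace DiffOp

variable {A : Type} [CommRing A] [Algebra ℝ A]

/-! ## Taylor coefficients and linear independence -/

theorem linearIndependent_of_dual {ι V : Type*} [AddCommGroup V] [Module ℝ V] {v : ι → V}
    (φ : ι → V →ₗ[ℝ] ℝ) (h1 : ∀ i, φ i (v i) ≠ 0) (h2 : ∀ i j, i ≠ j → φ i (v j) = 0) :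
    LinearIndependent ℝ v := by
  rw [linearIndependent_iff']
  intro s g hg i hi
  have := congrArg (φ i) hg
  rw [map_sum, map_zero, Finset.sum_eq_single i] at this
  · rw [map_smul, smul_eq_mul] at this
    exact (mul_eq_zero.1 this).resolve_right (h1 i)
  · intro j _ hj
    rw [map_smul, h2 i j hj.symm, smul_zero]
  · exact fun h => absurd hi h

theorem pow_derivation_apply {D : Der A} {t g : A} (ht : D t = 1) (hg : D g = 0) (a l : ℕ) :
    ((D : A →ₗ[ℝ] A) ^ a) (t ^ l * g) = (l.descFactorial a : A) * (t ^ (l - a) * g) := by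
  induction a with
  | zero => simp
  | succ a ih =>
    rw [pow_succ', Module.End.mul_apply, ih, Derivation.coeFn_coe]
    simp only [Derivation.leibniz, Derivation.leibniz_pow, hg, ht, Derivation.map_natCast,
      smul_eq_mul, nsmul_eq_mul, Nat.descFactorial_succ, Nat.cast_mul, Nat.sub_sub]
    ring

namespace Frame

variable (F : Frame A)

/-- A multiple of the Taylor coefficient of `xᵃ yᵇ zᶜ` at the base point. -/
def coef (a b c : ℕ) : A →ₗ[ℝ] ℝ :=
  F.ev.toLinearMap ∘ₗ ((F.p : A →ₗ[ℝ] A) ^ a) ∘ₗ ((F.q : A →ₗ[ℝ] A) ^ b) ∘ₗ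
    ((F.r : A →ₗ[ℝ] A) ^ c)

theorem coef_monomial (a b c l m n : ℕ) : F.coef a b c (F.x ^ l * F.y ^ m * F.z ^ n) =
    l.descFactorial a * m.descFactorial b * n.descFactorial c *
      (F.ev F.x ^ (l - a) * F.ev F.y ^ (m - b) * F.ev F.z ^ (n - c)) := by
  have hr : ((F.r : A →ₗ[ℝ] A) ^ c) (F.x ^ l * F.y ^ m * F.z ^ n) =
      (n.descFactorial c : A) * (F.z ^ (n - c) * (F.x ^ l * F.y ^ m)) := by
    rw [mul_comm]
    exact pow_derivation_apply F.r_z (by simp) c n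
  have hq : ((F.q : A →ₗ[ℝ] A) ^ b)
      (n.descFactorial c * (F.z ^ (n - c) * (F.x ^ l * F.y ^ m))) =
      (m.descFactorial b : A) *
        (F.y ^ (m - b) * (n.descFactorial c * F.z ^ (n - c) * F.x ^ l)) := by
    rw [← pow_derivation_apply F.q_y (by simp) b m]
    congr 1
    ring
  have hp : ((F.p : A →ₗ[ℝ] A) ^ a)
      (m.descFactorial b * (F.y ^ (m - b) * (n.descFactorial c * F.z ^ (n - c) * F.x ^ l))) =
      (l.descFactorial a : A) * (F.x ^ (l - a) *
        (m.descFactorial b * F.y ^ (m - b) * n.descFactorial c * F.z ^ (n - c))) := by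
    rw [← pow_derivation_apply F.p_x (by simp) a l]
    congr 1
    ring
  rw [coef, LinearMap.comp_apply, LinearMap.comp_apply, LinearMap.comp_apply, hr, hq, hp]
  simp only [AlgHom.toLinearMap_apply, map_mul, map_natCast, map_pow]
  ring

/-- The Taylor coefficients of the components of a vector field. -/
def dual (k : Fin 3) (a b c : ℕ) : Der A →ₗ[ℝ] ℝ :=
  F.coef a b c ∘ₗ
    { toFun := fun D => D (![F.x, F.y, F.z] k)
      map_add' := fun _ _ => rfl
      map_smul' := fun _ _ => rfl }

theorem dual_zero (a b c : ℕ) (f g h : A) : F.dual 0 a b c (F.vf f g h) = F.coef a b c f := by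
  change F.coef a b c (F.vf f g h F.x) = _
  simp [vf_apply]

theorem dual_one (a b c : ℕ) (f g h : A) : F.dual 1 a b c (F.vf f g h) = F.coef a b c g := by
  change F.coef a b c (F.vf f g h F.y) = _
  simp [vf_apply]

theorem dual_two (a b c : ℕ) (f g h : A) : F.dual 2 a b c (F.vf f g h) = F.coef a b c h := by
  change F.coef a b c (F.vf f g h F.z) = _
  simp [vf_apply]

end Frame

namespace FullFrame

variable (F : FullFrame A)

theorem coef_monomial (a b c l m n : ℕ) : F.coef a b c (F.x ^ l * F.y ^ m * F.z ^ n) =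
    if l = a ∧ m = b ∧ n = c then (a.factorial * b.factorial * c.factorial : ℝ) else 0 := by
  -- For i < j the falling factorial is zero, for i > j the power of zero is.
  have key : ∀ i j : ℕ, (i.descFactorial j : ℝ) * 0 ^ (i - j) =
      if i = j then (j.factorial : ℝ) else 0 := by
    intro i j
    split_ifs with h
    · simp [h, Nat.descFactorial_self]
    · rcases lt_or_gt_of_ne h with h | h
      · simp [Nat.descFactorial_of_lt h]
      · simp [(Nat.sub_pos_of_lt h).ne']
  rw [Frame.coef_monomial]
  simp only [Frame.ev_x, Frame.ev_z, ev_y]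
  have : ∀ u v w u' v' w' : ℝ, u * v * w * (u' * v' * w') = (u * u') * (v * v') * (w * w') := by
    intros; ring
  rw [this, key, key, key]
  split_ifs <;> simp_all

theorem coef_one (a b c : ℕ) : F.coef a b c 1 =
    if 0 = a ∧ 0 = b ∧ 0 = c then (a.factorial * b.factorial * c.factorial : ℝ) else 0 := by
  simpa using F.coef_monomial a b c 0 0 0

theorem coef_x_pow (a b c l : ℕ) : F.coef a b c (F.x ^ l) =
    if l = a ∧ 0 = b ∧ 0 = c then (a.factorial * b.factorial * c.factorial : ℝ) else 0 := by
  simpa using F.coef_monomial a b c l 0 0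

theorem coef_x (a b c : ℕ) : F.coef a b c F.x =
    if 1 = a ∧ 0 = b ∧ 0 = c then (a.factorial * b.factorial * c.factorial : ℝ) else 0 := by
  simpa using F.coef_monomial a b c 1 0 0

theorem coef_y_pow (a b c m : ℕ) : F.coef a b c (F.y ^ m) =
    if 0 = a ∧ m = b ∧ 0 = c then (a.factorial * b.factorial * c.factorial : ℝ) else 0 := by
  simpa using F.coef_monomial a b c 0 m 0

theorem coef_y (a b c : ℕ) : F.coef a b c F.y =
    if 0 = a ∧ 1 = b ∧ 0 = c then (a.factorial * b.factorial * c.factorial : ℝ) else 0 := by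
  simpa using F.coef_monomial a b c 0 1 0

theorem coef_z_pow (a b c n : ℕ) : F.coef a b c (F.z ^ n) =
    if 0 = a ∧ 0 = b ∧ n = c then (a.factorial * b.factorial * c.factorial : ℝ) else 0 := by
  simpa using F.coef_monomial a b c 0 0 n

theorem coef_z (a b c : ℕ) : F.coef a b c F.z =
    if 0 = a ∧ 0 = b ∧ 1 = c then (a.factorial * b.factorial * c.factorial : ℝ) else 0 := by
  simpa using F.coef_monomial a b c 0 0 1

theorem coef_x_pow_mul_y_pow (a b c l m : ℕ) : F.coef a b c (F.x ^ l * F.y ^ m) =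
    if l = a ∧ m = b ∧ 0 = c then (a.factorial * b.factorial * c.factorial : ℝ) else 0 := by
  simpa using F.coef_monomial a b c l m 0

theorem coef_x_mul_y (a b c : ℕ) : F.coef a b c (F.x * F.y) =
    if 1 = a ∧ 1 = b ∧ 0 = c then (a.factorial * b.factorial * c.factorial : ℝ) else 0 := by
  simpa using F.coef_monomial a b c 1 1 0

theorem coef_x_mul_z (a b c : ℕ) : F.coef a b c (F.x * F.z) =
    if 1 = a ∧ 0 = b ∧ 1 = c then (a.factorial * b.factorial * c.factorial : ℝ) else 0 := by
  simpa using F.coef_monomial a b c 1 0 1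

theorem coef_y_mul_z (a b c : ℕ) : F.coef a b c (F.y * F.z) =
    if 0 = a ∧ 1 = b ∧ 1 = c then (a.factorial * b.factorial * c.factorial : ℝ) else 0 := by
  simpa using F.coef_monomial a b c 0 1 1

end FullFrame

/-! ## Algebras containing `p, q, r, xp, yq, zr` -/

/-- Labels of the polynomial vector fields `p`, `xⁱq`, `xˡyᵐr`, `xp`, `yq`, `zr`,
`x²p + sxyq + kxzr`, `y²q + byzr`, `z²r`. -/
inductive PolyLabel
  | P
  | Q (i : ℕ)
  | R (l m : ℕ)
  | XP
  | YQ
  | ZR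
  | X2
  | Y2
  | Z2

namespace Frame

variable (F : Frame A)

/-- The operators with the given labels and the given cocycle constants `e`. -/
def polyOp (s k b : ℝ) (e : ℝ × ℝ × ℝ) : PolyLabel → Der A × A
  | .P => F.opP
  | .Q i => F.opQ i
  | .R l m => F.opR l m
  | .XP => F.opXP
  | .YQ => F.opYQ
  | .ZR => F.opZR
  | .X2 => F.opX2 s k e.1
  | .Y2 => F.opY2 b e.2.1
  | .Z2 => F.opZ2 e.2.2

/-- The Taylor coefficient dual to the vector field with the given label. -/
def polyDual : PolyLabel → Der A →ₗ[ℝ] ℝ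
  | .P => F.dual 0 0 0 0
  | .Q i => F.dual 1 i 0 0
  | .R l m => F.dual 2 l m 0
  | .XP => F.dual 0 1 0 0
  | .YQ => F.dual 1 0 1 0
  | .ZR => F.dual 2 0 0 1
  | .X2 => F.dual 0 2 0 0
  | .Y2 => F.dual 1 0 2 0
  | .Z2 => F.dual 2 0 0 2

end Frame

/-- Each label owns a monomial in one component that occurs in no other labelled field: x² in the
p-component for `X2`, y² in the q-component for `Y2`, and so on. -/
theorem FullFrame.linearIndependent_polyOp (F : FullFrame A) (s k b : ℝ) (e : ℝ × ℝ × ℝ) :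
    LinearIndependent ℝ fun i => (F.polyOp s k b e i).1 := by
  refine linearIndependent_of_dual F.polyDual (fun i => ?_) fun i j hij => ?_
  · cases i <;>
      simp [Frame.polyOp, Frame.polyDual, Frame.op, Frame.opP, Frame.opQ, Frame.opR, Frame.opXP,
        Frame.opYQ, Frame.opZR, Frame.opX2, Frame.opY2, Frame.opZ2, Frame.dual_zero, Frame.dual_one,
        Frame.dual_two, coef_one, coef_x_pow, coef_x, coef_y, coef_z, coef_x_pow_mul_y_pow,
        coef_y_pow, coef_z_pow, Nat.factorial_ne_zero]
  · cases i <;> cases j <;>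
      simp [Frame.polyOp, Frame.polyDual, Frame.op, Frame.opP, Frame.opQ, Frame.opR, Frame.opXP,
        Frame.opYQ, Frame.opZR, Frame.opX2, Frame.opY2, Frame.opZ2, Frame.dual_zero, Frame.dual_one,
        Frame.dual_two, coef_one, coef_x_pow, coef_x, coef_y, coef_z, coef_x_pow_mul_y_pow,
        coef_y_pow, coef_z_pow, coef_x_mul_y, coef_x_mul_z, coef_y_mul_z] at hij ⊢ <;>
      grind

end DiffOp

namespace DiffOp

variable {A : Type} [CommRing A] [Algebra ℝ A]

/-! ## Cohomology of the algebras containing `p, q, r, xp, yq, zr` -/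

/-- The conditions under which the vector fields with labels in `S` span a Lie algebra that contains
`p, q, r, xp, yq, zr`. -/
structure PolyClosed (s k b : ℝ) (S : Set PolyLabel) : Prop where
  P : .P ∈ S
  XP : .XP ∈ S
  YQ : .YQ ∈ S
  ZR : .ZR ∈ S
  Q_zero : .Q 0 ∈ S
  R_zero : .R 0 0 ∈ S
  Q_le : ∀ i j, .Q i ∈ S → j ≤ i → .Q j ∈ S
  R_le : ∀ l m l' m', .R l m ∈ S → l' ≤ l → m' ≤ m → .R l' m' ∈ S
  Q_R : ∀ i l m, .Q i ∈ S → .R l (m + 1) ∈ S → .R (l + i) m ∈ S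
  X2_Q : .X2 ∈ S → ∀ i : ℕ, .Q i ∈ S → (i : ℝ) = s ∨ .Q (i + 1) ∈ S
  X2_R : .X2 ∈ S → ∀ l m : ℕ, .R l m ∈ S → l + s * m = k ∨ .R (l + 1) m ∈ S
  Y2_Q : .Y2 ∈ S → ∀ i, .Q i ∈ S → i = 0
  Y2_R : .Y2 ∈ S → ∀ l m : ℕ, .R l m ∈ S → (m : ℝ) = b ∨ .R l (m + 1) ∈ S
  X2_Y2 : .X2 ∈ S → .Y2 ∈ S → s = 0
  Z2_R : .Z2 ∈ S → ∀ l m, .R l m ∈ S → l = 0 ∧ m = 0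
  X2_Z2 : .X2 ∈ S → .Z2 ∈ S → k = 0
  Y2_Z2 : .Y2 ∈ S → .Z2 ∈ S → b = 0

theorem lie_mem_of_swap {W : Submodule ℝ (Der A × A)} {a b : Der A × A} (h : opLie b a ∈ W) :
    opLie a b ∈ W := by
  rw [opLie_swap]
  exact W.smul_mem _ h

/-- An order of the labels. -/
def PolyLabel.rank : PolyLabel → ℕ
  | .P => 0
  | .XP => 1
  | .YQ => 2
  | .ZR => 3
  | .X2 => 4
  | .Y2 => 5
  | .Q _ => 6
  | .R _ _ => 7
  | .Z2 => 8

theorem Frame.lie_polyOp_mem (F : Frame A) {s k b : ℝ} {e : ℝ × ℝ × ℝ} {S : Set PolyLabel}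
    (hS : PolyClosed s k b S) {W : Submodule ℝ (Der A × A)} (hC : constOps A ≤ W)
    (hW : ∀ i ∈ S, F.polyOp s k b e i ∈ W) {i j : PolyLabel} (hi : i ∈ S) (hj : j ∈ S) :
    opLie (F.polyOp s k b e i) (F.polyOp s k b e j) ∈ W := by
  -- Antisymmetry leaves one order of each pair.
  wlog hij : i.rank ≤ j.rank generalizing i j
  · exact lie_mem_of_swap (this hj hi (by omega))
  have hXP := hW _ hS.XP
  have hYQ := hW _ hS.YQ
  have hZR := hW _ hS.ZR
  have hi' := hW _ hi
  have hj' := hW _ hj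
  cases i <;> cases j <;> simp only [PolyLabel.rank] at hij <;> first
    | (exfalso; revert hij; decide)
    | skip
  all_goals simp only [polyOp] at *
  all_goals try simp only [opLie_self, lie_P_Q, lie_P_R, lie_P_XP, lie_P_YQ, lie_P_ZR, lie_P_X2,
    lie_P_Y2, lie_P_Z2, lie_Q_Q, lie_XP_Q, lie_YQ_Q, lie_ZR_Q, lie_Q_Z2, lie_R_R,
    lie_XP_R, lie_YQ_R, lie_ZR_R, lie_XP_YQ, lie_XP_ZR, lie_YQ_ZR, lie_XP_X2, lie_YQ_X2,
    lie_ZR_X2, lie_XP_Y2, lie_YQ_Y2, lie_ZR_Y2, lie_XP_Z2, lie_YQ_Z2, lie_ZR_Z2, zero_mem]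
  all_goals try first
    | assumption
    | exact W.smul_mem _ ‹_›
  · exact W.smul_mem _ (hW _ (hS.Q_le _ _ hj (Nat.sub_le _ _)))
  · exact W.smul_mem _ (hW _ (hS.R_le _ _ _ _ hj (Nat.sub_le _ _) le_rfl))
  · exact add_mem (add_mem (add_mem (W.smul_mem _ hXP) (W.smul_mem _ hYQ)) (W.smul_mem _ hZR))
      (F.opC_mem hC _)
  · rename_i i l m
    rw [lie_Q_R]
    rcases m with _ | m
    · simp
    · exact W.smul_mem _ (hW _ (hS.Q_R _ _ _ hi hj))
  · rename_i l m
    obtain ⟨rfl, rfl⟩ := hS.Z2_R hj _ _ hi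
    rw [lie_R_Z2]
    exact add_mem (W.smul_mem _ hZR) (F.opC_mem hC _)
  · rename_i i
    rw [lie_X2_Q]
    rcases hS.X2_Q hi _ hj with h | h
    · simp [h]
    · exact W.smul_mem _ (hW _ h)
  · rename_i l m
    rw [lie_X2_R]
    rcases hS.X2_R hi _ _ hj with h | h
    · simp [h]
    · exact W.smul_mem _ (hW _ h)
  · rw [hS.X2_Y2 hi hj, lie_X2_Y2]
    exact zero_mem _
  · rw [hS.X2_Z2 hi hj, lie_X2_Z2]
    exact zero_mem _
  · rename_i i
    obtain rfl := hS.Y2_Q hi _ hj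
    refine lie_mem_of_swap ?_
    rw [lie_Q_Y2]
    exact add_mem (add_mem (W.smul_mem _ hYQ) (W.smul_mem _ hZR)) (F.opC_mem hC _)
  · rename_i l m
    rw [lie_Y2_R]
    rcases hS.Y2_R hi _ _ hj with h | h
    · simp [h]
    · exact W.smul_mem _ (hW _ h)
  · rw [hS.Y2_Z2 hi hj, lie_Y2_Z2]
    exact zero_mem _

end DiffOp

/-! ### Normalizing p, q, r, xp, yq, zr and reading off weights -/

namespace DiffOp

variable {A : Type} [CommRing A] [Algebra ℝ A]

theorem IsOpAlg.rel_of_lie_mem {G : Submodule ℝ (Der A × A)} (hG : IsOpAlg G) {a b : Der A × A} {g : A}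
    (ha : a ∈ G) (ha0 : a.2 = 0) (hb0 : b.2 = 0) (hb : (b.1, g) ∈ G) (h : opLie a b ∈ G) :
    a.1 g ∈ scalars A := by
  obtain ⟨v, f⟩ := a
  obtain ⟨w, f'⟩ := b
  simp only at ha0 hb0
  subst ha0 hb0
  exact hG.rel_mem ha hb (by simpa [opLie] using h)

theorem IsOpAlg.rel_of_lie_eq_smul {G : Submodule ℝ (Der A × A)} (hG : IsOpAlg G) {a b : Der A × A}
    {g : A} {μ : ℝ} (ha : a ∈ G) (ha0 : a.2 = 0) (hb : (b.1, g) ∈ G) (h : opLie a b = μ • b) :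
    a.1 g - algebraMap ℝ A μ * g ∈ scalars A := by
  obtain ⟨v, f⟩ := a
  simp only at ha0
  subst ha0
  exact hG.rel_smul ha hb (congrArg Prod.fst h)

theorem IsOpAlg.exists_mem_shift {G : Submodule ℝ (Der A × A)} (l : A) {v : Der A}
    (h : ∃ f, (v, f) ∈ G) : ∃ f, (v, f) ∈ DiffOp.shift G l := by
  obtain ⟨f, hf⟩ := h
  exact ⟨f - v l, by rwa [mem_shift, sub_add_cancel]⟩

namespace FullFrame

variable {F : FullFrame A} {θ : ℝ}

/-- Under (e₁, e₂) the function x has weight (1, 0) and y has weight (0, 1). So c survives only if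
(μ₁, μ₂) = (1, 0) and d only if it is (0, 1), while k(w) is left with two Euler equations. -/
theorem exists_affine_of_weight {f : A} {a b μ₁ μ₂ : ℝ} (hp : F.p f ∈ scalars A)
    (hv : F.v₀ θ f ∈ scalars A) (h₁ : F.e₁ θ a f - algebraMap ℝ A μ₁ * f ∈ scalars A)
    (h₂ : F.e₂ θ b f - algebraMap ℝ A μ₂ * f ∈ scalars A) :
    ∃ (c d : ℝ) (k : A), F.Inv θ k ∧ f = algebraMap ℝ A c * F.x + algebraMap ℝ A d * F.y + k ∧
      (c * (1 - μ₁) = 0 ∧ c * μ₂ = 0) ∧ (d * μ₁ = 0 ∧ d * (1 - μ₂) = 0) ∧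
      algebraMap ℝ A a * (F.w θ * F.r k) - algebraMap ℝ A μ₁ * k ∈ scalars A ∧
      algebraMap ℝ A b * (F.w θ * F.r k) - algebraMap ℝ A μ₂ * k ∈ scalars A := by
  obtain ⟨c, d, k, hk, rfl⟩ := exists_affine hp (by rwa [← v₀_apply])
  rw [e₁_affine hk] at h₁
  rw [e₂_affine hk] at h₂
  obtain ⟨h1, h2, h3⟩ := mem_scalars_affine (F := F) (θ := θ) (c := c * (1 - μ₁)) (d := -(d * μ₁))
    (((Inv.w.mul hk.r).cmul a).sub (hk.cmul μ₁)) (by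
      convert h₁ using 1
      simp only [map_mul, map_sub, map_one, map_neg]
      ring)
  obtain ⟨h4, h5, h6⟩ := mem_scalars_affine (F := F) (θ := θ) (c := -(c * μ₂)) (d := d * (1 - μ₂))
    (((Inv.w.mul hk.r).cmul b).sub (hk.cmul μ₂)) (by
      convert h₂ using 1
      simp only [map_mul, map_sub, map_one, map_neg]
      ring)
  exact ⟨c, d, k, hk, rfl, ⟨h1, neg_eq_zero.1 h4⟩, ⟨neg_eq_zero.1 h2, h5⟩, h3, h6⟩

/-- Weight -1 under e₂ occurs neither for x nor for y, and a function of w of this weight would be a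
multiple of 1/w. -/
theorem mem_scalars_of_weight_neg_one {f : A} (hp : F.p f ∈ scalars A)
    (hv : F.v₀ θ f ∈ scalars A) (h₂ : F.e₂ θ 1 f - algebraMap ℝ A (-1) * f ∈ scalars A) :
    f ∈ scalars A := by
  obtain ⟨c, d, k, hk, rfl⟩ := exists_affine hp (by rwa [← v₀_apply])
  rw [e₂_affine hk] at h₂
  obtain ⟨h4, h5, h6⟩ := mem_scalars_affine (F := F) (θ := θ) (c := c) (d := 2 * d)
    ((Inv.w.mul hk.r).add hk) (by
      convert h₂ using 1
      simp only [map_mul, map_one, map_neg, map_ofNat]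
      ring)
  obtain rfl : d = 0 := by linarith
  subst h4
  simpa using hk.mem_scalars_of_euler_add h6

/-- The functions x, y, z have the unit vectors as weights under xp, yq, zr. Hence f is constant
unless (μ₁, μ₂, μ₃) is a unit vector, and then one coordinate is allowed. -/
theorem exists_linear_of_weight {f : A} {μ₁ μ₂ μ₃ : ℝ} (hp : F.p f ∈ scalars A)
    (hq : F.q f ∈ scalars A) (hr : F.r f ∈ scalars A)
    (h₁ : F.opXP.1 f - algebraMap ℝ A μ₁ * f ∈ scalars A)
    (h₂ : F.opYQ.1 f - algebraMap ℝ A μ₂ * f ∈ scalars A)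
    (h₃ : F.opZR.1 f - algebraMap ℝ A μ₃ * f ∈ scalars A) :
    ∃ c d e : ℝ, f - (c • F.x + d • F.y + e • F.z) ∈ scalars A ∧
      (c * (1 - μ₁) = 0 ∧ c * μ₂ = 0 ∧ c * μ₃ = 0) ∧
      (d * μ₁ = 0 ∧ d * (1 - μ₂) = 0 ∧ d * μ₃ = 0) ∧
      (e * μ₁ = 0 ∧ e * μ₂ = 0 ∧ e * (1 - μ₃) = 0) := by
  obtain ⟨c, hc⟩ := hp
  obtain ⟨d, hd⟩ := hq
  obtain ⟨e, he⟩ := hr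
  rw [Algebra.linearMap_apply] at hc hd he
  obtain ⟨g, hg⟩ := F.mem_scalars (f - (c • F.x + d • F.y + e • F.z))
    (by simp [← hc, Algebra.smul_def]) (by simp [← hd, Algebra.smul_def])
    (by simp [← he, Algebra.smul_def])
  rw [Algebra.linearMap_apply] at hg
  have key : ∀ {g h k : ℝ}, algebraMap ℝ A g * F.x + algebraMap ℝ A h * F.y + algebraMap ℝ A k * F.z
      ∈ scalars A → g = 0 ∧ h = 0 ∧ k = 0 := by
    intro g h k hm
    have h1 := map_eq_zero_of_mem_scalars F.p hm
    have h2 := map_eq_zero_of_mem_scalars F.q hm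
    have h3 := map_eq_zero_of_mem_scalars F.r hm
    simp at h1 h2 h3
    exact ⟨F.algebraMap_eq_zero.1 h1, F.algebraMap_eq_zero.1 h2, F.algebraMap_eq_zero.1 h3⟩
  have hf : f = algebraMap ℝ A c * F.x + algebraMap ℝ A d * F.y + algebraMap ℝ A e * F.z +
      algebraMap ℝ A g := by
    simp only [Algebra.smul_def] at hg
    linear_combination -hg
  have h1 := key (g := c * (1 - μ₁)) (h := -(d * μ₁)) (k := -(e * μ₁)) (by
    convert add_mem h₁ (algebraMap_mem_scalars (μ₁ * g)) using 1
    simp only [Frame.opXP, Frame.op, Frame.vf_apply, ← hc, map_mul, map_sub, map_one, map_neg]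
    linear_combination algebraMap ℝ A μ₁ * hf)
  have h2 := key (g := -(c * μ₂)) (h := d * (1 - μ₂)) (k := -(e * μ₂)) (by
    convert add_mem h₂ (algebraMap_mem_scalars (μ₂ * g)) using 1
    simp only [Frame.opYQ, Frame.op, Frame.vf_apply, ← hd, map_mul, map_sub, map_one, map_neg]
    linear_combination algebraMap ℝ A μ₂ * hf)
  have h3 := key (g := -(c * μ₃)) (h := -(d * μ₃)) (k := e * (1 - μ₃)) (by
    convert add_mem h₃ (algebraMap_mem_scalars (μ₃ * g)) using 1
    simp only [Frame.opZR, Frame.op, Frame.vf_apply, ← he, map_mul, map_sub, map_one, map_neg]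
    linear_combination algebraMap ℝ A μ₃ * hf)
  simp only [neg_eq_zero] at h1 h2 h3
  exact ⟨c, d, e, ⟨g, hg⟩, ⟨h1.1, h2.1, h3.1⟩, ⟨h1.2.1, h2.2.1, h3.2.1⟩, h1.2.2, h2.2.2, h3.2.2⟩

theorem v₀_zero : F.v₀ 0 = (F.opQ 0).1 := by
  simp [v₀, Frame.opQ, Frame.op]

theorem e₁_zero : F.e₁ 0 0 = F.opXP.1 := by
  simp [e₁, Frame.opXP, Frame.op]

theorem e₂_zero : F.e₂ 0 1 = F.opYQ.1 + F.opZR.1 := by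
  simp [e₂, Frame.opYQ, Frame.opZR, Frame.op, Frame.vf_add, w]

/-- The operators `p, q, r, xp, yq, zr` belong to `G`. -/
structure HasTorus (F : FullFrame A) (G : Submodule ℝ (Der A × A)) : Prop where
  P : F.opP ∈ G
  Q : F.opQ 0 ∈ G
  R : F.opR 0 0 ∈ G
  XP : F.opXP ∈ G
  YQ : F.opYQ ∈ G
  ZR : F.opZR ∈ G

/-- The general normalization handles p, q, xp and the sum yq + zr. Then r has weight -1 and zr
weight 0 under that sum, so their terms are constant as well, and yq is the difference. -/
theorem exists_hasTorus {G : Submodule ℝ (Der A × A)} (hG : IsOpAlg G)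
    (hP : ∃ f, (F.opP.1, f) ∈ G) (hQ : ∃ f, ((F.opQ 0).1, f) ∈ G)
    (hR : ∃ f, ((F.opR 0 0).1, f) ∈ G) (hXP : ∃ f, (F.opXP.1, f) ∈ G)
    (hYQ : ∃ f, (F.opYQ.1, f) ∈ G) (hZR : ∃ f, (F.opZR.1, f) ∈ G) :
    ∃ l, F.HasTorus (shift G l) := by
  obtain ⟨l, hP', hQ', hXP', hE⟩ := exists_shift (F := F) (θ := 0) hG (a := 0) (b := 1)
    (by norm_num) hP (by rwa [v₀_zero]) (by rwa [e₁_zero]) (by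
      obtain ⟨f, hf⟩ := hYQ
      obtain ⟨g, hg⟩ := hZR
      rw [e₂_zero]
      exact ⟨f + g, add_mem hf hg⟩)
  rw [v₀_zero] at hQ'
  rw [e₁_zero] at hXP'
  obtain ⟨g, hg⟩ := IsOpAlg.exists_mem_shift l hZR
  obtain ⟨h, hh⟩ := IsOpAlg.exists_mem_shift l hR
  have hG' := hG.shift l
  refine ⟨l, ?_⟩
  generalize shift G l = G' at *
  change F.opP ∈ G' at hP'
  change F.opQ 0 ∈ G' at hQ'
  change F.opXP ∈ G' at hXP'
  have hE' : F.opYQ + F.opZR ∈ G' := by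
    rw [e₂_zero] at hE
    convert hE using 1
    ext1
    · rfl
    · exact add_zero 0
  have hR' : F.opR 0 0 ∈ G' := by
    refine hG'.zero_of hh (mem_scalars_of_weight_neg_one (F := F) (θ := 0) ?_ ?_ ?_)
    · rw [← p_apply]
      exact hG'.rel_of_lie_mem hP' rfl rfl hh (by simp [Frame.lie_P_R])
    · rw [v₀_zero]
      exact hG'.rel_of_lie_mem hQ' rfl rfl hh (by simp [Frame.lie_Q_R])
    · rw [e₂_zero]
      exact hG'.rel_of_lie_eq_smul hE' (add_zero 0) hh (by
        rw [opLie_add_left, Frame.lie_YQ_R, Frame.lie_ZR_R]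
        simp)
  have hZR' : F.opZR ∈ G' := by
    have h0 : opLie (F.opYQ + F.opZR) F.opZR = (0 : ℝ) • F.opZR := by
      rw [opLie_add_left, Frame.lie_YQ_ZR, opLie_self]
      simp
    obtain ⟨c, d, k, hk, rfl, ⟨hc, -⟩, ⟨-, hd⟩, -, hk'⟩ := exists_affine_of_weight (F := F) (θ := 0)
      (f := g) (a := 0) (b := 1) (μ₁ := 0) (μ₂ := 0)
      (by
        rw [← p_apply]
        exact hG'.rel_of_lie_mem hP' rfl rfl hg (by simp [Frame.lie_P_ZR]))
      (by
        rw [v₀_zero]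
        exact hG'.rel_of_lie_mem hQ' rfl rfl hg (lie_mem_of_swap (by simp [Frame.lie_ZR_Q])))
      (by
        rw [e₁_zero]
        exact hG'.rel_of_lie_eq_smul hXP' rfl hg (by simp [Frame.lie_XP_ZR]))
      (by
        rw [e₂_zero]
        exact hG'.rel_of_lie_eq_smul hE' (add_zero 0) hg h0)
    obtain rfl : c = 0 := by linarith
    obtain rfl : d = 0 := by linarith
    refine hG'.zero_of hg ?_
    simpa using hk.mem_scalars_of_euler (by simpa using hk')
  refine ⟨hP', hQ', hR', hXP', ?_, hZR'⟩
  simpa using sub_mem hE' hZR'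

theorem HasTorus.exists_linear {G : Submodule ℝ (Der A × A)} (hG : IsOpAlg G) (hT : F.HasTorus G)
    {a : Der A × A} {f : A} (ha0 : a.2 = 0) (ha : (a.1, f) ∈ G) {μ₁ μ₂ μ₃ : ℝ}
    (hp : opLie F.opP a ∈ G) (hq : opLie (F.opQ 0) a ∈ G) (hr : opLie (F.opR 0 0) a ∈ G)
    (h₁ : opLie F.opXP a = μ₁ • a) (h₂ : opLie F.opYQ a = μ₂ • a) (h₃ : opLie F.opZR a = μ₃ • a) :
    ∃ c d e : ℝ, (a.1, c • F.x + d • F.y + e • F.z) ∈ G ∧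
      (c * (1 - μ₁) = 0 ∧ c * μ₂ = 0 ∧ c * μ₃ = 0) ∧
      (d * μ₁ = 0 ∧ d * (1 - μ₂) = 0 ∧ d * μ₃ = 0) ∧
      (e * μ₁ = 0 ∧ e * μ₂ = 0 ∧ e * (1 - μ₃) = 0) := by
  have hp' := hG.rel_of_lie_mem hT.P rfl ha0 ha hp
  have hq' := hG.rel_of_lie_mem hT.Q rfl ha0 ha hq
  have hr' := hG.rel_of_lie_mem hT.R rfl ha0 ha hr
  obtain ⟨c, d, e, hf, h⟩ := exists_linear_of_weight
    (by simpa [Frame.opP, Frame.op, Frame.vf_apply] using hp')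
    (by simpa [Frame.opQ, Frame.op, Frame.vf_apply] using hq')
    (by simpa [Frame.opR, Frame.op, Frame.vf_apply] using hr')
    (hG.rel_of_lie_eq_smul hT.XP rfl ha h₁)
    (hG.rel_of_lie_eq_smul hT.YQ rfl ha h₂)
    (hG.rel_of_lie_eq_smul hT.ZR rfl ha h₃)
  exact ⟨c, d, e, hG.congr ha hf, h⟩

end FullFrame

end DiffOp

namespace DiffOp

variable {A : Type} [CommRing A] [Algebra ℝ A]

namespace FullFrame

variable {F : FullFrame A}

/-- The weight of xⁱq under yq is -1, which no coordinate has; the induction supplies the lift of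
the bracket with p. -/
theorem HasTorus.opQ_mem {G : Submodule ℝ (Der A × A)} (hG : IsOpAlg G) (hT : F.HasTorus G)
    (i : ℕ) (h : ∀ j ≤ i, ∃ f, ((F.opQ j).1, f) ∈ G) : F.opQ i ∈ G := by
  induction i with
  | zero => exact hT.Q
  | succ i ih =>
    obtain ⟨f, hf⟩ := h (i + 1) le_rfl
    obtain ⟨c, d, e, hm, ⟨-, hc, -⟩, ⟨-, hd, -⟩, ⟨-, he, -⟩⟩ := hT.exists_linear hG rfl hf
      (by
        rw [Frame.lie_P_Q]
        exact G.smul_mem _ (ih fun j hj => h j (by omega)))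
      (by rw [Frame.lie_Q_Q]; exact zero_mem G)
      (lie_mem_of_swap (by rw [Frame.lie_Q_R]; simp))
      (F.lie_XP_Q _) (F.lie_YQ_Q _) (F.lie_ZR_Q _)
    obtain rfl : c = 0 := by linarith
    obtain rfl : d = 0 := by linarith
    obtain rfl : e = 0 := by linarith
    simp only [zero_smul, add_zero] at hm
    exact hm

/-- Here the weight under zr is -1; brackets with p and q lower the total degree l + m. -/
theorem HasTorus.opR_mem {G : Submodule ℝ (Der A × A)} (hG : IsOpAlg G) (hT : F.HasTorus G)
    (l m : ℕ) (h : ∀ l' ≤ l, ∀ m' ≤ m, ∃ f, ((F.opR l' m').1, f) ∈ G) : F.opR l m ∈ G := by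
  induction hn : l + m using Nat.strong_induction_on generalizing l m with
  | _ n ih =>
  have key : ∀ l' ≤ l, ∀ m' ≤ m, l' + m' < n → F.opR l' m' ∈ G := fun l' hl m' hm hlt =>
    ih _ hlt l' m' (fun l'' hl' m'' hm' => h l'' (hl'.trans hl) m'' (hm'.trans hm)) rfl
  obtain ⟨f, hf⟩ := h l le_rfl m le_rfl
  obtain ⟨c, d, e, hm, ⟨-, -, hc⟩, ⟨-, -, hd⟩, ⟨-, -, he⟩⟩ := hT.exists_linear hG rfl hf
    (by
      rw [Frame.lie_P_R]
      rcases l with _ | l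
      · simp
      · exact G.smul_mem _ (key _ (by simp) _ le_rfl (by simp; omega)))
    (by
      rw [Frame.lie_Q_R]
      rcases m with _ | m
      · simp
      · exact G.smul_mem _ (key _ le_rfl _ (by simp) (by simp; omega)))
    (by rw [Frame.lie_R_R]; exact zero_mem G)
    (F.lie_XP_R _ _) (F.lie_YQ_R _ _) (F.lie_ZR_R _ _)
  obtain rfl : c = 0 := by linarith
  obtain rfl : d = 0 := by linarith
  obtain rfl : e = 0 := by linarith
  simp only [zero_smul, add_zero] at hm
  exact hm

/-- This field has weight (1, 0, 0), so a multiple of x survives. The two alternatives ensure that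
its brackets with q and r are already normalized or zero. -/
theorem HasTorus.exists_opX2_mem {G : Submodule ℝ (Der A × A)} (hG : IsOpAlg G)
    (hT : F.HasTorus G) {s k : ℝ} (hQ : s = 0 ∨ F.opQ 1 ∈ G) (hR : k = 0 ∨ F.opR 1 0 ∈ G)
    (h : ∃ f, ((F.opX2 s k 0).1, f) ∈ G) : ∃ c, F.opX2 s k c ∈ G := by
  obtain ⟨f, hf⟩ := h
  obtain ⟨c, d, e, hm, -, ⟨hd, -, -⟩, ⟨he, -, -⟩⟩ := hT.exists_linear hG (zero_smul _ _) hf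
    (by
      rw [Frame.lie_P_X2]
      exact add_mem (add_mem (add_mem (G.smul_mem _ hT.XP) (G.smul_mem _ hT.YQ))
        (G.smul_mem _ hT.ZR)) (by simp [Frame.opC, ← F.zero_op]))
    (lie_mem_of_swap (by
      rw [Frame.lie_X2_Q]
      rcases hQ with rfl | hQ
      · simp
      · exact G.smul_mem _ hQ))
    (lie_mem_of_swap (by
      rw [Frame.lie_X2_R]
      rcases hR with rfl | hR
      · simp
      · exact G.smul_mem _ hR))
    (F.lie_XP_X2 _ _ _) (F.lie_YQ_X2 _ _ _) (F.lie_ZR_X2 _ _ _)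
  obtain rfl : d = 0 := by linarith
  obtain rfl : e = 0 := by linarith
  simp only [zero_smul, add_zero] at hm
  exact ⟨c, hm⟩

theorem HasTorus.exists_opY2_mem {G : Submodule ℝ (Der A × A)} (hG : IsOpAlg G)
    (hT : F.HasTorus G) {b : ℝ} (hR : b = 0 ∨ F.opR 0 1 ∈ G)
    (h : ∃ f, ((F.opY2 b 0).1, f) ∈ G) : ∃ c, F.opY2 b c ∈ G := by
  obtain ⟨f, hf⟩ := h
  obtain ⟨c, d, e, hm, ⟨-, hc, -⟩, -, ⟨-, he, -⟩⟩ := hT.exists_linear hG (zero_smul _ _) hf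
    (by rw [Frame.lie_P_Y2]; exact zero_mem G)
    (by
      rw [Frame.lie_Q_Y2]
      exact add_mem (add_mem (G.smul_mem _ hT.YQ) (G.smul_mem _ hT.ZR))
        (by simp [Frame.opC, ← F.zero_op]))
    (lie_mem_of_swap (by
      rw [Frame.lie_Y2_R]
      rcases hR with rfl | hR
      · simp
      · exact G.smul_mem _ hR))
    (F.lie_XP_Y2 _ _) (F.lie_YQ_Y2 _ _) (F.lie_ZR_Y2 _ _)
  obtain rfl : c = 0 := by linarith
  obtain rfl : e = 0 := by linarith
  simp only [zero_smul, add_zero, zero_add] at hm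
  exact ⟨d, hm⟩

theorem HasTorus.exists_opZ2_mem {G : Submodule ℝ (Der A × A)} (hG : IsOpAlg G)
    (hT : F.HasTorus G) (h : ∃ f, ((F.opZ2 0).1, f) ∈ G) : ∃ c, F.opZ2 c ∈ G := by
  obtain ⟨f, hf⟩ := h
  obtain ⟨c, d, e, hm, ⟨-, -, hc⟩, ⟨-, -, hd⟩, -⟩ := hT.exists_linear hG (zero_smul _ _) hf
    (by rw [Frame.lie_P_Z2]; exact zero_mem G)
    (by rw [Frame.lie_Q_Z2]; exact zero_mem G)
    (by
      rw [Frame.lie_R_Z2]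
      exact add_mem (G.smul_mem _ hT.ZR) (by simp [Frame.opC, ← F.zero_op]))
    (F.lie_XP_Z2 _) (F.lie_YQ_Z2 _) (F.lie_ZR_Z2 _)
  obtain rfl : c = 0 := by linarith
  obtain rfl : d = 0 := by linarith
  simp only [zero_smul, zero_add] at hm
  exact ⟨e, hm⟩

/-- Every Lie algebra of operators lifting the span of the given polynomial vector fields is
equivalent to one of the standard ones. -/
theorem exists_polyOp_mem_shift {s k b : ℝ} {S : Set PolyLabel} (hS : PolyClosed s k b S)
    {G : Submodule ℝ (Der A × A)} (hG : IsOpAlg G)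
    (h : ∀ i ∈ S, ∃ f, ((F.polyOp s k b 0 i).1, f) ∈ G) :
    ∃ e l, ∀ i ∈ S, F.polyOp s k b e i ∈ shift G l := by
  obtain ⟨l, hT⟩ := exists_hasTorus (F := F) hG (h _ hS.P) (h _ hS.Q_zero) (h _ hS.R_zero)
    (h _ hS.XP) (h _ hS.YQ) (h _ hS.ZR)
  replace h := fun i hi => IsOpAlg.exists_mem_shift l (h i hi)
  replace hG := hG.shift l
  suffices ∃ e, ∀ i ∈ S, F.polyOp s k b e i ∈ shift G l by
    obtain ⟨e, he⟩ := this
    exact ⟨e, l, he⟩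
  generalize shift G l = G' at *
  have hQ : ∀ i, .Q i ∈ S → F.opQ i ∈ G' := fun i hi =>
    hT.opQ_mem hG i fun j hj => h _ (hS.Q_le _ _ hi hj)
  have hR : ∀ l m, .R l m ∈ S → F.opR l m ∈ G' := fun l m hi =>
    hT.opR_mem hG l m fun l' hl m' hm => h _ (hS.R_le _ _ _ _ hi hl hm)
  have hX2 : .X2 ∈ S → ∃ c, F.opX2 s k c ∈ G' := fun hi => by
    refine hT.exists_opX2_mem hG ?_ ?_ (h _ hi)
    · exact (hS.X2_Q hi _ hS.Q_zero).imp (fun h => by simpa using h.symm) (hQ 1)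
    · exact (hS.X2_R hi _ _ hS.R_zero).imp (fun h => by simpa using h.symm) (hR 1 0)
  have hY2 : .Y2 ∈ S → ∃ c, F.opY2 b c ∈ G' := fun hi => by
    refine hT.exists_opY2_mem hG ?_ (h _ hi)
    exact (hS.Y2_R hi _ _ hS.R_zero).imp (fun h => by simpa using h.symm) (hR 0 1)
  have hZ2 : .Z2 ∈ S → ∃ c, F.opZ2 c ∈ G' := fun hi => hT.exists_opZ2_mem hG (h _ hi)
  -- If the generator is absent its constant is irrelevant and set to zero; likewise for the other
  -- two.
  obtain ⟨e₁, h₁⟩ : ∃ c, .X2 ∈ S → F.opX2 s k c ∈ G' := by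
    by_cases hi : .X2 ∈ S
    · obtain ⟨c, hc⟩ := hX2 hi
      exact ⟨c, fun _ => hc⟩
    · exact ⟨0, fun h => absurd h hi⟩
  obtain ⟨e₂, h₂⟩ : ∃ c, .Y2 ∈ S → F.opY2 b c ∈ G' := by
    by_cases hi : .Y2 ∈ S
    · obtain ⟨c, hc⟩ := hY2 hi
      exact ⟨c, fun _ => hc⟩
    · exact ⟨0, fun h => absurd h hi⟩
  obtain ⟨e₃, h₃⟩ : ∃ c, .Z2 ∈ S → F.opZ2 c ∈ G' := by
    by_cases hi : .Z2 ∈ S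
    · obtain ⟨c, hc⟩ := hZ2 hi
      exact ⟨c, fun _ => hc⟩
    · exact ⟨0, fun h => absurd h hi⟩
  refine ⟨(e₁, e₂, e₃), fun i hi => ?_⟩
  cases i with
  | P => exact hT.P
  | Q i => exact hQ i hi
  | R l m => exact hR l m hi
  | XP => exact hT.XP
  | YQ => exact hT.YQ
  | ZR => exact hT.ZR
  | X2 => exact h₁ hi
  | Y2 => exact h₂ hi
  | Z2 => exact h₃ hi

theorem polyOp_fst (s k b : ℝ) (e : ℝ × ℝ × ℝ) (i : PolyLabel) :
    (F.polyOp s k b e i).1 = (F.polyOp s k b 0 i).1 := by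
  cases i <;> rfl

theorem smul_mem_scalars {c : ℝ} {t : A} {D : Der A} (hD : D t = 1) (h : c • t ∈ scalars A) :
    algebraMap ℝ A c = 0 := by
  have := map_eq_zero_of_mem_scalars D h
  rwa [Derivation.map_smul, hD, Algebra.smul_def, mul_one] at this

/-- A function whose coboundary vanishes on p, q, r, xp, yq, zr has weight zero, hence is constant.
So the coboundary is zero on the remaining fields too, and multiples of x, y, z are constant only if
they are zero. -/
theorem eq_zero_of_polyOp_sub_mem {s k b : ℝ} {S : Set PolyLabel} (hS : PolyClosed s k b S)
    {e : ℝ × ℝ × ℝ} {f : A}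
    (h : ∀ i ∈ S, (F.polyOp s k b e i).2 - (F.polyOp s k b e i).1 f ∈ scalars A) :
    (.X2 ∈ S → e.1 = 0) ∧ (.Y2 ∈ S → e.2.1 = 0) ∧ (.Z2 ∈ S → e.2.2 = 0) := by
  have hf : ∀ {i : PolyLabel}, i ∈ S → (F.polyOp s k b e i).2 = 0 →
      (F.polyOp s k b e i).1 f ∈ scalars A := by
    intro i hi h0
    have := h i hi
    rw [h0, zero_sub] at this
    exact (Submodule.neg_mem_iff _).1 this
  obtain ⟨c₁, c₂, c₃, hl, ⟨h1, -, -⟩, ⟨-, h2, -⟩, ⟨-, -, h3⟩⟩ := exists_linear_of_weight (F := F) (f := f)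
    (μ₁ := 0) (μ₂ := 0) (μ₃ := 0)
    (by simpa [Frame.polyOp, Frame.opP, Frame.op, Frame.vf_apply] using hf hS.P rfl)
    (by simpa [Frame.polyOp, Frame.opQ, Frame.op, Frame.vf_apply] using hf hS.Q_zero rfl)
    (by simpa [Frame.polyOp, Frame.opR, Frame.op, Frame.vf_apply] using hf hS.R_zero rfl)
    (by simpa [Frame.polyOp] using hf hS.XP rfl) (by simpa [Frame.polyOp] using hf hS.YQ rfl) (by simpa [Frame.polyOp] using hf hS.ZR rfl)
  obtain rfl : c₁ = 0 := by linarith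
  obtain rfl : c₂ = 0 := by linarith
  obtain rfl : c₃ = 0 := by linarith
  have hD : ∀ D : Der A, D f = 0 := fun D =>
    map_eq_zero_of_mem_scalars D (by simpa using hl)
  refine ⟨fun hi => ?_, fun hi => ?_, fun hi => ?_⟩
  · have := h _ hi
    rw [hD, sub_zero] at this
    exact F.algebraMap_eq_zero.1 (smul_mem_scalars F.p_x this)
  · have := h _ hi
    rw [hD, sub_zero] at this
    exact F.algebraMap_eq_zero.1 (smul_mem_scalars F.q_y this)
  · have := h _ hi
    rw [hD, sub_zero] at this
    exact F.algebraMap_eq_zero.1 (smul_mem_scalars F.r_z this)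

theorem polyOp_add_snd (s k b : ℝ) (e e' : ℝ × ℝ × ℝ) (i : PolyLabel) :
    (F.polyOp s k b (e + e') i).2 = (F.polyOp s k b e i).2 + (F.polyOp s k b e' i).2 := by
  cases i <;> first | exact (add_zero 0).symm | exact add_smul _ _ _

theorem polyOp_smul_snd (s k b r : ℝ) (e : ℝ × ℝ × ℝ) (i : PolyLabel) :
    (F.polyOp s k b (r • e) i).2 = r • (F.polyOp s k b e i).2 := by
  cases i <;> first | exact (smul_zero r).symm | exact mul_smul _ _ _

/-- The hypotheses on `E` say that the parameters correspond bijectively to the constants on those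
of the three quadratic fields that are present. -/
theorem classifies_of_polyOp {ι : Type} {m : ℕ} {s k b : ℝ} {lab : ι → PolyLabel}
    (hlab : Function.Injective lab) (hS : PolyClosed s k b (Set.range lab))
    (E : (Fin m → ℝ) →ₗ[ℝ] ℝ × ℝ × ℝ)
    (hE : ∀ c, (.X2 ∈ Set.range lab → (E c).1 = 0) → (.Y2 ∈ Set.range lab → (E c).2.1 = 0) →
      (.Z2 ∈ Set.range lab → (E c).2.2 = 0) → c = 0)
    (hE' : ∀ e : ℝ × ℝ × ℝ, ∃ c, (.X2 ∈ Set.range lab → (E c).1 = e.1) ∧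
      (.Y2 ∈ Set.range lab → (E c).2.1 = e.2.1) ∧ (.Z2 ∈ Set.range lab → (E c).2.2 = e.2.2))
    {v : ι → Der A} {η : (Fin m → ℝ) → ι → A}
    (hv : ∀ c i, (v i, η c i) = F.polyOp s k b (E c) (lab i)) : Classifies v η where
  add c c' i := by
    have h : ∀ c i, η c i = (F.polyOp s k b (E c) (lab i)).2 := fun c i => congrArg Prod.snd (hv c i)
    rw [h, h, h, map_add, polyOp_add_snd]
  smul r c i := by
    have h : ∀ c i, η c i = (F.polyOp s k b (E c) (lab i)).2 := fun c i => congrArg Prod.snd (hv c i)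
    rw [h, h, map_smul, polyOp_smul_snd]
  linearIndependent := by
    convert (F.linearIndependent_polyOp s k b (E 0)).comp lab hlab using 1
    exact funext fun i => congrArg Prod.fst (hv 0 i)
  lie c i j := by
    rw [hv, hv]
    refine F.lie_polyOp_mem hS le_sup_right ?_ ⟨i, rfl⟩ ⟨j, rfl⟩
    rintro _ ⟨i, rfl⟩
    rw [← hv]
    exact opSpan_gen v (η c) i
  inj c f h := by
    obtain ⟨h1, h2, h3⟩ := eq_zero_of_polyOp_sub_mem (F := F) hS (e := E c) (f := f) (by
      rintro _ ⟨i, rfl⟩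
      rw [← hv]
      exact h i)
    exact hE c h1 h2 h3
  surj G hG h := by
    obtain ⟨e, l, he⟩ := exists_polyOp_mem_shift (F := F) hS hG (by
      rintro _ ⟨i, rfl⟩
      obtain ⟨f, hf⟩ := h i
      rw [show v i = _ from congrArg Prod.fst (hv 0 i), polyOp_fst] at hf
      exact ⟨f, hf⟩)
    obtain ⟨c, h1, h2, h3⟩ := hE' e
    refine ⟨c, l, fun i => ?_⟩
    rw [hv]
    have := he _ ⟨i, rfl⟩
    have hi : lab i ∈ Set.range lab := ⟨i, rfl⟩
    generalize lab i = j at *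
    cases j with
    | X2 => rw [Frame.polyOp, h1 hi]; exact this
    | Y2 => rw [Frame.polyOp, h2 hi]; exact this
    | Z2 => rw [Frame.polyOp, h3 hi]; exact this
    | _ => exact this

end FullFrame

end DiffOp

namespace DiffOp

variable {A : Type} [CommRing A] [Algebra ℝ A]

/-- The labels `P, XP, YQ, ZR`, the `Q i` with `i ≤ s`, the `R l m` with `T l m`, and `X2, Y2, Z2`
according to `X, Y, Z`. -/
def polySet (s : ℕ) (T : ℕ → ℕ → Prop) (X Y Z : Prop) : Set PolyLabel :=
  {i | match i with
    | .Q i => i ≤ s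
    | .R l m => T l m
    | .X2 => X
    | .Y2 => Y
    | .Z2 => Z
    | _ => True}

theorem polyClosed_polySet {s : ℕ} {T : ℕ → ℕ → Prop} {X Y Z : Prop} {k b : ℝ} (h0 : T 0 0)
    (h1 : ∀ l m l' m', T l m → l' ≤ l → m' ≤ m → T l' m')
    (h2 : ∀ i l m, i ≤ s → T l (m + 1) → T (l + i) m)
    (h3 : X → ∀ l m : ℕ, T l m → l + s * m = k ∨ T (l + 1) m)
    (h4 : Y → ∀ l m : ℕ, T l m → (m : ℝ) = b ∨ T l (m + 1))
    (h5 : Z → ∀ l m, T l m → l = 0 ∧ m = 0) (h6 : Y → s = 0) (h7 : X → Z → k = 0)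
    (h8 : Y → Z → b = 0) : PolyClosed s k b (polySet s T X Y Z) where
  P := trivial
  XP := trivial
  YQ := trivial
  ZR := trivial
  Q_zero := Nat.zero_le _
  R_zero := h0
  Q_le _ _ hi hj := le_trans hj hi
  R_le := h1
  Q_R := h2
  X2_Q _ i hi := by
    rcases Nat.eq_or_lt_of_le (show i ≤ s from hi) with h | h
    · exact Or.inl (by rw [h])
    · exact Or.inr h
  X2_R := h3
  Y2_Q hY i hi := by
    have : i ≤ s := hi
    have := h6 hY
    omega
  Y2_R := h4
  X2_Y2 _ hY := by simp [h6 hY]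
  Z2_R := h5
  X2_Z2 := h7
  Y2_Z2 := h8

namespace Frame

variable (F : Frame A)

theorem opQ_zero : F.opQ 0 = F.op 0 1 0 0 := by rw [opQ, pow_zero]

theorem opR_zero : F.opR 0 0 = F.op 0 0 1 0 := by rw [opR, pow_zero, pow_zero, one_mul]

theorem opX2_right_zero (s c : ℝ) :
    F.opX2 s 0 c = F.op (F.x ^ 2) (s • (F.x * F.y)) 0 (c • F.x) := by rw [opX2, zero_smul]

theorem opX2_left_zero (k c : ℝ) :
    F.opX2 0 k c = F.op (F.x ^ 2) 0 (k • (F.x * F.z)) (c • F.x) := by rw [opX2, zero_smul]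

theorem opX2_zero_zero (c : ℝ) : F.opX2 0 0 c = F.op (F.x ^ 2) 0 0 (c • F.x) := by
  rw [opX2, zero_smul, zero_smul]

theorem opY2_zero (d : ℝ) : F.opY2 0 d = F.op 0 (F.y ^ 2) 0 (d • F.y) := by
  rw [opY2, zero_smul]

end Frame

end DiffOp

/-! ### The algebras that contain p, q, r, xp, yq, zr -/

namespace TypeIII

open VF3 DiffOp

/-- The pairs `(l, m)` of exponents that occur in 4C and 5C. -/
def Staircase (s n l₀ l m : ℕ) : Prop := ∃ b, m + b = n ∧ l ≤ l₀ + s * b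

theorem staircase_iff {s n l₀ l m : ℕ} :
    Staircase s n l₀ l m ↔ ∃ bl : Pairs s n l₀, (bl.2 : ℕ) = l ∧ n - (bl.1 : ℕ) = m := by
  constructor
  · rintro ⟨b, hb, hl⟩
    exact ⟨⟨⟨b, by omega⟩, ⟨l, Nat.lt_succ_of_le hl⟩⟩, rfl, by simp only; omega⟩
  · rintro ⟨⟨b, l⟩, rfl, rfl⟩
    exact ⟨b, by have := b.2; simp only; omega, Nat.le_of_lt_succ l.2⟩

/-- Lowering the exponent of y raises b, which only relaxes the bound on the exponent of x. -/
theorem staircase_of_le {s n l₀ l m l' m' : ℕ} (h : Staircase s n l₀ l m) (hl : l' ≤ l)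
    (hm : m' ≤ m) : Staircase s n l₀ l' m' := by
  obtain ⟨b, hb, h⟩ := h
  exact ⟨b + (m - m'), by omega, by nlinarith⟩

theorem staircase_add {s n l₀ i l m : ℕ} (hi : i ≤ s) (h : Staircase s n l₀ l (m + 1)) :
    Staircase s n l₀ (l + i) m := by
  obtain ⟨b, hb, h⟩ := h
  exact ⟨b + 1, by omega, by nlinarith⟩

/-- At the end l = l₀ + sb of a row, l + sm = l₀ + sn does not depend on the row, so a single
coefficient of xzr closes all rows. -/
theorem staircase_succ {s n l₀ l m : ℕ} (h : Staircase s n l₀ l m) :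
    (l + s * m : ℝ) = l₀ + s * n ∨ Staircase s n l₀ (l + 1) m := by
  obtain ⟨b, hb, h⟩ := h
  rcases Nat.eq_or_lt_of_le h with h | h
  · left
    have : (m : ℝ) + b = n := by exact_mod_cast hb
    rw [← this, h]
    push_cast
    ring
  · exact Or.inr ⟨b, hb, h⟩

theorem pairs_ext {s n l₀ : ℕ} {a b : Pairs s n l₀} (h : (a.2 : ℕ) = b.2)
    (h' : n - (a.1 : ℕ) = n - b.1) : a = b := by
  obtain ⟨⟨a, ha⟩, ⟨l, hl⟩⟩ := a
  obtain ⟨⟨b, hb⟩, ⟨l', hl'⟩⟩ := b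
  simp only at h h'
  obtain rfl : a = b := by omega
  subst h
  rfl

/-- The labels of 4C. -/
def lab4C (s n l₀ : ℕ) : Fin (s + 1) ⊕ Pairs s n l₀ ⊕ Fin 4 → PolyLabel :=
  Sum.elim (fun i => .Q i) <| Sum.elim (fun bl => .R bl.2 (n - bl.1 : ℕ)) ![.P, .YQ, .XP, .ZR]

theorem lab4C_injective (s n l₀ : ℕ) : Function.Injective (lab4C s n l₀) := by
  rintro (i | bl | i) (j | bl' | j) h
  · simp [lab4C] at h; simp [Fin.ext h]
  · simp [lab4C] at h
  · fin_cases j <;> simp [lab4C] at h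
  · simp [lab4C] at h
  · simp [lab4C] at h; rw [pairs_ext h.1 h.2]
  · fin_cases j <;> simp [lab4C] at h
  · fin_cases i <;> simp [lab4C] at h
  · fin_cases i <;> simp [lab4C] at h
  · fin_cases i <;> fin_cases j <;> simp [lab4C] at h <;> rfl

theorem range_lab4C (s n l₀ : ℕ) :
    Set.range (lab4C s n l₀) = polySet s (Staircase s n l₀) False False False := by
  ext i
  cases i <;> simp [polySet, staircase_iff, Fin.exists_iff, lab4C]

theorem hasCohomology_4C (s n l₀ : ℕ) :
    HasCohomology (U := ⊤) (m := 0) (gen4C s n l₀) (fun _ _ => 0) := by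
  -- The values of `k` and `b` are immaterial: the fields in which they occur are absent.
  refine hasCohomology_of_classifies (fullFrame.classifies_of_polyOp (s := s) (k := 0) (b := 0)
    (lab4C_injective s n l₀) ?_ 0 ?_ ?_ ?_)
  · rw [range_lab4C]
    refine polyClosed_polySet ⟨n, by simp⟩ (fun l m l' m' => staircase_of_le)
      (fun i l m => staircase_add) ?_ ?_ ?_ ?_ ?_ ?_ <;> simp
  · intro c _ _ _
    exact Subsingleton.elim _ _
  · intro e
    simp [range_lab4C, polySet]
  · rintro c (i | bl | i)
    · rfl
    · rfl
    · fin_cases i <;> rfl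

/-- The labels of 4D. -/
def lab4D (s : ℕ) : Fin (s + 1) ⊕ Fin 6 → PolyLabel :=
  Sum.elim (fun i => .Q i) ![.P, .YQ, .XP, .R 0 0, .ZR, .Z2]

theorem lab4D_injective (s : ℕ) : Function.Injective (lab4D s) := by
  rintro (i | i) (j | j) h
  · simp [lab4D] at h; simp [Fin.ext h]
  · fin_cases j <;> simp [lab4D] at h
  · fin_cases i <;> simp [lab4D] at h
  · fin_cases i <;> fin_cases j <;> simp [lab4D] at h <;> rfl

theorem range_lab4D (s : ℕ) :
    Set.range (lab4D s) = polySet s (fun l m => 0 = l ∧ 0 = m) False False True := by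
  ext i
  cases i <;> simp [polySet, Fin.exists_iff, lab4D, eq_comm]

theorem hasCohomology_4D (s : ℕ) : HasCohomology (U := ⊤) (gen4D s) (coc4D s) := by
  refine hasCohomology_of_classifies (fullFrame.classifies_of_polyOp (s := s) (k := 0) (b := 0)
    (lab4D_injective s) ?_ (LinearMap.prod 0 (LinearMap.prod 0 (LinearMap.proj 0))) ?_ ?_ ?_)
  · rw [range_lab4D]
    refine polyClosed_polySet ?_ ?_ ?_ ?_ ?_ ?_ ?_ ?_ ?_ <;> simp
    grind
  · intro c
    simp [range_lab4D, polySet, funext_iff]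
  · intro e
    simp only [range_lab4D, polySet]
    exact ⟨fun _ => e.2.2, by simp⟩
  · rintro c (i | i)
    · rfl
    · fin_cases i
      exacts [rfl, rfl, rfl, (Frame.opR_zero fullFrame.toFrame).symm, rfl, rfl]

/-- The labels of 5C. -/
def lab5C (s n l₀ : ℕ) : Fin (s + 1) ⊕ Pairs s n l₀ ⊕ Fin 5 → PolyLabel :=
  Sum.elim (fun i => .Q i) <|
    Sum.elim (fun bl => .R bl.2 (n - bl.1 : ℕ)) ![.P, .YQ, .XP, .ZR, .X2]

theorem lab5C_injective (s n l₀ : ℕ) : Function.Injective (lab5C s n l₀) := by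
  rintro (i | bl | i) (j | bl' | j) h
  · simp [lab5C] at h; simp [Fin.ext h]
  · simp [lab5C] at h
  · fin_cases j <;> simp [lab5C] at h
  · simp [lab5C] at h
  · simp [lab5C] at h; rw [pairs_ext h.1 h.2]
  · fin_cases j <;> simp [lab5C] at h
  · fin_cases i <;> simp [lab5C] at h
  · fin_cases i <;> simp [lab5C] at h
  · fin_cases i <;> fin_cases j <;> simp [lab5C] at h <;> rfl

theorem range_lab5C (s n l₀ : ℕ) :
    Set.range (lab5C s n l₀) = polySet s (Staircase s n l₀) True False False := by
  ext i
  cases i <;> simp [polySet, staircase_iff, Fin.exists_iff, lab5C]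

theorem hasCohomology_5C (s n l₀ : ℕ) :
    HasCohomology (U := ⊤) (gen5C s n l₀) (coc5C s n l₀) := by
  refine hasCohomology_of_classifies (fullFrame.classifies_of_polyOp (s := s) (k := l₀ + s * n)
    (b := 0) (lab5C_injective s n l₀) ?_ (LinearMap.prod (LinearMap.proj 0) 0) ?_ ?_ ?_)
  · rw [range_lab5C]
    refine polyClosed_polySet ⟨n, by simp⟩ (fun l m l' m' => staircase_of_le)
      (fun i l m => staircase_add) (fun _ l m => staircase_succ) ?_ ?_ ?_ ?_ ?_ <;> simp
  · intro c
    simp [range_lab5C, polySet, funext_iff]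
  · intro e
    simp only [range_lab5C, polySet]
    exact ⟨fun _ => e.1, by simp⟩
  · rintro c (i | bl | i)
    · rfl
    · rfl
    · fin_cases i <;> rfl

/-- The labels of 5D. -/
def lab5D (s : ℕ) : Fin (s + 1) ⊕ Fin 7 → PolyLabel :=
  Sum.elim (fun i => .Q i) ![.P, .YQ, .XP, .X2, .R 0 0, .ZR, .Z2]

theorem lab5D_injective (s : ℕ) : Function.Injective (lab5D s) := by
  rintro (i | i) (j | j) h
  · simp [lab5D] at h; simp [Fin.ext h]
  · fin_cases j <;> simp [lab5D] at h
  · fin_cases i <;> simp [lab5D] at h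
  · fin_cases i <;> fin_cases j <;> simp [lab5D] at h <;> rfl

theorem range_lab5D (s : ℕ) :
    Set.range (lab5D s) = polySet s (fun l m => 0 = l ∧ 0 = m) True False True := by
  ext i
  cases i <;> simp [polySet, Fin.exists_iff, lab5D, eq_comm]

theorem hasCohomology_5D (s : ℕ) : HasCohomology (U := ⊤) (gen5D s) (coc5D s) := by
  refine hasCohomology_of_classifies (fullFrame.classifies_of_polyOp (s := s) (k := 0) (b := 0)
    (lab5D_injective s) ?_ (LinearMap.prod (LinearMap.proj 0)
      (LinearMap.prod 0 (LinearMap.proj 1))) ?_ ?_ ?_)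
  · rw [range_lab5D]
    refine polyClosed_polySet ?_ ?_ ?_ ?_ ?_ ?_ ?_ ?_ ?_ <;> simp
    grind
  · intro c
    simpa [range_lab5D, polySet, funext_iff, Fin.forall_fin_two] using And.intro
  · intro e
    simp only [range_lab5D, polySet]
    exact ⟨![e.1, e.2.2], by simp⟩
  · rintro c (i | i)
    · rfl
    · fin_cases i
      exacts [rfl, rfl, rfl, (Frame.opX2_right_zero fullFrame.toFrame s (c 0)).symm,
        (Frame.opR_zero fullFrame.toFrame).symm, rfl, rfl]

/-- The labels of 17C. -/
def lab17C (l₀ b₀ : ℕ) : (Fin (l₀ + 1) × Fin (b₀ + 1)) ⊕ Fin 7 → PolyLabel :=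
  Sum.elim (fun lb => .R lb.1 lb.2) ![.P, .Q 0, .XP, .YQ, .ZR, .X2, .Y2]

theorem lab17C_injective (l₀ b₀ : ℕ) : Function.Injective (lab17C l₀ b₀) := by
  rintro (i | i) (j | j) h
  · simp [lab17C] at h; simp [Prod.ext_iff, Fin.ext_iff, h]
  · fin_cases j <;> simp [lab17C] at h
  · fin_cases i <;> simp [lab17C] at h
  · fin_cases i <;> fin_cases j <;> simp [lab17C] at h <;> rfl

theorem range_lab17C (l₀ b₀ : ℕ) :
    Set.range (lab17C l₀ b₀) = polySet 0 (fun l m => l ≤ l₀ ∧ m ≤ b₀) True True False := by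
  ext i
  cases i <;> simp [polySet, Fin.exists_iff, lab17C]

theorem hasCohomology_17C (l₀ b₀ : ℕ) :
    HasCohomology (U := ⊤) (gen17C l₀ b₀) (coc17C l₀ b₀) := by
  refine hasCohomology_of_classifies (fullFrame.classifies_of_polyOp (s := 0) (k := l₀) (b := b₀)
    (lab17C_injective l₀ b₀) ?_ (LinearMap.prod (LinearMap.proj 0)
      (LinearMap.prod (LinearMap.proj 1) 0)) ?_ ?_ ?_)
  · rw [range_lab17C]
    have := polyClosed_polySet (s := 0) (T := fun l m => l ≤ l₀ ∧ m ≤ b₀) (X := True) (Y := True)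
      (Z := False) (k := l₀) (b := b₀) (by simp) (by omega) (by omega)
      (by simp; omega) (by simp; omega) (by simp) (by simp) (by simp) (by simp)
    simpa using this
  · intro c
    simpa [range_lab17C, polySet, funext_iff, Fin.forall_fin_two] using And.intro
  · intro e
    simp only [range_lab17C, polySet]
    exact ⟨![e.1, e.2.1], by simp⟩
  · rintro c (i | i)
    · rfl
    · fin_cases i
      exacts [rfl, (Frame.opQ_zero fullFrame.toFrame).symm, rfl, rfl, rfl,
        (Frame.opX2_left_zero fullFrame.toFrame l₀ (c 0)).symm, rfl]

/-- The labels of 17D. -/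
def lab17D : Fin 9 → PolyLabel := ![.P, .XP, .X2, .Q 0, .YQ, .Y2, .R 0 0, .ZR, .Z2]

theorem lab17D_injective : Function.Injective lab17D := by
  intro i j h
  fin_cases i <;> fin_cases j <;> simp [lab17D] at h <;> rfl

theorem range_lab17D :
    Set.range lab17D = polySet 0 (fun l m => 0 = l ∧ 0 = m) True True True := by
  ext i
  cases i <;> simp [polySet, lab17D, eq_comm]

theorem hasCohomology_17D : HasCohomology (U := ⊤) gen17D coc17D := by
  refine hasCohomology_of_classifies (fullFrame.classifies_of_polyOp (s := 0) (k := 0) (b := 0)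
    lab17D_injective ?_ (LinearMap.prod (LinearMap.proj 0)
      (LinearMap.prod (LinearMap.proj 1) (LinearMap.proj 2))) ?_ ?_ ?_)
  · rw [range_lab17D]
    have := polyClosed_polySet (s := 0) (T := fun l m => 0 = l ∧ 0 = m) (X := True) (Y := True)
      (Z := True) (k := 0) (b := 0) (by simp) (by omega) (by omega)
      (by simp) (by simp) (by omega) (by simp) (by simp) (by simp)
    simpa using this
  · intro c
    simp [range_lab17D, polySet, funext_iff, Fin.forall_fin_succ]
    exact fun h h' h'' => ⟨h, h', h''⟩
  · intro e
    simp only [range_lab17D, polySet]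
    exact ⟨![e.1, e.2.1, e.2.2], by simp⟩
  · intro c i
    fin_cases i
    exacts [rfl, rfl, (Frame.opX2_zero_zero fullFrame.toFrame (c 0)).symm,
      (Frame.opQ_zero fullFrame.toFrame).symm, rfl,
      (Frame.opY2_zero fullFrame.toFrame (c 1)).symm, (Frame.opR_zero fullFrame.toFrame).symm, rfl, rfl]

end TypeIII

/-! ### Brackets of the fields xⁱq + C(i,t)xⁱ⁻ᵗr, xp + azr, yq + bzr -/

namespace DiffOp

variable {A : Type} [CommRing A] [Algebra ℝ A]

theorem opLie_mem_of_lt {n : ℕ} {g : Fin n → Der A × A} {W : Submodule ℝ (Der A × A)}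
    (h : ∀ i j, i < j → opLie (g i) (g j) ∈ W) (i j : Fin n) : opLie (g i) (g j) ∈ W := by
  rcases lt_trichotomy i j with hij | rfl | hij
  · exact h i j hij
  · rw [opLie_self]
    exact zero_mem W
  · exact lie_mem_of_swap (h j i hij)

namespace Frame

variable (F : Frame A)

/-- `xⁱq + C(i,t) xⁱ⁻ᵗ r` -/
def opV (t i : ℕ) : Der A × A := F.op 0 (F.x ^ i) ((i.choose t : ℝ) • F.x ^ (i - t)) 0
/-- `x p + a z r` -/
def opE₁ (a : ℝ) : Der A × A := F.op F.x 0 (a • F.z) 0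
/-- `y q + b z r` -/
def opE₂ (b : ℝ) : Der A × A := F.op 0 F.y (b • F.z) 0

theorem opE₁_eq (a : ℝ) : F.opE₁ a = F.opXP + a • F.opZR := by
  simp [opE₁, opXP, opZR, smul_op, add_op, Algebra.smul_def]

theorem opE₂_eq (b : ℝ) : F.opE₂ b = F.opYQ + b • F.opZR := by
  simp [opE₂, opYQ, opZR, smul_op, add_op, Algebra.smul_def]

theorem opE₁_zero : F.opE₁ 0 = F.op F.x 0 0 0 := by rw [opE₁, zero_smul]

theorem opE₁_one : F.opE₁ 1 = F.op F.x 0 F.z 0 := by rw [opE₁, one_smul]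

theorem opE₂_zero : F.opE₂ 0 = F.op 0 F.y 0 0 := by rw [opE₂, zero_smul]

theorem opE₂_one : F.opE₂ 1 = F.op 0 F.y F.z 0 := by rw [opE₂, one_smul]

theorem opV_zero (i : ℕ) : F.opV 0 i = F.op 0 (F.x ^ i) (F.x ^ i) 0 := by
  rw [opV, Nat.choose_zero_right, Nat.cast_one, one_smul, Nat.sub_zero]

/-- The r-component is the t-th x-derivative of xⁱ divided by t!, and so it transforms under p in
the same way as xⁱ. -/
theorem lie_P_V (t i : ℕ) : opLie F.opP (F.opV t i) = (i : ℝ) • F.opV t (i - 1) := by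
  simp only [opP, opV, opLie_op, smul_op]
  rcases i with _ | i
  · congr 1 <;> simp [Algebra.smul_def]
  · congr 1 <;> simp [Algebra.smul_def]
    have h : ((i + 1).choose t : A) * ((i + 1 - t : ℕ) : A) = (i + 1) * i.choose t := by
      have := Nat.choose_mul_succ_eq i t
      have h' := congrArg (Nat.cast (R := A)) this
      push_cast at h'
      linear_combination -h'
    rw [show i + 1 - t - 1 = i - t by omega]
    linear_combination F.x ^ (i - t) * h

theorem lie_V_V (t i j : ℕ) : opLie (F.opV t i) (F.opV t j) = 0 := by
  simp only [opV, opLie_op, F.zero_op]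
  congr 1 <;> simp [Algebra.smul_def]

theorem choose_mul_sub {B : Type*} [CommRing B] (i t : ℕ) : (i.choose t : B) * ((i - t : ℕ) : B) = i.choose t * (i - t) := by
  rcases lt_or_ge i t with h | h
  · simp [Nat.choose_eq_zero_of_lt h]
  · rw [Nat.cast_sub h]

/-- The summand -tzr raises the eigenvalue i - t of xⁱ⁻ᵗr to the eigenvalue i of xⁱq. -/
theorem lie_E₁_V (t i : ℕ) : opLie (F.opE₁ (-(t : ℝ))) (F.opV t i) = (i : ℝ) • F.opV t i := by
  simp only [opE₁, opV, opLie_op, smul_op]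
  congr 1 <;> simp [Algebra.smul_def]
  · exact x_mul_pow_pred i F.x
  · linear_combination (i.choose t : A) * x_mul_pow_pred (i - t) F.x +
      F.x ^ (i - t) * choose_mul_sub (B := A) i t

theorem lie_E₂_V (t i : ℕ) : opLie (F.opE₂ 1) (F.opV t i) = (-1 : ℝ) • F.opV t i := by
  simp only [opE₂, opV, opLie_op, smul_op]
  congr 1 <;> simp [Algebra.smul_def]

theorem lie_X2_V (s k c : ℝ) (t i : ℕ) : opLie (F.opX2 s k c) (F.opV t i) =
    F.op 0 ((i - s) • F.x ^ (i + 1)) (((i.choose t : ℝ) * (i - t - k)) • F.x ^ (i - t + 1)) 0 := by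
  simp only [opX2, opV, opLie_op]
  congr 1 <;> simp [Algebra.smul_def]
  · linear_combination F.x * x_mul_pow_pred i F.x
  · linear_combination (i.choose t : A) * F.x * x_mul_pow_pred (i - t) F.x +
      F.x ^ (i - t + 1) * choose_mul_sub (B := A) i t

theorem lie_X2_V_zero (s c : ℝ) (i : ℕ) :
    opLie (F.opX2 s s c) (F.opV 0 i) = (i - s) • F.opV 0 (i + 1) := by
  rw [lie_X2_V]
  simp only [opV, smul_op]
  congr 1 <;> simp [Algebra.smul_def]

/-- At i = s the q-component cancels, but the r-component keeps the factor (s - t) - (s - 2t) = t.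
This is the obstruction to closure. -/
theorem lie_X2_V_top (s t : ℕ) (c : ℝ) : opLie (F.opX2 s (s - 2 * t) c) (F.opV t s) =
    ((s.choose t : ℝ) * t) • F.opR (s - t + 1) 0 := by
  rw [lie_X2_V]
  simp only [opR, smul_op]
  congr 1 <;> simp [Algebra.smul_def, map_ofNat]
  ring

theorem lie_P_E₁ (a : ℝ) : opLie F.opP (F.opE₁ a) = F.opP := by
  rw [opE₁_eq, opLie_add_right, opLie_smul_right, lie_P_XP, lie_P_ZR]
  simp

theorem lie_P_E₂ (b : ℝ) : opLie F.opP (F.opE₂ b) = 0 := by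
  rw [opE₂_eq, opLie_add_right, opLie_smul_right, lie_P_YQ, lie_P_ZR]
  simp

theorem lie_E₁_E₂ (a b : ℝ) : opLie (F.opE₁ a) (F.opE₂ b) = 0 := by
  rw [opE₁_eq, opE₂_eq]
  simp only [opLie_add_left, opLie_add_right, opLie_smul_left, opLie_smul_right, lie_XP_YQ,
    lie_XP_ZR, opLie_self]
  rw [opLie_swap, lie_YQ_ZR]
  simp

theorem lie_E₁_X2 (a s k c : ℝ) : opLie (F.opE₁ a) (F.opX2 s k c) = (1 : ℝ) • F.opX2 s k c := by
  rw [opE₁_eq, opLie_add_left, opLie_smul_left, lie_XP_X2, lie_ZR_X2]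
  simp

theorem lie_E₂_X2 (b s k c : ℝ) : opLie (F.opE₂ b) (F.opX2 s k c) = (0 : ℝ) • F.opX2 s k c := by
  rw [opE₂_eq, opLie_add_left, opLie_smul_left, lie_YQ_X2, lie_ZR_X2]
  simp

theorem lie_E₁_Y2 (a b c : ℝ) : opLie (F.opE₁ a) (F.opY2 b c) = (0 : ℝ) • F.opY2 b c := by
  rw [opE₁_eq, opLie_add_left, opLie_smul_left, lie_XP_Y2, lie_ZR_Y2]
  simp

theorem lie_E₂_Y2 (a b c : ℝ) : opLie (F.opE₂ a) (F.opY2 b c) = (1 : ℝ) • F.opY2 b c := by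
  rw [opE₂_eq, opLie_add_left, opLie_smul_left, lie_YQ_Y2, lie_ZR_Y2]
  simp

theorem lie_Q_E₁ (a : ℝ) : opLie (F.opQ 0) (F.opE₁ a) = 0 := by
  rw [opE₁_eq, opLie_add_right, opLie_smul_right, opLie_swap, lie_XP_Q, opLie_swap F.opZR, lie_ZR_Q]
  simp

theorem lie_Q_E₂ (a : ℝ) : opLie (F.opQ 0) (F.opE₂ a) = F.opQ 0 := by
  rw [opE₂_eq, opLie_add_right, opLie_smul_right, opLie_swap, lie_YQ_Q, opLie_swap F.opZR, lie_ZR_Q]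
  simp

theorem lie_P_X2_diag (s c : ℝ) : opLie F.opP (F.opX2 s s c) =
    (2 : ℝ) • F.opE₁ 0 + s • F.opE₂ 1 + F.opC c := by
  rw [lie_P_X2, opE₁_eq, opE₂_eq]
  simp [add_assoc]

theorem lie_P_X2_zero (a c : ℝ) : opLie F.opP (F.opX2 0 (2 * a) c) =
    (2 : ℝ) • F.opE₁ a + F.opC c := by
  rw [lie_P_X2, opE₁_eq, smul_add, smul_smul]
  simp

theorem lie_Q_Y2_eq (a d : ℝ) : opLie (F.opQ 0) (F.opY2 (2 * a) d) =
    (2 : ℝ) • F.opE₂ a + F.opC d := by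
  rw [lie_Q_Y2, opE₂_eq, smul_add, smul_smul]

/-- `x² p + (2x + az) z r + b x + c z` -/
def opX (a b c : ℝ) : Der A × A :=
  F.op (F.x ^ 2) 0 (((2 : ℝ) • F.x + a • F.z) * F.z) (b • F.x + c • F.z)

theorem lie_P_X (a b c : ℝ) : opLie F.opP (F.opX a b c) = (2 : ℝ) • F.opE₁ 1 + F.opC b := by
  simp only [opP, opX, opE₁, opC, opLie_op, smul_op, add_op]
  congr 1 <;> simp [Algebra.smul_def]
  simp only [map_ofNat]
  ring

theorem lie_Q_X (a b c : ℝ) : opLie (F.opQ 0) (F.opX a b c) = 0 := by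
  simp only [opQ, opX, opLie_op, F.zero_op]
  congr 1 <;> simp [Algebra.smul_def]

theorem lie_E₁_X (a b c : ℝ) : opLie (F.opE₁ 1) (F.opX a b c) = (1 : ℝ) • F.opX a b c := by
  simp only [opE₁, opX, opLie_op, smul_op]
  congr 1 <;> simp [Algebra.smul_def] <;> ring

theorem lie_E₂_X (a b c : ℝ) : opLie (F.opE₂ 0) (F.opX a b c) = (0 : ℝ) • F.opX a b c := by
  simp only [opE₂, opX, opLie_op, smul_op]
  congr 1 <;> simp [Algebra.smul_def]

theorem lie_X_Y2 (a b c d : ℝ) : opLie (F.opX a b c) (F.opY2 0 d) = 0 := by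
  simp only [opX, opY2, opLie_op, F.zero_op]
  congr 1 <;> simp [Algebra.smul_def]

end Frame

namespace FullFrame

variable {F : FullFrame A} {θ : ℝ}

/-- Because aw = az - aθy, the two fields agree as soon as a or θ vanishes. -/
theorem e₁_eq {a : ℝ} (h : a * θ = 0) : F.e₁ θ a = (F.opE₁ a).1 := by
  have h' : algebraMap ℝ A a * algebraMap ℝ A θ = 0 := by rw [← map_mul, h, map_zero]
  simp only [e₁, Frame.opE₁, Frame.op, w, Algebra.smul_def]
  congr 1
  linear_combination -F.y * h'

/-- As θy + w = z, the field yq + zr is adapted to every θ. -/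
theorem e₂_one_eq : F.e₂ θ 1 = (F.opE₂ 1).1 := by
  simp [e₂, Frame.opE₂, Frame.op, w]

theorem e₂_zero_eq {b : ℝ} : F.e₂ 0 b = (F.opE₂ b).1 := by
  simp [e₂, Frame.opE₂, Frame.op, w, Algebra.smul_def]

theorem v₀_eq (t : ℕ) : F.v₀ (Nat.choose 0 t) = (F.opV t 0).1 := by
  simp [v₀, Frame.opV, Frame.op, Algebra.smul_def]

/-- In weight (0, 0) there is no linear part, and both awk' and bwk' are constant; their combination
with coefficients a and b, divided by a² + b², is wk'. -/
theorem mem_scalars_of_invariant {f : A} {a b : ℝ} (hab : a ^ 2 + b ^ 2 ≠ 0)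
    (hp : F.p f ∈ scalars A) (hv : F.v₀ θ f ∈ scalars A) (h₁ : F.e₁ θ a f ∈ scalars A)
    (h₂ : F.e₂ θ b f ∈ scalars A) : f ∈ scalars A := by
  obtain ⟨c, d, k, hk, rfl, ⟨hc, -⟩, ⟨-, hd⟩, h1, h2⟩ := exists_affine_of_weight (F := F) (θ := θ)
    (μ₁ := 0) (μ₂ := 0) hp hv (by simpa using h₁) (by simpa using h₂)
  obtain rfl : c = 0 := by linarith
  obtain rfl : d = 0 := by linarith
  have h3 := add_mem ((scalars A).smul_mem ((a ^ 2 + b ^ 2)⁻¹ * a) h1)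
    ((scalars A).smul_mem ((a ^ 2 + b ^ 2)⁻¹ * b) h2)
  have hn : algebraMap ℝ A (a ^ 2 + b ^ 2)⁻¹ * (algebraMap ℝ A a ^ 2 + algebraMap ℝ A b ^ 2) = 1 := by
    rw [← map_pow, ← map_pow, ← map_add, ← map_mul, inv_mul_cancel₀ hab, map_one]
  have := hk.mem_scalars_of_euler (by
    convert h3 using 1
    simp only [Algebra.smul_def, map_mul, map_zero]
    linear_combination -F.w θ * F.r k * hn)
  simpa using this

end FullFrame

end DiffOp

namespace DiffOp

variable {A : Type} [CommRing A] [Algebra ℝ A]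

namespace FullFrame

variable {F : FullFrame A}

/-! ### The algebra spanned by `p`, `xp - tzr`, `yq + zr` and the `xⁱq + C(i,t) xⁱ⁻ᵗ r` -/

/-- These fields have weight -1 under yq + zr, so no nonconstant term is possible. -/
theorem opV_mem {G : Submodule ℝ (Der A × A)} (hG : IsOpAlg G) {t i : ℕ}
    (hP : F.opP ∈ G) (h₀ : F.opV t 0 ∈ G) (hE : F.opE₂ 1 ∈ G)
    (h : ∀ j ≤ i, ∃ f, ((F.opV t j).1, f) ∈ G) : F.opV t i ∈ G := by
  induction i with
  | zero => exact h₀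
  | succ i ih =>
    obtain ⟨f, hf⟩ := h (i + 1) le_rfl
    refine hG.zero_of hf (mem_scalars_of_weight_neg_one (F := F) (θ := Nat.choose 0 t) ?_ ?_ ?_)
    · rw [← p_apply]
      refine hG.rel_of_lie_mem hP rfl rfl hf ?_
      rw [Frame.lie_P_V]
      exact G.smul_mem _ (ih fun j hj => h j (by omega))
    · rw [v₀_eq]
      refine hG.rel_of_lie_mem h₀ rfl rfl hf ?_
      rw [Frame.lie_V_V]
      exact zero_mem G
    · rw [e₂_one_eq]
      exact hG.rel_of_lie_eq_smul hE rfl hf (F.lie_E₂_V _ _)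

theorem exists_shift_V {G : Submodule ℝ (Der A × A)} (hG : IsOpAlg G) {s t : ℕ}
    (hP : ∃ f, (F.opP.1, f) ∈ G) (hE₁ : ∃ f, ((F.opE₁ (-(t : ℝ))).1, f) ∈ G)
    (hE₂ : ∃ f, ((F.opE₂ 1).1, f) ∈ G) (hV : ∀ i ≤ s, ∃ f, ((F.opV t i).1, f) ∈ G) :
    ∃ l, F.opP ∈ shift G l ∧ F.opE₁ (-(t : ℝ)) ∈ shift G l ∧ F.opE₂ 1 ∈ shift G l ∧
      ∀ i ≤ s, F.opV t i ∈ shift G l := by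
  -- The field with i = 0 is q + r for t = 0 and q otherwise, so θ = C(0,t). One of t and θ is zero,
  -- which is what `e₁_eq` requires.
  have ht : -(t : ℝ) * (Nat.choose 0 t : ℝ) = 0 := by rcases t with _ | t <;> simp
  obtain ⟨l, h1, h2, h3, h4⟩ := exists_shift (F := F) (θ := Nat.choose 0 t) (a := -t) (b := 1) hG
    (by positivity) hP (by rw [v₀_eq]; exact hV 0 (Nat.zero_le _)) (by rwa [e₁_eq ht])
    (by rwa [e₂_one_eq])
  rw [v₀_eq] at h2
  rw [e₁_eq ht] at h3
  rw [e₂_one_eq] at h4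
  exact ⟨l, h1, h3, h4, fun i hi => opV_mem (hG.shift l) h1 h2 h4 fun j hj =>
    IsOpAlg.exists_mem_shift l (hV j (hj.trans hi))⟩

theorem lie_V_mem {W : Submodule ℝ (Der A × A)} {s t : ℕ} (hV : ∀ i ≤ s, F.opV t i ∈ W) {i : ℕ}
    (hi : i ≤ s) : opLie F.opP (F.opV t i) ∈ W ∧ opLie (F.opE₁ (-(t : ℝ))) (F.opV t i) ∈ W ∧
      opLie (F.opE₂ 1) (F.opV t i) ∈ W := by
  rw [Frame.lie_P_V, Frame.lie_E₁_V, Frame.lie_E₂_V]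
  exact ⟨W.smul_mem _ (hV _ (by omega)), W.smul_mem _ (hV _ hi), W.smul_mem _ (hV _ hi)⟩

variable (F) in
/-- The vector fields of 4A. -/
def gen4A (s t : ℕ) : Fin (s + 1) ⊕ Fin 3 → Der A :=
  Sum.elim (fun i => F.vf 0 (F.x ^ (i : ℕ)) (((i : ℕ).choose t : ℝ) • F.x ^ ((i : ℕ) - t)))
    ![F.vf 1 0 0, F.vf F.x 0 (-(t : ℝ) • F.z), F.vf 0 F.y F.z]

theorem gen4A_inr (s t : ℕ) (i : Fin 3) :
    (F.gen4A s t (Sum.inr i), (0 : A)) = ![F.opP, F.opE₁ (-(t : ℝ)), F.opE₂ 1] i := by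
  rw [Frame.opE₂_one]
  fin_cases i <;> rfl

theorem classifies_4A (s t : ℕ) : Classifies (m := 0) (F.gen4A s t) fun _ _ => 0 where
  add _ _ _ := (add_zero 0).symm
  smul r _ _ := (smul_zero r).symm
  linearIndependent := by
    refine linearIndependent_of_dual
      (Sum.elim (fun i => F.dual 1 i 0 0) ![F.dual 0 0 0 0, F.dual 0 1 0 0, F.dual 1 0 1 0])
      (fun i => ?_) fun i j hij => ?_
    · rcases i with i | i
      · simp [gen4A, Frame.dual_one, coef_x_pow, Nat.factorial_ne_zero]
      · fin_cases i <;>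
          simp [gen4A, Frame.dual_zero,
            Frame.dual_one, coef_one, coef_x, coef_y]
    · rcases i with i | i <;> rcases j with j | j
      · simp [gen4A, Frame.dual_one, coef_x_pow]
        intro h
        exact absurd (congrArg Sum.inl (Fin.ext h)).symm hij
      · fin_cases j <;>
          simp [gen4A, Frame.dual_one, coef_y]
      · fin_cases i <;>
          simp [gen4A, Frame.dual_zero, Frame.dual_one, coef_x_pow]
      · fin_cases i <;> fin_cases j <;>
          simp [gen4A, Frame.dual_zero,
            Frame.dual_one, coef_one, coef_x] at hij ⊢
  lie c i j := by
    set W := opSpan (F.gen4A s t) fun _ => 0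
    have hV : ∀ i ≤ s, F.opV t i ∈ W := fun i hi =>
      opSpan_gen (F.gen4A s t) (fun _ => 0) (Sum.inl ⟨i, Nat.lt_succ_of_le hi⟩)
    have hP : F.opP ∈ W := opSpan_gen (F.gen4A s t) (fun _ => 0) (Sum.inr 0)
    have key : ∀ i : Fin (s + 1), ∀ j : Fin 3, opLie (![F.opP, F.opE₁ (-(t : ℝ)), F.opE₂ 1] j)
        (F.opV t i) ∈ W := by
      intro i j
      obtain ⟨h1, h2, h3⟩ := lie_V_mem hV (Nat.le_of_lt_succ i.2)
      fin_cases j <;> assumption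
    rcases i with i | i <;> rcases j with j | j
    · exact (F.lie_V_V t i j).symm ▸ zero_mem W
    · rw [gen4A_inr]
      exact lie_mem_of_swap (key i j)
    · rw [gen4A_inr]
      exact key j i
    · rw [gen4A_inr, gen4A_inr]
      refine opLie_mem_of_lt (fun i j hij => ?_) i j
      fin_cases i <;> fin_cases j <;> first
        | exact absurd hij (by decide)
        | skip
      · exact (F.lie_P_E₁ _).symm ▸ hP
      · exact (F.lie_P_E₂ _).symm ▸ zero_mem W
      · exact (F.lie_E₁_E₂ _ _).symm ▸ zero_mem W
  inj c f h := Subsingleton.elim _ _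
  surj G hG h := by
    obtain ⟨l, h1, h2, h3, h4⟩ := exists_shift_V (F := F) (s := s) (t := t) hG (h (Sum.inr 0))
      (h (Sum.inr 1)) (by rw [Frame.opE₂_one]; exact h (Sum.inr 2))
      fun i hi => h (Sum.inl ⟨i, Nat.lt_succ_of_le hi⟩)
    refine ⟨0, l, ?_⟩
    rintro (i | i)
    · exact h4 i (Nat.le_of_lt_succ i.2)
    · rw [gen4A_inr]
      fin_cases i <;> assumption

end FullFrame

end DiffOp

namespace TypeIII

open VF3 DiffOp

theorem hasCohomology_4A (s t : ℕ) :
    HasCohomology (U := ⊤) (m := 0) (gen4A s t) (fun _ _ => 0) :=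
  hasCohomology_of_classifies (fullFrame.classifies_4A s t)

end TypeIII

namespace DiffOp

variable {A : Type} [CommRing A] [Algebra ℝ A]

theorem mem_scalars_of_zero_sub {f g : A} (h : g - f ∈ scalars A) (hg : g = 0) : f ∈ scalars A := by
  rw [hg, zero_sub] at h
  exact (Submodule.neg_mem_iff _).1 h

namespace FullFrame

variable {F : FullFrame A}

/-! ### The algebra 5A* -/

variable (F) in
/-- The vector fields of 5A*. -/
def gen5Astar (s : ℕ) : Fin (s + 1) ⊕ Fin 4 → Der A :=
  Sum.elim (fun i => F.vf 0 (F.x ^ (i : ℕ)) (F.x ^ (i : ℕ)))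
    ![F.vf 1 0 0, F.vf F.x 0 0, F.vf 0 F.y F.z,
      F.vf (F.x ^ 2) ((s : ℝ) • (F.x * F.y)) ((s : ℝ) • (F.x * F.z))]

variable (F) in
/-- The cocycles of 5A*. -/
def coc5Astar (s : ℕ) (c : Fin 1 → ℝ) : Fin (s + 1) ⊕ Fin 4 → A :=
  Sum.elim (fun _ => 0) ![0, 0, 0, c 0 • F.x]

theorem gen5Astar_inl (s : ℕ) (c : Fin 1 → ℝ) (i : Fin (s + 1)) :
    (F.gen5Astar s (Sum.inl i), F.coc5Astar s c (Sum.inl i)) = F.opV 0 i := by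
  rw [Frame.opV_zero]
  rfl

theorem gen5Astar_inr (s : ℕ) (c : Fin 1 → ℝ) (i : Fin 4) :
    (F.gen5Astar s (Sum.inr i), F.coc5Astar s c (Sum.inr i)) =
      ![F.opP, F.opE₁ 0, F.opE₂ 1, F.opX2 s s (c 0)] i := by
  rw [Frame.opE₂_one, Frame.opE₁_zero]
  fin_cases i <;> rfl

theorem linearIndependent_gen5Astar (s : ℕ) : LinearIndependent ℝ (F.gen5Astar s) := by
  refine linearIndependent_of_dual
    (Sum.elim (fun i => F.dual 1 i 0 0)
      ![F.dual 0 0 0 0, F.dual 0 1 0 0, F.dual 1 0 1 0, F.dual 0 2 0 0])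
    (fun i => ?_) fun i j hij => ?_
  · rcases i with i | i
    · simp [gen5Astar, Frame.dual_one, coef_x_pow, Nat.factorial_ne_zero]
    · fin_cases i <;>
        simp [gen5Astar, Frame.dual_zero, Frame.dual_one, coef_one, coef_x, coef_y, coef_x_pow]
  · rcases i with i | i <;> rcases j with j | j
    · simp [gen5Astar, Frame.dual_one, coef_x_pow]
      intro h
      exact absurd (congrArg Sum.inl (Fin.ext h)).symm hij
    · fin_cases j <;> simp [gen5Astar, Frame.dual_one, coef_y, coef_x_mul_y]
    · fin_cases i <;> simp [gen5Astar, Frame.dual_zero, Frame.dual_one, coef_x_pow]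
    · fin_cases i <;> fin_cases j <;>
        simp [gen5Astar, Frame.dual_zero, Frame.dual_one, coef_one, coef_x, coef_x_pow,
          coef_x_mul_y] at hij ⊢

theorem classifies_5Astar (s : ℕ) : Classifies (F.gen5Astar s) (F.coc5Astar s) where
  add c c' i := by
    rcases i with i | i
    · exact (add_zero 0).symm
    · fin_cases i
      exacts [(add_zero 0).symm, (add_zero 0).symm, (add_zero 0).symm, add_smul _ _ _]
  smul r c i := by
    rcases i with i | i
    · exact (smul_zero r).symm
    · fin_cases i
      exacts [(smul_zero r).symm, (smul_zero r).symm, (smul_zero r).symm, mul_smul _ _ _]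
  linearIndependent := linearIndependent_gen5Astar s
  lie c i j := by
    set W := opSpan (F.gen5Astar s) (F.coc5Astar s c)
    have hV : ∀ i ≤ s, F.opV 0 i ∈ W := fun i hi => by
      rw [← gen5Astar_inl s c ⟨i, Nat.lt_succ_of_le hi⟩]
      exact opSpan_gen _ _ _
    have hg : ∀ i, ![F.opP, F.opE₁ 0, F.opE₂ 1, F.opX2 s s (c 0)] i ∈ W := fun i => by
      rw [← gen5Astar_inr s c i]
      exact opSpan_gen _ _ _
    have hP : F.opP ∈ W := hg 0
    have hE₁ : F.opE₁ 0 ∈ W := hg 1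
    have hE₂ : F.opE₂ 1 ∈ W := hg 2
    have hX : F.opX2 s s (c 0) ∈ W := hg 3
    have key : ∀ i : Fin (s + 1), ∀ j : Fin 4,
        opLie (![F.opP, F.opE₁ 0, F.opE₂ 1, F.opX2 s s (c 0)] j) (F.opV 0 i) ∈ W := by
      intro i j
      obtain ⟨h1, h2, h3⟩ := lie_V_mem hV (Nat.le_of_lt_succ i.2)
      rw [Nat.cast_zero, neg_zero] at h2
      fin_cases j
      · exact h1
      · exact h2
      · exact h3
      · refine (F.lie_X2_V_zero _ _ _).symm ▸ ?_
        rcases Nat.eq_or_lt_of_le (Nat.le_of_lt_succ i.2) with h | h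
        · simp [h]
        · exact W.smul_mem _ (hV _ h)
    rcases i with i | i <;> rcases j with j | j
    · rw [gen5Astar_inl, gen5Astar_inl, Frame.lie_V_V]
      exact zero_mem W
    · rw [gen5Astar_inl, gen5Astar_inr]
      exact lie_mem_of_swap (key i j)
    · rw [gen5Astar_inl, gen5Astar_inr]
      exact key j i
    · rw [gen5Astar_inr, gen5Astar_inr]
      refine opLie_mem_of_lt (fun i j hij => ?_) i j
      fin_cases i <;> fin_cases j <;> first
        | exact absurd hij (by decide)
        | skip
      · exact (F.lie_P_E₁ _).symm ▸ hP
      · exact (F.lie_P_E₂ _).symm ▸ zero_mem W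
      · exact (F.lie_P_X2_diag _ _).symm ▸ add_mem (add_mem (W.smul_mem _ hE₁) (W.smul_mem _ hE₂))
          (F.opC_mem le_sup_right _)
      · exact (F.lie_E₁_E₂ _ _).symm ▸ zero_mem W
      · exact (F.lie_E₁_X2 _ _ _ _).symm ▸ W.smul_mem _ hX
      · exact (F.lie_E₂_X2 _ _ _ _).symm ▸ W.smul_mem _ hX
  inj c f h := by
    have hc : f ∈ scalars A := by
      refine mem_scalars_of_invariant (F := F) (θ := Nat.choose 0 0) (a := 0) (b := 1) (by norm_num)
        ?_ ?_ ?_ ?_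
      · rw [← p_apply]
        exact mem_scalars_of_zero_sub (h (Sum.inr 0)) rfl
      · rw [v₀_eq, Frame.opV_zero]
        exact mem_scalars_of_zero_sub (h (Sum.inl 0)) rfl
      · rw [e₁_eq (zero_mul _), Frame.opE₁_zero]
        exact mem_scalars_of_zero_sub (h (Sum.inr 1)) rfl
      · rw [e₂_one_eq, Frame.opE₂_one]
        exact mem_scalars_of_zero_sub (h (Sum.inr 2)) rfl
    have h3 := h (Sum.inr 3)
    rw [map_eq_zero_of_mem_scalars _ hc, sub_zero] at h3
    refine funext fun i => ?_
    rw [Subsingleton.elim i 0]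
    exact F.algebraMap_eq_zero.1 (smul_mem_scalars F.p_x h3)
  surj G hG h := by
    obtain ⟨l, h1, h2, h3, h4⟩ := exists_shift_V (F := F) (s := s) (t := 0) hG (h (Sum.inr 0))
      (by rw [Nat.cast_zero, neg_zero, Frame.opE₁_zero]; exact h (Sum.inr 1))
      (by rw [Frame.opE₂_one]; exact h (Sum.inr 2))
      (fun i hi => by rw [Frame.opV_zero]; exact h (Sum.inl ⟨i, Nat.lt_succ_of_le hi⟩))
    rw [Nat.cast_zero, neg_zero] at h2
    obtain ⟨f, hf⟩ := IsOpAlg.exists_mem_shift l (h (Sum.inr 3))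
    have hG' := hG.shift l
    change ((F.opX2 s s 0).1, f) ∈ _ at hf
    have h0 : F.opC 0 = 0 := by rw [Frame.opC, map_zero, ← F.zero_op]
    obtain ⟨c, d, k, hk, rfl, -, ⟨hd, -⟩, hk', -⟩ := exists_affine_of_weight (F := F)
      (θ := Nat.choose 0 0) (a := 0) (b := 1) (μ₁ := 1) (μ₂ := 0) (f := f)
      (by
        rw [← p_apply]
        refine hG'.rel_of_lie_mem h1 rfl (zero_smul _ _) hf ?_
        rw [Frame.lie_P_X2_diag, h0, add_zero]
        exact add_mem (Submodule.smul_mem _ _ h2) (Submodule.smul_mem _ _ h3))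
      (by
        rw [v₀_eq]
        refine hG'.rel_of_lie_mem (h4 0 (Nat.zero_le _)) rfl (zero_smul _ _) hf (lie_mem_of_swap ?_)
        rw [Frame.lie_X2_V_zero]
        rcases s with _ | s
        · simp
        · exact Submodule.smul_mem _ _ (h4 1 (by omega)))
      (by
        rw [e₁_eq (zero_mul _)]
        exact hG'.rel_of_lie_eq_smul h2 rfl hf (F.lie_E₁_X2 _ _ _ _))
      (by
        rw [e₂_one_eq]
        exact hG'.rel_of_lie_eq_smul h3 rfl hf (F.lie_E₂_X2 _ _ _ _))
    obtain rfl : d = 0 := by linarith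
    -- With a = 0 and μ₁ = 1 the first Euler equation reads: -k is constant.
    have hk0 : k ∈ scalars A := by simpa using hk'
    have hX : F.opX2 s s c ∈ shift G l := by
      refine hG'.congr hf ?_
      simpa [Algebra.smul_def] using hk0
    refine ⟨fun _ => c, l, ?_⟩
    rintro (i | i)
    · rw [gen5Astar_inl]
      exact h4 i (Nat.le_of_lt_succ i.2)
    · rw [gen5Astar_inr]
      fin_cases i <;> assumption

end FullFrame

end DiffOp

namespace TypeIII

open VF3 DiffOp

theorem hasCohomology_5Astar (s : ℕ) : HasCohomology (U := ⊤) (gen5Astar s) (coc5Astar s) :=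
  hasCohomology_of_classifies (fullFrame.classifies_5Astar s)

end TypeIII

namespace DiffOp

variable {A : Type} [CommRing A] [Algebra ℝ A]

namespace FullFrame

variable {F : FullFrame A}

/-! ### The algebras 17A -/

variable (F) in
/-- The vector fields of 17A₁. -/
def gen17A₁ (a : ℝ) : Fin 6 → Der A :=
  ![F.vf 1 0 0, F.vf 0 1 0, F.vf F.x 0 F.z, F.vf 0 F.y 0,
    F.vf (F.x ^ 2) 0 (((2 : ℝ) • F.x + a • F.z) * F.z), F.vf 0 (F.y ^ 2) 0]

variable (F) in
/-- The cocycles of 17A₁. -/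
def coc17A₁ (c : Fin 3 → ℝ) : Fin 6 → A := ![0, 0, 0, 0, c 0 • F.x + c 1 • F.z, c 2 • F.y]

theorem gen17A₁_eq (a : ℝ) (c : Fin 3 → ℝ) (i : Fin 6) : (F.gen17A₁ a i, F.coc17A₁ c i) =
    ![F.opP, F.opQ 0, F.opE₁ 1, F.opE₂ 0, F.opX a (c 0) (c 1), F.opY2 0 (c 2)] i := by
  rw [Frame.opQ_zero, Frame.opE₁_one, Frame.opE₂_zero, Frame.opY2_zero]
  fin_cases i <;> rfl

variable (F) in
/-- The vector fields of 17A₂. -/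
def gen17A₂ (a : ℝ) : Fin 6 → Der A :=
  ![F.vf 1 0 0, F.vf 0 1 0, F.vf F.x 0 (a • F.z), F.vf 0 F.y F.z,
    F.vf (F.x ^ 2) 0 ((2 * a) • (F.x * F.z)), F.vf 0 (F.y ^ 2) ((2 : ℝ) • (F.y * F.z))]

variable (F) in
/-- The cocycles of 17A₂. -/
def coc17A₂ (c : Fin 2 → ℝ) : Fin 6 → A := ![0, 0, 0, 0, c 0 • F.x, c 1 • F.y]

theorem gen17A₂_eq (a : ℝ) (c : Fin 2 → ℝ) (i : Fin 6) : (F.gen17A₂ a i, F.coc17A₂ c i) =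
    ![F.opP, F.opQ 0, F.opE₁ a, F.opE₂ 1, F.opX2 0 (2 * a) (c 0), F.opY2 (2 * 1) (c 1)] i := by
  rw [Frame.opQ_zero, Frame.opE₂_one, Frame.opX2_left_zero, mul_one]
  fin_cases i <;> rfl

variable (F) in
/-- The Taylor coefficients dual to the algebras 17A. -/
def dual17A : Fin 6 → Der A →ₗ[ℝ] ℝ :=
  ![F.dual 0 0 0 0, F.dual 1 0 0 0, F.dual 0 1 0 0, F.dual 1 0 1 0, F.dual 0 2 0 0, F.dual 1 0 2 0]

theorem linearIndependent_gen17A₁ (a : ℝ) : LinearIndependent ℝ (F.gen17A₁ a) := by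
  refine linearIndependent_of_dual F.dual17A (fun i => ?_) fun i j hij => ?_
  · fin_cases i <;> simp [gen17A₁, dual17A, Frame.dual_zero, Frame.dual_one, coef_one, coef_x,
      coef_y, coef_x_pow, coef_y_pow]
  · fin_cases i <;> fin_cases j <;> simp [gen17A₁, dual17A, Frame.dual_zero, Frame.dual_one,
      coef_one, coef_x, coef_y, coef_x_pow, coef_y_pow] at hij ⊢

theorem linearIndependent_gen17A₂ (a : ℝ) : LinearIndependent ℝ (F.gen17A₂ a) := by
  refine linearIndependent_of_dual F.dual17A (fun i => ?_) fun i j hij => ?_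
  · fin_cases i <;> simp [gen17A₂, dual17A, Frame.dual_zero, Frame.dual_one, coef_one, coef_x,
      coef_y, coef_x_pow, coef_y_pow]
  · fin_cases i <;> fin_cases j <;> simp [gen17A₂, dual17A, Frame.dual_zero, Frame.dual_one,
      coef_one, coef_x, coef_y, coef_x_pow, coef_y_pow] at hij ⊢

/-- The brackets of six operators, the first four of which satisfy the relations of
`p, q, xp + azr, yq + bzr`. -/
theorem lie_mem_17A {W : Submodule ℝ (Der A × A)} (hC : constOps A ≤ W) {a b c d : ℝ}
    {X Y : Der A × A}
    (h : ∀ i, ![F.opP, F.opQ 0, F.opE₁ a, F.opE₂ b, X, Y] i ∈ W)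
    (hPX : opLie F.opP X = (2 : ℝ) • F.opE₁ a + F.opC c) (hQX : opLie (F.opQ 0) X = 0)
    (hEX : opLie (F.opE₁ a) X = (1 : ℝ) • X) (hE'X : opLie (F.opE₂ b) X = (0 : ℝ) • X)
    (hPY : opLie F.opP Y = 0) (hQY : opLie (F.opQ 0) Y = (2 : ℝ) • F.opE₂ b + F.opC d)
    (hEY : opLie (F.opE₁ a) Y = (0 : ℝ) • Y) (hE'Y : opLie (F.opE₂ b) Y = (1 : ℝ) • Y)
    (hXY : opLie X Y = 0) (i j : Fin 6) :
    opLie (![F.opP, F.opQ 0, F.opE₁ a, F.opE₂ b, X, Y] i)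
      (![F.opP, F.opQ 0, F.opE₁ a, F.opE₂ b, X, Y] j) ∈ W := by
  have hP : F.opP ∈ W := h 0
  have hQ : F.opQ 0 ∈ W := h 1
  have hE : F.opE₁ a ∈ W := h 2
  have hE' : F.opE₂ b ∈ W := h 3
  have hX : X ∈ W := h 4
  have hY : Y ∈ W := h 5
  refine opLie_mem_of_lt (fun i j hij => ?_) i j
  fin_cases i <;> fin_cases j <;> first
    | exact absurd hij (by decide)
    | skip
  · exact (F.lie_P_Q 0).symm ▸ W.smul_mem _ hQ
  · exact (F.lie_P_E₁ _).symm ▸ hP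
  · exact (F.lie_P_E₂ _).symm ▸ zero_mem W
  · exact hPX.symm ▸ add_mem (W.smul_mem _ hE) (F.opC_mem hC _)
  · exact hPY.symm ▸ zero_mem W
  · exact (F.lie_Q_E₁ _).symm ▸ zero_mem W
  · exact (F.lie_Q_E₂ _).symm ▸ hQ
  · exact hQX.symm ▸ zero_mem W
  · exact hQY.symm ▸ add_mem (W.smul_mem _ hE') (F.opC_mem hC _)
  · exact (F.lie_E₁_E₂ _ _).symm ▸ zero_mem W
  · exact hEX.symm ▸ W.smul_mem _ hX
  · exact hEY.symm ▸ W.smul_mem _ hY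
  · exact hE'X.symm ▸ W.smul_mem _ hX
  · exact hE'Y.symm ▸ W.smul_mem _ hY
  · exact hXY.symm ▸ zero_mem W

theorem mem_scalars_of_17A {f : A} {a b : ℝ} (hab : a ^ 2 + b ^ 2 ≠ 0)
    (hP : F.opP.1 f ∈ scalars A) (hQ : (F.opQ 0).1 f ∈ scalars A) (h₁ : (F.opE₁ a).1 f ∈ scalars A)
    (h₂ : (F.opE₂ b).1 f ∈ scalars A) : f ∈ scalars A :=
  mem_scalars_of_invariant (F := F) (θ := 0) hab (by rwa [← p_apply]) (by rwa [v₀_zero])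
    (by rwa [e₁_eq (mul_zero _)]) (by rwa [e₂_zero_eq])

theorem exists_shift_17A {G : Submodule ℝ (Der A × A)} (hG : IsOpAlg G) {a b : ℝ}
    (hab : a ^ 2 + b ^ 2 ≠ 0) (hP : ∃ f, (F.opP.1, f) ∈ G) (hQ : ∃ f, ((F.opQ 0).1, f) ∈ G)
    (h₁ : ∃ f, ((F.opE₁ a).1, f) ∈ G) (h₂ : ∃ f, ((F.opE₂ b).1, f) ∈ G) :
    ∃ l, F.opP ∈ shift G l ∧ F.opQ 0 ∈ shift G l ∧ F.opE₁ a ∈ shift G l ∧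
      F.opE₂ b ∈ shift G l := by
  have := exists_shift (F := F) (θ := 0) hG hab hP (by rwa [v₀_zero])
    (by rwa [e₁_eq (mul_zero _)]) (by rwa [e₂_zero_eq])
  rw [v₀_zero, e₁_eq (mul_zero _), e₂_zero_eq] at this
  exact this

theorem exists_affine_17A {G : Submodule ℝ (Der A × A)} (hG : IsOpAlg G) {a b μ₁ μ₂ : ℝ}
    (hP : F.opP ∈ G) (hQ : F.opQ 0 ∈ G) (h₁ : F.opE₁ a ∈ G) (h₂ : F.opE₂ b ∈ G)
    {X : Der A × A} {f : A} (hX0 : X.2 = 0) (hX : (X.1, f) ∈ G) (hPX : opLie F.opP X ∈ G)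
    (hQX : opLie (F.opQ 0) X ∈ G) (hEX : opLie (F.opE₁ a) X = μ₁ • X)
    (hE'X : opLie (F.opE₂ b) X = μ₂ • X) :
    ∃ (c d : ℝ) (k : A), F.Inv 0 k ∧ f = algebraMap ℝ A c * F.x + algebraMap ℝ A d * F.y + k ∧
      (c * (1 - μ₁) = 0 ∧ c * μ₂ = 0) ∧ (d * μ₁ = 0 ∧ d * (1 - μ₂) = 0) ∧
      algebraMap ℝ A a * (F.w 0 * F.r k) - algebraMap ℝ A μ₁ * k ∈ scalars A ∧
      algebraMap ℝ A b * (F.w 0 * F.r k) - algebraMap ℝ A μ₂ * k ∈ scalars A :=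
  exists_affine_of_weight (F := F) (θ := 0)
    (by
      rw [← p_apply]
      exact hG.rel_of_lie_mem hP rfl hX0 hX hPX)
    (by
      rw [v₀_zero]
      exact hG.rel_of_lie_mem hQ rfl hX0 hX hQX)
    (by
      rw [e₁_eq (mul_zero _)]
      exact hG.rel_of_lie_eq_smul h₁ rfl hX hEX)
    (by
      rw [e₂_zero_eq]
      exact hG.rel_of_lie_eq_smul h₂ rfl hX hE'X)

theorem opC_zero : F.opC 0 = 0 := by rw [Frame.opC, map_zero, ← F.zero_op]

theorem classifies_17A₁ (a : ℝ) : Classifies (F.gen17A₁ a) F.coc17A₁ where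
  add c c' i := by
    fin_cases i
    exacts [(add_zero 0).symm, (add_zero 0).symm, (add_zero 0).symm, (add_zero 0).symm,
      (congrArg₂ _ (add_smul _ _ _) (add_smul _ _ _)).trans (add_add_add_comm _ _ _ _),
      add_smul _ _ _]
  smul r c i := by
    fin_cases i
    exacts [(smul_zero r).symm, (smul_zero r).symm, (smul_zero r).symm, (smul_zero r).symm,
      (congrArg₂ _ (mul_smul _ _ _) (mul_smul _ _ _)).trans (smul_add _ _ _).symm, mul_smul _ _ _]
  linearIndependent := linearIndependent_gen17A₁ a
  lie c i j := by
    rw [gen17A₁_eq, gen17A₁_eq]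
    refine lie_mem_17A (d := c 2) le_sup_right (fun i => ?_) (F.lie_P_X _ _ _) (F.lie_Q_X _ _ _)
      (F.lie_E₁_X _ _ _) (F.lie_E₂_X _ _ _) (F.lie_P_Y2 _ _) ?_ (F.lie_E₁_Y2 _ _ _)
      (F.lie_E₂_Y2 _ _ _) (F.lie_X_Y2 _ _ _ _) i j
    · rw [← gen17A₁_eq]
      exact opSpan_gen _ _ _
    · have := F.lie_Q_Y2_eq 0 (c 2)
      rwa [mul_zero] at this
  inj c f h := by
    have hc : f ∈ scalars A := by
      refine mem_scalars_of_17A (F := F) (a := 1) (b := 0) (by norm_num) ?_ ?_ ?_ ?_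
      · exact mem_scalars_of_zero_sub (h 0) rfl
      · rw [Frame.opQ_zero]
        exact mem_scalars_of_zero_sub (h 1) rfl
      · rw [Frame.opE₁_one]
        exact mem_scalars_of_zero_sub (h 2) rfl
      · rw [Frame.opE₂_zero]
        exact mem_scalars_of_zero_sub (h 3) rfl
    have h4 := h 4
    have h5 := h 5
    rw [map_eq_zero_of_mem_scalars _ hc, sub_zero] at h4 h5
    change c 0 • F.x + c 1 • F.z ∈ scalars A at h4
    have h6 := map_eq_zero_of_mem_scalars F.p h4
    have h7 := map_eq_zero_of_mem_scalars F.r h4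
    simp [Algebra.smul_def] at h6 h7
    refine funext fun i => ?_
    fin_cases i
    · exact F.algebraMap_eq_zero.1 h6
    · exact F.algebraMap_eq_zero.1 h7
    · exact F.algebraMap_eq_zero.1 (smul_mem_scalars F.q_y h5)
  surj G hG h := by
    obtain ⟨l, h1, h2, h3, h4⟩ := exists_shift_17A (F := F) hG (a := 1) (b := 0) (by norm_num) (h 0)
      (by rw [Frame.opQ_zero]; exact h 1) (by rw [Frame.opE₁_one]; exact h 2)
      (by rw [Frame.opE₂_zero]; exact h 3)
    obtain ⟨f, hf⟩ := IsOpAlg.exists_mem_shift l (h 4)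
    obtain ⟨g, hg⟩ := IsOpAlg.exists_mem_shift l (h 5)
    have hG' := hG.shift l
    change ((F.opX a 0 0).1, f) ∈ _ at hf
    replace hg : ((F.opY2 0 0).1, g) ∈ shift G l := by
      rw [Frame.opY2_zero]
      exact hg
    obtain ⟨c, d, k, hk, rfl, -, ⟨hd, -⟩, hk', -⟩ := exists_affine_17A hG' h1 h2 h3 h4
      (by simp [Frame.opX, Frame.op]) hf
      (by rw [Frame.lie_P_X, opC_zero, add_zero]; exact Submodule.smul_mem _ _ h3)
      (by rw [Frame.lie_Q_X]; exact zero_mem _) (F.lie_E₁_X _ _ _) (F.lie_E₂_X _ _ _)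
    obtain rfl : d = 0 := by linarith
    -- For a = 1 and μ₁ = 1 the equation is wk' - k = const with w = z; its solutions produce the
    -- additional cocycle in z.
    obtain ⟨e, he⟩ := hk.exists_of_euler_sub (by simpa using hk')
    obtain ⟨c', d', k', hk₂, rfl, ⟨-, hc'⟩, -, hk₂', -⟩ := exists_affine_17A hG' h1 h2 h3 h4
      (zero_smul _ _) hg (by rw [Frame.lie_P_Y2]; exact zero_mem _)
      (by
        have := F.lie_Q_Y2_eq 0 0
        rw [mul_zero, opC_zero, add_zero] at this
        rw [this]
        exact Submodule.smul_mem _ _ h4) (F.lie_E₁_Y2 _ _ _) (F.lie_E₂_Y2 _ _ _)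
    obtain rfl : c' = 0 := by linarith
    have hk0 : k' ∈ scalars A := hk₂.mem_scalars_of_euler (by simpa using hk₂')
    have hX : F.opX a c e ∈ shift G l := by
      refine hG'.congr hf ?_
      convert he using 1
      simp only [Algebra.smul_def, w, map_zero]
      ring
    have hY : F.opY2 0 d' ∈ shift G l := by
      refine hG'.congr hg ?_
      simpa [Algebra.smul_def] using hk0
    refine ⟨![c, e, d'], l, fun i => ?_⟩
    rw [gen17A₁_eq]
    fin_cases i <;> assumption

theorem classifies_17A₂ {a : ℝ} (ha : a ≠ 0) : Classifies (F.gen17A₂ a) F.coc17A₂ where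
  add c c' i := by
    fin_cases i
    exacts [(add_zero 0).symm, (add_zero 0).symm, (add_zero 0).symm, (add_zero 0).symm,
      add_smul _ _ _, add_smul _ _ _]
  smul r c i := by
    fin_cases i
    exacts [(smul_zero r).symm, (smul_zero r).symm, (smul_zero r).symm, (smul_zero r).symm,
      mul_smul _ _ _, mul_smul _ _ _]
  linearIndependent := linearIndependent_gen17A₂ a
  lie c i j := by
    rw [gen17A₂_eq, gen17A₂_eq]
    refine lie_mem_17A le_sup_right (fun i => ?_) (F.lie_P_X2_zero _ _)
      (by rw [opLie_swap, Frame.lie_X2_Q]; simp)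
      (F.lie_E₁_X2 _ _ _ _) (F.lie_E₂_X2 _ _ _ _) (F.lie_P_Y2 _ _) (F.lie_Q_Y2_eq _ _)
      (F.lie_E₁_Y2 _ _ _) (F.lie_E₂_Y2 _ _ _) (F.lie_X2_Y2 _ _ _ _) i j
    rw [← gen17A₂_eq]
    exact opSpan_gen _ _ _
  inj c f h := by
    have hc : f ∈ scalars A := by
      refine mem_scalars_of_17A (F := F) (a := a) (b := 1) (by positivity) ?_ ?_ ?_ ?_
      · exact mem_scalars_of_zero_sub (h 0) rfl
      · rw [Frame.opQ_zero]
        exact mem_scalars_of_zero_sub (h 1) rfl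
      · exact mem_scalars_of_zero_sub (h 2) rfl
      · rw [Frame.opE₂_one]
        exact mem_scalars_of_zero_sub (h 3) rfl
    have h4 := h 4
    have h5 := h 5
    rw [map_eq_zero_of_mem_scalars _ hc, sub_zero] at h4 h5
    refine funext fun i => ?_
    fin_cases i
    · exact F.algebraMap_eq_zero.1 (smul_mem_scalars F.p_x h4)
    · exact F.algebraMap_eq_zero.1 (smul_mem_scalars F.q_y h5)
  surj G hG h := by
    obtain ⟨l, h1, h2, h3, h4⟩ := exists_shift_17A (F := F) hG (a := a) (b := 1) (by positivity) (h 0)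
      (by rw [Frame.opQ_zero]; exact h 1) (h 2) (by rw [Frame.opE₂_one]; exact h 3)
    obtain ⟨f, hf⟩ := IsOpAlg.exists_mem_shift l (h 4)
    obtain ⟨g, hg⟩ := IsOpAlg.exists_mem_shift l (h 5)
    have hG' := hG.shift l
    replace hf : ((F.opX2 0 (2 * a) 0).1, f) ∈ shift G l := by
      rw [Frame.opX2_left_zero]
      exact hf
    replace hg : ((F.opY2 (2 * 1) 0).1, g) ∈ shift G l := by
      rw [mul_one]
      exact hg
    obtain ⟨c, d, k, hk, rfl, -, ⟨hd, -⟩, -, hk'⟩ := exists_affine_17A hG' h1 h2 h3 h4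
      (zero_smul _ _) hf
      (by rw [Frame.lie_P_X2_zero, opC_zero, add_zero]; exact Submodule.smul_mem _ _ h3)
      (by rw [opLie_swap, Frame.lie_X2_Q]; simp) (F.lie_E₁_X2 _ _ _ _) (F.lie_E₂_X2 _ _ _ _)
    obtain rfl : d = 0 := by linarith
    have hk0 : k ∈ scalars A := hk.mem_scalars_of_euler (by simpa using hk')
    obtain ⟨c', d', k', hk₂, rfl, ⟨-, hc'⟩, -, hk₂', -⟩ := exists_affine_17A hG' h1 h2 h3 h4
      (zero_smul _ _) hg (by rw [Frame.lie_P_Y2]; exact zero_mem _)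
      (by rw [Frame.lie_Q_Y2_eq, opC_zero, add_zero]; exact Submodule.smul_mem _ _ h4)
      (F.lie_E₁_Y2 _ _ _) (F.lie_E₂_Y2 _ _ _)
    obtain rfl : c' = 0 := by linarith
    have hk0' : k' ∈ scalars A := by
      refine hk₂.mem_scalars_of_euler ?_
      -- Only awk' is known to be constant here, since y²q + 2yzr has weight 0 under xp + azr; this
      -- is where a ≠ 0 enters.
      have := (scalars A).smul_mem a⁻¹ hk₂'
      rw [map_zero, zero_mul, sub_zero, Algebra.smul_def, ← mul_assoc, ← map_mul,
        inv_mul_cancel₀ ha, map_one, one_mul] at this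
      exact this
    have hX : F.opX2 0 (2 * a) c ∈ shift G l := by
      refine hG'.congr hf ?_
      simpa [Algebra.smul_def] using hk0
    have hY : F.opY2 (2 * 1) d' ∈ shift G l := by
      refine hG'.congr hg ?_
      simpa [Algebra.smul_def] using hk0'
    refine ⟨![c, d'], l, fun i => ?_⟩
    rw [gen17A₂_eq]
    fin_cases i <;> assumption

end FullFrame

end DiffOp

namespace TypeIII

open VF3 DiffOp

theorem hasCohomology_17A₁ (a : ℝ) : HasCohomology (U := ⊤) (gen17A₁ a) coc17A₁ :=
  hasCohomology_of_classifies (fullFrame.classifies_17A₁ a)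

theorem hasCohomology_17A₂ {a : ℝ} (ha : a ≠ 0) : HasCohomology (U := ⊤) (gen17A₂ a) coc17A₂ :=
  hasCohomology_of_classifies (fullFrame.classifies_17A₂ ha)

end TypeIII

namespace DiffOp

variable {A : Type} [CommRing A] [Algebra ℝ A]

namespace FullFrame

variable {F : FullFrame A}

/-! ### The family 5A -/

variable (F) in
/-- The vector fields of 5A. -/
def gen5A (s t : ℕ) : Set (Der A) :=
  Set.range (fun i : Fin (s + 1) =>
    F.vf 0 (F.x ^ (i : ℕ)) (((i : ℕ).choose t : ℝ) • F.x ^ ((i : ℕ) - t))) ∪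
    {F.vf 1 0 0, F.vf F.x 0 (-(t : ℝ) • F.z), F.vf 0 F.y F.z,
      F.vf (F.x ^ 2) ((s : ℝ) • (F.x * F.y)) (((s : ℝ) - 2 * t) • (F.x * F.z))}

theorem gen5A_zero (s : ℕ) : F.gen5A s 0 = Set.range (F.gen5Astar s) := by
  rw [gen5Astar, Set.Sum.elim_range, gen5A]
  congr 1
  · simp
  · simp only [Nat.cast_zero, neg_zero, zero_smul, mul_zero, sub_zero, Matrix.range_cons,
      Matrix.range_empty, Set.union_empty, Set.insert_eq]

theorem lie_fst_mem {L : Submodule ℝ (Der A)} (hL : ∀ a ∈ L, ∀ b ∈ L, ⁅a, b⁆ ∈ L)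
    {a b : Der A × A} (ha : a.1 ∈ L) (hb : b.1 ∈ L) : (opLie a b).1 ∈ L := hL _ ha _ hb

/-- The quadratic field raises the power of x. It maps the top field to a nonzero multiple of
xˢ⁻ᵗ⁺¹r, and each later step has the coefficient t + 1 + j, which is never zero. -/
theorem opR_fst_mem {L : Submodule ℝ (Der A)} (hL : ∀ a ∈ L, ∀ b ∈ L, ⁅a, b⁆ ∈ L) {s t : ℕ}
    (ht : t ≠ 0) (hts : t ≤ s) (hgen : F.gen5A s t ⊆ L) (j : ℕ) :
    (F.opR (s - t + 1 + j) 0).1 ∈ L := by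
  have hW : (F.opX2 s (s - 2 * t) 0).1 ∈ L := hgen (Or.inr (by simp [Frame.opX2, Frame.op]))
  induction j with
  | zero =>
    have hV : (F.opV t s).1 ∈ L := hgen (Or.inl ⟨Fin.last s, rfl⟩)
    have h := lie_fst_mem hL hW hV
    rw [Frame.lie_X2_V_top, Prod.smul_fst, L.smul_mem_iff] at h
    · exact h
    · have := (Nat.choose_pos hts).ne'
      positivity
  | succ j ih =>
    have h := lie_fst_mem hL hW ih
    rw [Frame.lie_X2_R, Prod.smul_fst, L.smul_mem_iff] at h
    · exact h
    · push_cast [Nat.cast_sub hts]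
      have : (s : ℝ) - t + 1 + j + s * 0 - (s - 2 * t) = t + 1 + j := by ring
      rw [this]
      positivity

theorem eq_zero_of_lie_mem {s t N : ℕ} (hts : t ≤ s) {S : Set (Der A)}
    (hS : ∀ D ∈ S, ∀ M > N, F.dual 2 M 0 0 D = 0)
    (hL : ∀ a ∈ Submodule.span ℝ (F.gen5A s t ∪ S), ∀ b ∈ Submodule.span ℝ (F.gen5A s t ∪ S),
      ⁅a, b⁆ ∈ Submodule.span ℝ (F.gen5A s t ∪ S)) : t = 0 := by
  by_contra ht
  -- The resulting exponent s - t + 1 + s + N exceeds both s and N, hence every pure power of x in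
  -- the r-components of the generators.
  have h := opR_fst_mem hL ht hts (Set.subset_union_left.trans Submodule.subset_span) (s + N)
  have h0 : Submodule.span ℝ (F.gen5A s t ∪ S) ≤
      LinearMap.ker (F.dual 2 (s - t + 1 + (s + N)) 0 0) := by
    rw [Submodule.span_le]
    rintro D ((⟨i, rfl⟩ | hD) | hD)
    · have := i.2
      simp [Frame.dual_two, coef_x_pow]
      intro
      omega
    · rcases hD with rfl | rfl | rfl | rfl <;> simp [Frame.dual_two, coef_z, coef_x_mul_z]
    · exact hS D hD _ (by omega)
  have h1 := h0 h
  simp [Frame.opR, Frame.op, Frame.dual_two, coef_x_pow, Nat.factorial_ne_zero] at h1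

end FullFrame

end DiffOp

/-! ### Which members of the family with parameter t are Lie algebras -/

namespace TypeIII

open VF3 DiffOp

theorem gen5A_eq (s t : ℕ) : gen5A (U := ⊤) s t = fullFrame.gen5A s t := rfl

theorem gen5Astar_eq (s : ℕ) : gen5Astar (U := ⊤) s = fullFrame.gen5Astar s := rfl

theorem span_gen5A_zero (s : ℕ) : Submodule.span ℝ (gen5A (U := ⊤) s 0) =
    Submodule.span ℝ (Set.range (gen5Astar (U := ⊤) s)) := by
  rw [gen5A_eq, gen5Astar_eq, FullFrame.gen5A_zero]

theorem spanIsLieAlgebra_of_hasCohomology {U : TopologicalSpace.Opens R3} {ι : Type} {m : ℕ}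
    {v : ι → VF U} {η : (Fin m → ℝ) → ι → Fun U} (h : HasCohomology v η) :
    SpanIsLieAlgebra (Set.range v) := by
  obtain ⟨𝔥, B, -, hB, -⟩ := h
  refine ⟨𝔥, ?_⟩
  have := congrArg (Submodule.map 𝔥.toSubmodule.subtype) B.span_eq
  rw [Submodule.map_span, Submodule.map_subtype_top, ← Set.range_comp] at this
  rw [← this]
  congr 2
  exact funext hB

theorem spanIsLieAlgebra_gen5A_zero (s : ℕ) : SpanIsLieAlgebra (U := ⊤) (gen5A s 0) := by
  rw [gen5A_eq, FullFrame.gen5A_zero, ← gen5Astar_eq]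
  exact spanIsLieAlgebra_of_hasCohomology (hasCohomology_5Astar s)

theorem dual_extra5A {s n l₀ M : ℕ} (hM : l₀ + s * n + 1 < M) {D : VF ⊤} (hD : D ∈ extra5A s n l₀) :
    fullFrame.dual 2 M 0 0 D = 0 := by
  rcases hD with (rfl | rfl) | ⟨bl, rfl⟩
  · exact (Frame.dual_two _ _ _ _ _ _ _).trans (map_zero _)
  · exact (Frame.dual_two _ _ _ _ _ _ _).trans
      ((FullFrame.coef_z _ _ _ _).trans (if_neg (by simp)))
  · refine (Frame.dual_two _ _ _ _ _ _ _).trans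
      ((FullFrame.coef_x_pow_mul_y_pow _ _ _ _ _ _).trans (if_neg ?_))
    rintro ⟨h, -⟩
    have h1 := bl.2.2
    have h2 : s * (bl.1 : ℕ) ≤ s * n := Nat.mul_le_mul_left _ (Nat.le_of_lt_succ bl.1.2)
    omega

theorem eq_zero_of_spanIsLieAlgebra {s t n l₀ : ℕ} (hts : t ≤ s) {S : Set (VF ⊤)}
    (hS : S ⊆ extra5A s n l₀) (h : SpanIsLieAlgebra (gen5A s t ∪ S)) : t = 0 := by
  obtain ⟨𝔥, h𝔥⟩ := h
  refine fullFrame.eq_zero_of_lie_mem (N := l₀ + s * n + 1) hts (S := S)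
    (fun D hD M hM => dual_extra5A hM (hS hD)) ?_
  rw [← gen5A_eq, ← h𝔥]
  exact fun a ha b hb => 𝔥.lie_mem ha hb

theorem spanIsLieAlgebra_gen5A_iff {s t : ℕ} (hts : t ≤ s) :
    SpanIsLieAlgebra (U := ⊤) (gen5A s t) ↔ t = 0 := by
  constructor
  · intro h
    refine eq_zero_of_spanIsLieAlgebra (n := 0) (l₀ := 0) hts (Set.empty_subset _) ?_
    rwa [Set.union_empty]
  · rintro rfl
    exact spanIsLieAlgebra_gen5A_zero s

end TypeIII

namespace DiffOp

variable {A : Type} [CommRing A] [Algebra ℝ A]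

theorem mem_shift_of_eq {G : Submodule ℝ (Der A × A)} {l f : A} {a : Der A × A} (ha : (a.1, f) ∈ G)
    (h : a.2 + a.1 l = f) : a ∈ shift G l := by
  subst h
  exact ha

namespace HalfFrame

variable (F : HalfFrame A)

/-! ### The algebra 7C -/

theorem derivation_yi (D : Der A) : D F.yi = -(F.yi ^ 2 * D F.y) := by
  have h := congrArg D F.y_mul_yi
  simp only [Derivation.leibniz, smul_eq_mul, Derivation.map_one_eq_zero] at h
  linear_combination F.yi * h - D F.yi * F.y_mul_yi

@[simp] theorem p_yi : F.p F.yi = 0 := by simp [derivation_yi]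
@[simp] theorem q_yi : F.q F.yi = -F.yi ^ 2 := by simp [derivation_yi]
@[simp] theorem r_yi : F.r F.yi = 0 := by simp [derivation_yi]

theorem y_pow_mul_yi_pow (n : ℕ) : F.y ^ n * F.yi ^ n = 1 := by
  rw [← mul_pow, F.y_mul_yi, one_pow]

theorem ev_yi_ne_zero : F.ev F.yi ≠ 0 := by
  intro h
  have := congrArg F.ev F.y_mul_yi
  simp [h] at this

/-- `2 x p + y q` -/
def opE : Der A × A := F.op ((2 : ℝ) • F.x) F.y 0 0
/-- `x² p + x y q + c y²` -/
def opG (c : ℝ) : Der A × A := F.op (F.x ^ 2) (F.x * F.y) 0 (c • F.y ^ 2)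
/-- `xˡ y⁻ⁿ r` -/
def opS (n l : ℕ) : Der A × A := F.op 0 0 (F.x ^ l * F.yi ^ n) 0

theorem lie_P_E : opLie F.opP F.opE = (2 : ℝ) • F.opP := by
  simp only [Frame.opP, opE, Frame.opLie_op, Frame.smul_op]
  congr 1 <;> simp [Algebra.smul_def]

theorem lie_P_G (c : ℝ) : opLie F.opP (F.opG c) = F.opE := by
  simp only [Frame.opP, opG, opE, Frame.opLie_op]
  congr 1 <;> simp [Algebra.smul_def, map_ofNat]

theorem lie_E_G (c : ℝ) : opLie F.opE (F.opG c) = (2 : ℝ) • F.opG c := by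
  simp only [opE, opG, Frame.opLie_op, Frame.smul_op]
  congr 1 <;> simp [Algebra.smul_def] <;> simp only [map_ofNat] <;> ring

theorem lie_P_S (n l : ℕ) : opLie F.opP (F.opS n l) = (l : ℝ) • F.opS n (l - 1) := by
  simp only [Frame.opP, opS, Frame.opLie_op, Frame.smul_op]
  congr 1 <;> simp
  ring

theorem lie_E_S (n l : ℕ) : opLie F.opE (F.opS n l) = (2 * l - n : ℝ) • F.opS n l := by
  simp only [opE, opS, Frame.opLie_op, Frame.smul_op]
  congr 1 <;> simp [Algebra.smul_def]
  simp only [map_ofNat]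
  linear_combination 2 * F.yi ^ n * x_mul_pow_pred l F.x -
    F.x ^ l * x_mul_pow_pred n F.yi - F.x ^ l * (n * F.yi ^ (n - 1) * F.yi) * F.y_mul_yi

theorem lie_G_S (c : ℝ) (n l : ℕ) :
    opLie (F.opG c) (F.opS n l) = (l - n : ℝ) • F.opS n (l + 1) := by
  simp only [opG, opS, Frame.opLie_op, Frame.smul_op]
  congr 1 <;> simp [Algebra.smul_def]
  linear_combination F.x * F.yi ^ n * x_mul_pow_pred l F.x -
    F.x ^ (l + 1) * x_mul_pow_pred n F.yi - F.x ^ (l + 1) * (n * F.yi ^ (n - 1) * F.yi) * F.y_mul_yi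

theorem lie_ZR_S (n l : ℕ) : opLie F.opZR (F.opS n l) = (-1 : ℝ) • F.opS n l := by
  simp only [Frame.opZR, opS, Frame.opLie_op, Frame.smul_op]
  congr 1 <;> simp

theorem lie_S_S (n l m : ℕ) : opLie (F.opS n l) (F.opS n m) = 0 := by
  simp only [opS, Frame.opLie_op, F.zero_op]
  congr 1 <;> simp

theorem lie_E_ZR : opLie F.opE F.opZR = 0 := by
  simp only [opE, Frame.opZR, Frame.opLie_op, F.zero_op]
  congr 1 <;> simp

theorem lie_G_ZR (c : ℝ) : opLie (F.opG c) F.opZR = 0 := by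
  simp only [opG, Frame.opZR, Frame.opLie_op, F.zero_op]
  congr 1 <;> simp [Algebra.smul_def]

variable {F}

theorem opP_apply (f : A) : F.opP.1 f = F.p f := by simp [Frame.opP, Frame.op, Frame.vf_apply]

theorem opZR_apply (f : A) : F.opZR.1 f = F.z * F.r f := by
  simp [Frame.opZR, Frame.op, Frame.vf_apply]

theorem opS_apply (n l : ℕ) (f : A) : (F.opS n l).1 f = F.x ^ l * F.yi ^ n * F.r f := by
  simp [opS, Frame.op, Frame.vf_apply]

theorem opE_apply (f : A) : F.opE.1 f = 2 * F.x * F.p f + F.y * F.q f := by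
  simp [opE, Frame.op, Frame.vf_apply, Algebra.smul_def, map_ofNat]

theorem opG_apply (c : ℝ) (f : A) : (F.opG c).1 f = F.x ^ 2 * F.p f + F.x * F.y * F.q f := by
  simp [opG, Frame.op, Frame.vf_apply]

theorem derivation_two (D : Der A) : D 2 = 0 := by simpa using D.map_natCast 2

theorem r_eq_of_opS {n : ℕ} {f : A} (h : (F.opS n 0).1 f ∈ scalars A) :
    ∃ c : ℝ, F.r f = algebraMap ℝ A c * F.y ^ n := by
  obtain ⟨c, hc⟩ := h
  rw [opS_apply, Algebra.linearMap_apply] at hc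
  exact ⟨c, by linear_combination -F.r f * F.y_pow_mul_yi_pow n - F.y ^ n * hc⟩

theorem algebraMap_mul_y_pow {n : ℕ} {c : ℝ} (h : algebraMap ℝ A c * F.y ^ n = 0) : c = 0 :=
  F.algebraMap_eq_zero.1 (by
    linear_combination F.yi ^ n * h - algebraMap ℝ A c * F.y_pow_mul_yi_pow n)

/-- After p is straightened, the term g of y⁻ⁿr has a constant derivative along p. Applying p to the
relation of zr with its eigenvector y⁻ⁿr shows that this constant is zero, so r(l) = yⁿg can be
solved without disturbing p. -/
theorem exists_shift_P_S {G : Submodule ℝ (Der A × A)} (hG : IsOpAlg G) {n : ℕ}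
    (hP : ∃ f, (F.opP.1, f) ∈ G) (hS : ∃ f, ((F.opS n 0).1, f) ∈ G)
    (hZ : ∃ f, (F.opZR.1, f) ∈ G) : ∃ l, F.opP ∈ shift G l ∧ F.opS n 0 ∈ shift G l := by
  obtain ⟨f, hf⟩ := hP
  obtain ⟨l₁, rfl⟩ := F.exists_p_eq f
  have hP : F.opP ∈ shift G l₁ := mem_shift_of_eq hf ((zero_add _).trans (opP_apply l₁))
  obtain ⟨g, hg⟩ := IsOpAlg.exists_mem_shift l₁ hS
  obtain ⟨h, hh⟩ := IsOpAlg.exists_mem_shift l₁ hZ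
  have hG' := hG.shift l₁
  have h1 := hG'.rel_of_lie_mem hP rfl rfl hg (by simp [lie_P_S])
  have h2 := hG'.rel_of_lie_mem hP rfl rfl hh (by simp [Frame.lie_P_ZR])
  have h3 := hG'.rel hh hg (h := (-1 : ℝ) • g) (by
    rw [show ⁅F.opZR.1, (F.opS n 0).1⁆ = _ from congrArg Prod.fst (F.lie_ZR_S n 0)]
    exact Submodule.smul_mem _ (-1 : ℝ) hg)
  rw [opP_apply] at h1 h2
  obtain ⟨α, hα⟩ := h1
  obtain ⟨β, hβ⟩ := h2
  rw [Algebra.linearMap_apply] at hα hβ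
  have hα0 : α = 0 := by
    have h4 := map_eq_zero_of_mem_scalars F.p h3
    rw [opZR_apply, opS_apply] at h4
    simp [← hα, ← hβ, ← F.r_p] at h4
    exact F.algebraMap_eq_zero.1 h4
  subst hα0
  obtain ⟨l₂, hl₂, hl₂'⟩ := F.exists_r_eq (F.y ^ n * g) (by simp [← hα])
  refine ⟨l₁ + l₂, ?_⟩
  rw [← shift_shift]
  constructor
  · refine mem_shift.2 ?_
    change (F.opP.1, 0 + F.opP.1 l₂) ∈ _
    rw [opP_apply, hl₂, add_zero]
    exact hP
  · refine mem_shift_of_eq hg ?_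
    change 0 + (F.opS n 0).1 l₂ = _
    rw [opS_apply, hl₂']
    linear_combination g * F.y_pow_mul_yi_pow n

/-- Let c yⁿ and d yⁿ be the r-derivatives of the terms of zr and 2xp + yq. That these two fields
commute gives p f = 0 for the term f of zr and d = nc. One conjugation then removes the term of 2xp
+ yq and the part c yⁿz of f; what remains of f can only be a multiple of log y, up to a constant.
-/
theorem exists_shift_E {G : Submodule ℝ (Der A × A)} (hG : IsOpAlg G) {n : ℕ}
    (hP : F.opP ∈ G) (hS : F.opS n 0 ∈ G) (hZ : ∃ f, (F.opZR.1, f) ∈ G)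
    (hE : ∃ f, (F.opE.1, f) ∈ G) :
    ∃ l, F.opP ∈ shift G l ∧ F.opS n 0 ∈ shift G l ∧ F.opE ∈ shift G l ∧
      ∃ k, (F.opZR.1, k) ∈ shift G l ∧ F.p k = 0 ∧ F.r k = 0 ∧ F.y * F.q k ∈ scalars A := by
  obtain ⟨f, hf⟩ := hZ
  obtain ⟨g, hg⟩ := hE
  have h1 := hG.rel_of_lie_mem hP rfl rfl hf (by simp [Frame.lie_P_ZR])
  have h2 := r_eq_of_opS (hG.rel_of_lie_mem hS rfl rfl hf (lie_mem_of_swap (by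
    rw [lie_ZR_S]; exact G.smul_mem _ hS)))
  have h3 := hG.rel_of_lie_mem hP rfl rfl hg (by rw [lie_P_E]; exact G.smul_mem _ hP)
  have h4 := r_eq_of_opS (hG.rel_of_lie_mem hS rfl rfl hg (lie_mem_of_swap (by
    rw [lie_E_S]; exact G.smul_mem _ hS)))
  have h5 := hG.rel_zero hg hf (congrArg Prod.fst F.lie_E_ZR)
  rw [opP_apply] at h1 h3
  obtain ⟨β, hβ⟩ := h1
  obtain ⟨c, hc⟩ := h2
  obtain ⟨e, he⟩ := h3
  obtain ⟨d, hd⟩ := h4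
  rw [Algebra.linearMap_apply] at hβ he
  rw [opE_apply, opZR_apply] at h5
  have hβ0 : β = 0 := by
    have h6 := map_eq_zero_of_mem_scalars F.p h5
    simp [← hβ, ← F.q_p, hd, derivation_two] at h6
    have := F.algebraMap_eq_zero (c := 2 * β)
    rw [map_mul, map_ofNat] at this
    linarith [this.1 (by linear_combination h6)]
  subst hβ0
  have hdc : d = n * c := by
    have h6 := map_eq_zero_of_mem_scalars F.r h5
    simp only [map_sub, Derivation.leibniz, smul_eq_mul, ← hβ, map_zero, mul_zero,
      zero_add, F.r_q, hc, hd, F.r_z, F.r_y, F.q_y, add_zero, mul_one, nsmul_eq_mul,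
      Derivation.map_algebraMap, Derivation.leibniz_pow, smul_zero] at h6
    have := algebraMap_mul_y_pow (F := F) (n := n) (c := d - n * c) (by
      simp only [map_sub, map_mul, map_natCast]
      linear_combination -h6 + algebraMap ℝ A c * x_mul_pow_pred n F.y)
    linarith
  obtain ⟨μ, hμ1, hμ2, hμ3⟩ := F.exists_q_eq
    (F.yi * (g - algebraMap ℝ A e * F.x - algebraMap ℝ A d * F.y ^ n * F.z))
    (by simp [← he]) (by simp [hd])
  have hd' : algebraMap ℝ A d = n * algebraMap ℝ A c := by
    rw [hdc, map_mul, map_natCast]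
  have he2 : (2 : A) * algebraMap ℝ A (e / 2) = algebraMap ℝ A e := by
    rw [← map_ofNat (algebraMap ℝ A) 2, ← map_mul]
    congr 1
    ring
  -- The field 2xp + yq multiplies yⁿz by n and x by 2, and `μ` is a function of y with yμ' equal to
  -- the rest of g. On p and y⁻ⁿr the effect is constant.
  refine ⟨algebraMap ℝ A c * F.y ^ n * F.z + algebraMap ℝ A (e / 2) * F.x + μ, ?_, ?_, ?_,
    f - algebraMap ℝ A c * F.y ^ n * F.z, ?_, ?_, ?_, ?_⟩
  · refine hG.congr hP ?_
    change 0 - (0 + F.opP.1 _) ∈ scalars A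
    rw [opP_apply]
    simp [hμ1, ← map_neg]
  · refine hG.congr hS ?_
    change 0 - (0 + (F.opS n 0).1 _) ∈ scalars A
    rw [opS_apply]
    have : F.x ^ 0 * F.yi ^ n * F.r (algebraMap ℝ A c * F.y ^ n * F.z +
        algebraMap ℝ A (e / 2) * F.x + μ) = algebraMap ℝ A c := by
      simp [hμ2]
      linear_combination algebraMap ℝ A c * F.y_pow_mul_yi_pow n
    rw [this, zero_add, zero_sub, ← map_neg]
    exact algebraMap_mem_scalars _
  · refine mem_shift_of_eq hg ?_
    change 0 + F.opE.1 _ = _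
    rw [opE_apply]
    simp [hμ1, hμ3]
    linear_combination F.z * algebraMap ℝ A c * x_mul_pow_pred n F.y + F.x * he2 -
      F.z * F.y ^ n * hd' +
      (g - algebraMap ℝ A e * F.x - algebraMap ℝ A d * F.y ^ n * F.z) * F.y_mul_yi
  · refine mem_shift.2 ?_
    convert hf using 2
    rw [opZR_apply]
    simp [hμ2]
    ring
  · simp [← hβ]
  · simp [hc]
  · rw [hd, ← hβ] at h5
    convert h5 using 1
    simp
    linear_combination F.z * F.y ^ n * hd' - F.z * algebraMap ℝ A c * x_mul_pow_pred n F.y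

/-- Commutation of zr with x²p + xyq excludes the multiple of log y left on zr and makes the term of
x²p + xyq independent of z. That term has eigenvalue 2 under 2xp + yq and constant derivative along
p, so it is δx + cy² up to a constant. -/
theorem exists_shift_G {G : Submodule ℝ (Der A × A)} (hG : IsOpAlg G) {n : ℕ}
    (hP : F.opP ∈ G) (hS : F.opS n 0 ∈ G) (hE : F.opE ∈ G)
    (hZ : ∃ k, (F.opZR.1, k) ∈ G ∧ F.p k = 0 ∧ F.r k = 0 ∧ F.y * F.q k ∈ scalars A)
    (hX : ∃ f, ((F.opG 0).1, f) ∈ G) :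
    ∃ c l, F.opP ∈ shift G l ∧ F.opS n 0 ∈ shift G l ∧ F.opE ∈ shift G l ∧
      F.opZR ∈ shift G l ∧ F.opG c ∈ shift G l := by
  obtain ⟨k, hk, hpk, hrk, γ, hγ⟩ := hZ
  obtain ⟨f, hf⟩ := hX
  rw [Algebra.linearMap_apply] at hγ
  have h1 := hG.rel_of_lie_mem hP rfl (zero_smul _ _) hf (by rw [lie_P_G]; exact hE)
  have h2 := hG.rel_of_lie_eq_smul hE rfl hf (F.lie_E_G 0)
  have h3 := hG.rel_zero hf hk (congrArg Prod.fst (F.lie_G_ZR 0))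
  rw [opP_apply] at h1
  rw [opE_apply] at h2
  rw [opG_apply, opZR_apply, hpk] at h3
  obtain ⟨δ, hδ⟩ := h1
  rw [Algebra.linearMap_apply] at hδ
  have h4 : F.x * algebraMap ℝ A γ - F.z * F.r f ∈ scalars A := by
    convert h3 using 1
    rw [hγ]
    ring
  have hγ0 : γ = 0 := by
    have h5 := map_eq_zero_of_mem_scalars F.p h4
    simp [← F.r_p, ← hδ] at h5
    exact F.algebraMap_eq_zero.1 h5
  subst hγ0
  have hqk : F.q k = 0 := by
    linear_combination -F.q k * F.y_mul_yi - F.yi * hγ + F.yi * map_zero (algebraMap ℝ A)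
  have hZ : F.opZR ∈ G := hG.zero_of hk (F.mem_scalars k hpk hqk hrk)
  have hrf : F.r f = 0 := by
    obtain ⟨τ, hτ⟩ := h4
    have : τ = 0 := by simpa using congrArg F.ev hτ
    subst this
    refine F.eq_zero_of_mul_eq_zero _ ?_
    rw [Algebra.linearMap_apply, map_zero] at hτ
    linear_combination hτ
  obtain ⟨τ, hτ⟩ := h2
  rw [Algebra.linearMap_apply, ← hδ, map_ofNat] at hτ
  have hτ2 : (2 : A) * algebraMap ℝ A (τ / 2) = algebraMap ℝ A τ := by
    rw [← map_ofNat (algebraMap ℝ A) 2, ← map_mul]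
    congr 1
    ring
  -- The eigenvalue equation says that y⁻² times the remainder has no y-derivative.
  obtain ⟨c, hc⟩ := F.mem_scalars (F.yi ^ 2 * (f - algebraMap ℝ A δ * F.x + algebraMap ℝ A (τ / 2)))
    (by simp [← hδ])
    (by
      simp
      linear_combination -F.q f * F.yi ^ 2 * F.y_mul_yi - F.yi ^ 3 * hτ - F.yi ^ 3 * hτ2)
    (by simp [hrf])
  rw [Algebra.linearMap_apply] at hc
  have hf' : f = algebraMap ℝ A δ * F.x + algebraMap ℝ A c * F.y ^ 2 - algebraMap ℝ A (τ / 2) := by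
    linear_combination -(f - algebraMap ℝ A δ * F.x + algebraMap ℝ A (τ / 2)) *
      F.y_pow_mul_yi_pow 2 - F.y ^ 2 * hc
  -- `L` is δ log y: x²p + xyq maps it to δx, 2xp + yq maps it to a constant, and p, r annihilate
  -- it.
  obtain ⟨L, hL1, hL2, hL3⟩ := F.exists_q_eq (algebraMap ℝ A δ * F.yi) (by simp) (by simp)
  refine ⟨c, L, ?_, ?_, ?_, ?_, ?_⟩
  · refine mem_shift.2 ?_
    change (F.opP.1, 0 + F.opP.1 L) ∈ _
    rw [opP_apply, hL1, add_zero]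
    exact hP
  · refine mem_shift.2 ?_
    change ((F.opS n 0).1, 0 + (F.opS n 0).1 L) ∈ _
    rw [opS_apply, hL2, mul_zero, add_zero]
    exact hS
  · refine hG.congr hE ?_
    change 0 - (0 + F.opE.1 L) ∈ scalars A
    have : F.opE.1 L = algebraMap ℝ A δ := by
      rw [opE_apply, hL1, hL3]
      linear_combination algebraMap ℝ A δ * F.y_mul_yi
    rw [this, zero_add, zero_sub, ← map_neg]
    exact algebraMap_mem_scalars _
  · refine mem_shift.2 ?_
    change (F.opZR.1, 0 + F.opZR.1 L) ∈ _
    rw [opZR_apply, hL2, mul_zero, add_zero]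
    exact hZ
  · refine hG.congr hf ?_
    change f - (c • F.y ^ 2 + (F.opG c).1 L) ∈ scalars A
    refine ⟨-(τ / 2), ?_⟩
    rw [opG_apply, hL1, hL3, Algebra.linearMap_apply, Algebra.smul_def, map_neg]
    linear_combination -hf' + F.x * algebraMap ℝ A δ * F.y_mul_yi

/-- The term satisfies r f = κyⁿ, because the fields xˡy⁻ⁿr commute. Weight -1 under zr says that z
r f + f is constant, and its r-derivative 2κyⁿ must vanish. -/
theorem opS_mem {G : Submodule ℝ (Der A × A)} (hG : IsOpAlg G) {n : ℕ}
    (hS : F.opS n 0 ∈ G) (hZ : F.opZR ∈ G) {l : ℕ} (h : ∃ f, ((F.opS n l).1, f) ∈ G) :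
    F.opS n l ∈ G := by
  obtain ⟨f, hf⟩ := h
  obtain ⟨κ, hκ⟩ := r_eq_of_opS (hG.rel_of_lie_mem hS rfl rfl hf (by simp [lie_S_S]))
  have h1 := hG.rel_of_lie_eq_smul hZ rfl hf (F.lie_ZR_S n l)
  refine hG.zero_of hf ?_
  rw [opZR_apply, hκ, map_neg, map_one] at h1
  have h2 := map_eq_zero_of_mem_scalars F.r h1
  simp [hκ] at h2
  have h3 := algebraMap_mul_y_pow (F := F) (n := n) (c := 2 * κ) (by
    rw [map_mul, map_ofNat]
    linear_combination h2)
  obtain rfl : κ = 0 := by linarith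
  simpa using h1

end HalfFrame

end DiffOp

namespace DiffOp

variable {A : Type} [CommRing A] [Algebra ℝ A]

namespace HalfFrame

variable {F : HalfFrame A}

variable (F) in
/-- The vector fields of 7C. -/
def gen7C (n : ℕ) : Fin (n + 1) ⊕ Fin 4 → Der A :=
  Sum.elim (fun l => F.vf 0 0 (F.x ^ (l : ℕ) * F.yi ^ n))
    ![F.vf 1 0 0, F.vf ((2 : ℝ) • F.x) F.y 0, F.vf (F.x ^ 2) (F.x * F.y) 0, F.vf 0 0 F.z]

variable (F) in
/-- The cocycles of 7C. -/
def coc7C (n : ℕ) (c : Fin 1 → ℝ) : Fin (n + 1) ⊕ Fin 4 → A :=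
  Sum.elim (fun _ => 0) ![0, 0, c 0 • F.y ^ 2, 0]

theorem gen7C_inl (n : ℕ) (c : Fin 1 → ℝ) (l : Fin (n + 1)) :
    (F.gen7C n (Sum.inl l), F.coc7C n c (Sum.inl l)) = F.opS n l := rfl

theorem gen7C_inr (n : ℕ) (c : Fin 1 → ℝ) (i : Fin 4) :
    (F.gen7C n (Sum.inr i), F.coc7C n c (Sum.inr i)) =
      ![F.opP, F.opE, F.opG (c 0), F.opZR] i := by
  fin_cases i <;> rfl

theorem coef_x_pow_mul_yi_pow (a l n : ℕ) : F.coef a 0 0 (F.x ^ l * F.yi ^ n) =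
    if l = a then (a.factorial * F.ev F.yi ^ n : ℝ) else 0 := by
  have h := pow_derivation_apply (D := F.p) (g := F.yi ^ n) F.p_x (by simp) a l
  simp only [Frame.coef, pow_zero, Module.End.one_eq_id, LinearMap.comp_id]
  rw [LinearMap.comp_apply, h]
  simp only [AlgHom.toLinearMap_apply, map_mul, map_natCast, map_pow, F.ev_x]
  split_ifs with hl
  · simp [hl, Nat.descFactorial_self]
  · rcases lt_or_gt_of_ne hl with hl | hl
    · simp [Nat.descFactorial_of_lt hl]
    · simp [(Nat.sub_pos_of_lt hl).ne']

theorem coef_one_x_pow_mul_yi_pow (l n : ℕ) : F.coef 0 0 1 (F.x ^ l * F.yi ^ n) = 0 := by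
  simp [Frame.coef]

theorem coef_x_pow (a l : ℕ) : F.coef a 0 0 (F.x ^ l) = if l = a then (a.factorial : ℝ) else 0 := by
  simpa using coef_x_pow_mul_yi_pow (F := F) a l 0

theorem coef_x (a : ℕ) : F.coef a 0 0 F.x = if 1 = a then (a.factorial : ℝ) else 0 := by
  simpa using coef_x_pow (F := F) a 1

theorem coef_one (a : ℕ) : F.coef a 0 0 1 = if 0 = a then (a.factorial : ℝ) else 0 := by
  simpa using coef_x_pow (F := F) a 0

theorem coef_z (a : ℕ) : F.coef a 0 0 F.z = 0 := by
  simpa using F.coef_monomial a 0 0 0 0 1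

theorem coef_one_z : F.coef 0 0 1 F.z = 1 := by
  simp [Frame.coef]

theorem linearIndependent_gen7C (n : ℕ) : LinearIndependent ℝ (F.gen7C n) := by
  refine linearIndependent_of_dual
    (Sum.elim (fun l => F.dual 2 l 0 0)
      ![F.dual 0 0 0 0, F.dual 0 1 0 0, F.dual 0 2 0 0, F.dual 2 0 0 1])
    (fun i => ?_) fun i j hij => ?_
  · rcases i with i | i
    · simp [gen7C, Frame.dual_two, coef_x_pow_mul_yi_pow, Nat.factorial_ne_zero, ev_yi_ne_zero]
    · fin_cases i <;> simp [gen7C, Frame.dual_zero, Frame.dual_two, coef_one, coef_x, coef_x_pow,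
        coef_one_z]
  · rcases i with i | i <;> rcases j with j | j
    · simp [gen7C, Frame.dual_two, coef_x_pow_mul_yi_pow]
      intro h
      exact absurd (congrArg Sum.inl (Fin.ext h)).symm hij
    · fin_cases j <;> simp [gen7C, Frame.dual_two, coef_z]
    · fin_cases i <;> simp [gen7C, Frame.dual_zero, Frame.dual_two, coef_one_x_pow_mul_yi_pow]
    · fin_cases i <;> fin_cases j <;>
        simp [gen7C, Frame.dual_zero, Frame.dual_two, coef_one, coef_x, coef_x_pow] at hij ⊢

/-- The first two conditions force p f = 0 and make y q f a constant k, so x²p + xyq maps f to kx,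
which cannot match cy² up to a constant. -/
theorem eq_zero_of_opG_sub_mem {c : ℝ} {f : A} (hP : F.opP.1 f ∈ scalars A)
    (hE : F.opE.1 f ∈ scalars A)
    (hG : c • F.y ^ 2 - (F.opG c).1 f ∈ scalars A) : c = 0 := by
  rw [opP_apply] at hP
  rw [opE_apply] at hE
  rw [opG_apply] at hG
  obtain ⟨a, ha⟩ := hP
  rw [Algebra.linearMap_apply] at ha
  have h1 := map_eq_zero_of_mem_scalars F.p hE
  simp [← F.q_p, ← ha, derivation_two] at h1
  have ha0 := F.algebraMap_eq_zero (c := 2 * a)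
  rw [map_mul, map_ofNat] at ha0
  obtain rfl : a = 0 := by linarith [ha0.1 (by linear_combination h1)]
  rw [← ha, map_zero, mul_zero, zero_add] at hE hG
  obtain ⟨k, hk⟩ := hE
  rw [Algebra.linearMap_apply] at hk
  have h2 : c • F.y ^ 2 - algebraMap ℝ A k * F.x ∈ scalars A := by
    convert hG using 2
    linear_combination F.x * hk
  have h3 := map_eq_zero_of_mem_scalars F.q h2
  simp [Algebra.smul_def] at h3
  have hc0 := F.algebraMap_eq_zero (c := 2 * c)
  rw [map_mul, map_ofNat] at hc0
  linarith [hc0.1 (by linear_combination F.yi * h3 - 2 * algebraMap ℝ A c * F.y_mul_yi)]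

theorem classifies_7C (n : ℕ) : Classifies (F.gen7C n) (F.coc7C n) where
  add c c' i := by
    rcases i with i | i
    · exact (add_zero 0).symm
    · fin_cases i
      exacts [(add_zero 0).symm, (add_zero 0).symm, add_smul _ _ _, (add_zero 0).symm]
  smul r c i := by
    rcases i with i | i
    · exact (smul_zero r).symm
    · fin_cases i
      exacts [(smul_zero r).symm, (smul_zero r).symm, mul_smul _ _ _, (smul_zero r).symm]
  linearIndependent := linearIndependent_gen7C n
  lie c i j := by
    set W := opSpan (F.gen7C n) (F.coc7C n c)
    have hS : ∀ l ≤ n, F.opS n l ∈ W := fun l hl => by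
      rw [← gen7C_inl n c ⟨l, Nat.lt_succ_of_le hl⟩]
      exact opSpan_gen _ _ _
    have hg : ∀ i, ![F.opP, F.opE, F.opG (c 0), F.opZR] i ∈ W := fun i => by
      rw [← gen7C_inr n c i]
      exact opSpan_gen _ _ _
    have key : ∀ l : Fin (n + 1), ∀ j : Fin 4,
        opLie (![F.opP, F.opE, F.opG (c 0), F.opZR] j) (F.opS n l) ∈ W := by
      intro l j
      have hl := Nat.le_of_lt_succ l.2
      fin_cases j
      · exact (F.lie_P_S n l).symm ▸ W.smul_mem _ (hS _ (by omega))
      · exact (F.lie_E_S n l).symm ▸ W.smul_mem _ (hS _ hl)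
      · refine (F.lie_G_S (c 0) n l).symm ▸ ?_
        rcases Nat.eq_or_lt_of_le hl with h | h
        · simp [h]
        · exact W.smul_mem _ (hS _ h)
      · exact (F.lie_ZR_S n l).symm ▸ W.smul_mem _ (hS _ hl)
    rcases i with i | i <;> rcases j with j | j
    · rw [gen7C_inl, gen7C_inl, lie_S_S]
      exact zero_mem W
    · rw [gen7C_inl, gen7C_inr]
      exact lie_mem_of_swap (key i j)
    · rw [gen7C_inl, gen7C_inr]
      exact key j i
    · rw [gen7C_inr, gen7C_inr]
      refine opLie_mem_of_lt (fun i j hij => ?_) i j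
      fin_cases i <;> fin_cases j <;> first
        | exact absurd hij (by decide)
        | skip
      · exact F.lie_P_E.symm ▸ W.smul_mem _ (hg 0)
      · exact (F.lie_P_G _).symm ▸ hg 1
      · exact F.lie_P_ZR.symm ▸ zero_mem W
      · exact (F.lie_E_G _).symm ▸ W.smul_mem _ (hg 2)
      · exact F.lie_E_ZR.symm ▸ zero_mem W
      · exact (F.lie_G_ZR _).symm ▸ zero_mem W
  inj c f h := by
    refine funext fun i => ?_
    rw [Subsingleton.elim i 0]
    exact eq_zero_of_opG_sub_mem (F := F) (f := f) (mem_scalars_of_zero_sub (h (Sum.inr 0)) rfl)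
      (mem_scalars_of_zero_sub (h (Sum.inr 1)) rfl) (h (Sum.inr 2))
  surj G hG h := by
    obtain ⟨l₁, h1, h2⟩ := exists_shift_P_S (F := F) (n := n) hG (h (Sum.inr 0)) (h (Sum.inl 0))
      (h (Sum.inr 3))
    obtain ⟨l₂, h1, h2, h3, h4⟩ := exists_shift_E (hG.shift l₁) h1 h2
      (IsOpAlg.exists_mem_shift l₁ (h (Sum.inr 3))) (IsOpAlg.exists_mem_shift l₁ (h (Sum.inr 1)))
    obtain ⟨c, l₃, h1, h2, h3, h4, h5⟩ := exists_shift_G ((hG.shift l₁).shift l₂) h1 h2 h3 h4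
      (IsOpAlg.exists_mem_shift l₂ (IsOpAlg.exists_mem_shift l₁ (h (Sum.inr 2))))
    have hS : ∀ l : Fin (n + 1), F.opS n l ∈ shift (shift (shift G l₁) l₂) l₃ := fun l =>
      opS_mem (((hG.shift l₁).shift l₂).shift l₃) h2 h4 (IsOpAlg.exists_mem_shift l₃
        (IsOpAlg.exists_mem_shift l₂ (IsOpAlg.exists_mem_shift l₁ (h (Sum.inl l)))))
    refine ⟨fun _ => c, l₁ + l₂ + l₃, ?_⟩
    rw [← shift_shift, ← shift_shift]
    rintro (i | i)
    · exact hS i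
    · rw [gen7C_inr]
      fin_cases i <;> assumption

end HalfFrame

end DiffOp

namespace TypeIII

open VF3 DiffOp

theorem hasCohomology_7C {ε : ℝ} (hε : ε ≠ 0) (n : ℕ) : HasCohomology (gen7C ε n) (coc7C ε n) :=
  hasCohomology_of_classifies ((halfFrame ε hε).classifies_7C n)

end TypeIII

end

/-! ### The theorem -/

theorem mainTheorem2 :
    (∀ s t : ℕ, t ≤ s →
      VF3.HasCohomology (U := ⊤) (m := 0) (TypeIII.gen4A s t) (fun _ _ => 0)) ∧
    (∀ s n l₀ : ℕ,
      VF3.HasCohomology (U := ⊤) (m := 0) (TypeIII.gen4C s n l₀) (fun _ _ => 0)) ∧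
    (∀ s : ℕ, VF3.HasCohomology (U := ⊤) (TypeIII.gen4D s) (TypeIII.coc4D s)) ∧
    (∀ s : ℕ, VF3.HasCohomology (U := ⊤) (TypeIII.gen5Astar s) (TypeIII.coc5Astar s)) ∧
    (∀ s n l₀ : ℕ,
      VF3.HasCohomology (U := ⊤) (TypeIII.gen5C s n l₀) (TypeIII.coc5C s n l₀)) ∧
    (∀ s : ℕ, VF3.HasCohomology (U := ⊤) (TypeIII.gen5D s) (TypeIII.coc5D s)) ∧
    (∀ (ε : ℝ) (n : ℕ), ε ≠ 0 → 1 ≤ n →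
      VF3.HasCohomology (TypeIII.gen7C ε n) (TypeIII.coc7C ε n)) ∧
    (∀ a : ℝ, VF3.HasCohomology (U := ⊤) (TypeIII.gen17A₁ a) TypeIII.coc17A₁) ∧
    (∀ a : ℝ, a ≠ 0 →
      VF3.HasCohomology (U := ⊤) (TypeIII.gen17A₂ a) TypeIII.coc17A₂) ∧
    (∀ l₀ b₀ : ℕ,
      VF3.HasCohomology (U := ⊤) (TypeIII.gen17C l₀ b₀) (TypeIII.coc17C l₀ b₀)) ∧
    VF3.HasCohomology (U := ⊤) TypeIII.gen17D TypeIII.coc17D ∧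
    (∀ s t : ℕ, t ≤ s →
      (VF3.SpanIsLieAlgebra (U := ⊤) (TypeIII.gen5A s t) ↔ t = 0)) ∧
    (∀ s t n l₀ : ℕ, t ≤ s →
      ∀ S : Set (VF3.VF ⊤), S ⊆ TypeIII.extra5A s n l₀ →
        VF3.SpanIsLieAlgebra (TypeIII.gen5A s t ∪ S) → t = 0) ∧
    (∀ s : ℕ, Submodule.span ℝ (TypeIII.gen5A (U := ⊤) s 0) =
      Submodule.span ℝ (Set.range (TypeIII.gen5Astar (U := ⊤) s))) := by
  exact ⟨fun s t _ => TypeIII.hasCohomology_4A s t, TypeIII.hasCohomology_4C,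
    TypeIII.hasCohomology_4D, TypeIII.hasCohomology_5Astar, TypeIII.hasCohomology_5C,
    TypeIII.hasCohomology_5D, fun ε n hε _ => TypeIII.hasCohomology_7C hε n,
    TypeIII.hasCohomology_17A₁, fun a ha => TypeIII.hasCohomology_17A₂ ha,
    TypeIII.hasCohomology_17C, TypeIII.hasCohomology_17D,
    fun s t hts => TypeIII.spanIsLieAlgebra_gen5A_iff hts,
    fun s t n l₀ hts S hS h => TypeIII.eq_zero_of_spanIsLieAlgebra hts hS h,
    TypeIII.span_gen5A_zero⟩
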